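/- **Setting.** Let $\Omega\subset\mathbb R^2$ be a bounded Lipschitz domain with a macro-triangulation $\mathcal T^{\mathcal M}$ consisting of $n$ curvilinear quadrilaterals: there are maps $F_1,\dots,F_n$, each real analytic on $[0,1]^2$, injective there with non-vanishing Jacobian determinant, such that the open macro-elements $F_i((0,1)^2)\subset\Omega$ are pairwise disjoint, $\bigcup_i F_i([0,1]^2)=\overline\Omega$, any two closed macro-elements are disjoint or share exactly one vertex or exactly one entire edge, and the parametrizations of a common edge by the two element maps agree up to orientation. Let $\Lambda$ be a shape-regularity constant of $\mathcal T^{\mathcal M}$: $\|F_i'\|\le\Lambda$ and $\|(F_i')^{-1}\|\le\Lambda$ on $[0,1]^2$ for all $i$. **Refinement patterns.** Let $\sigma\in(0,1)$, $\kappa\in(0,1/2]$, $L\in\mathbb N_0$. The square $(0,\kappa)^2$ is refined geometrically with $L$ layers: with $h_l=\kappa\sigma^l$, it is split into the square $(0,h_L)^2$ and, for each $0\le l<L$ and with $h=h_{l+1}$, $H=h_l$, the four triangles with vertices $\{(h,0),(H,0),(h,h)\}$, $\{(h,h),(H,0),(H,H)\}$, $\{(h,h),(H,H),(0,H)\}$,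 $\{(0,h),(h,h),(0,H)\}$; these are the *corner* elements. The patterns on $(0,1)^2$ are: * *trivial*: one large element $(0,1)^2$; * *boundary layer*: anisotropic element $(0,1)\times(0,\kappa)$, large element $(0,1)\times(\kappa,1)$; * *tensor product*: large element $(\kappa,1)^2$, anisotropic elements $(\kappa,1)\times(0,\kappa)$ and $(0,\kappa)\times(\kappa,1)$, and the corner elements; * *mixed*: large triangles $\{(\kappa,\kappa),(1,\kappa),(1,1)\}$ and $\{(\kappa,\kappa),(1,1),(0,1)\}$, anisotropic elements $(\kappa,1)\times(0,\kappa)$ and the triangle $\{(0,\kappa),(\kappa,\kappa),(0,1)\}$, and the corner elements; * *geometric*: large triangles $\{(\kappa,\kappa),(1,0),(1,1)\}$ and $\{(\kappa,\kappa),(1,1),(0,1)\}$, anisotropic triangles $\{(\kappa,0),(1,0),(\kappa,\kappa)\}$ and $\{(0,\kappa),(\kappa,\kappa),(0,1)\}$, and the corner elements. **Mesh.** A *spectral boundary layer mesh* $\mathcal T(\kappa,\mathbf L)$, $\mathbf L=(L_1,\dots,L_n)\in\mathbb N_0^n$, is obtained by choosing for each $i$ one of the patterns with the parameters $\sigma,\kappa,L_i$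 and mapping it to $\Omega$ by $F_i$, such that the resulting mesh has no hanging nodes, and such that for each $i$, with $\Gamma_i:=F_i([0,1]^2)\cap\partial\Omega$, one of the following holds: $\Gamma_i=\emptyset$; or $\Gamma_i=\{F_i(0,0)\}$ and the pattern is tensor product, mixed or geometric; or $\Gamma_i=F_i([0,1]\times\{0\})$ and the pattern is boundary layer or mixed; or $\Gamma_i=F_i([0,1]\times\{0\}\cup\{0\}\times[0,1])$ and the pattern is tensor product. The element maps $F_K:\widehat K\to K$ are the affine maps from the reference square $(0,1)^2$ or the reference triangle $\{0<x<1,\,0<y<1-x\}$ onto the elements of the patterns, followed by the $F_i$. Let $\Omega_0$ be the interior of the union of the closed large elements. Let $$S^{p,1}(\mathcal T)=\{u\in H^1(\Omega): u\circ F_K\in\Pi_p(\widehat K)\ \ \forall K\},\qquad V_N:=S^{p,1}_0(\mathcal T)=S^{p,1}(\mathcal T)\cap H^1_0(\Omega),$$ where $\Pi_p(\widehat K)$ is the space of polynomials of degree at most $p$ in each variable on the square and of total degree at most $p$ on the triangle. Functions in $V_N$ are identified with their continuous representatives on $\overline\Omega$. For $\varepsilon\in(0,1]$ and a linear operator $\mathcal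 L:V_N|_{\partial\Omega_0}\to V_N$ put $$\|\mathcal L\|:=\sup_{v\in V_N:\,v|_{\partial\Omega_0}\neq0}\frac{\varepsilon^{1/2}|\mathcal Lv|_{H^1(\Omega\setminus\Omega_0)}+\varepsilon^{-1/2}\|\mathcal Lv\|_{L^2(\Omega\setminus\Omega_0)}}{\|v\|_{L^\infty(\partial\Omega_0)}},$$ $$\|\mathcal L\|_+:=\sup_{v\in V_N:\,v|_{\partial\Omega_0}\neq0}\frac{\|\mathcal Lv\|_{L^\infty(\Omega)}+\varepsilon^{1/2}|\mathcal Lv|_{H^1(\Omega\setminus\Omega_0)}+\varepsilon^{-1/2}\|\mathcal Lv\|_{L^2(\Omega\setminus\Omega_0)}}{\|v\|_{L^\infty(\partial\Omega_0)}}.$$ **Lemma.** There is a constant $C>0$, depending only on the number $n$ of macro-elements and on the shape-regularity constant $\Lambda$ of the macro-triangulation, such that for every $\sigma\in(0,1)$, $\kappa\in(0,1/2]$, $\mathbf L\in\mathbb N_0^n$, every spectral boundary layer mesh $\mathcal T(\kappa,\mathbf L)$ and every $p\ge1$, there is a linear lifting operator $\mathcal L_0:V_N|_{\partial\Omega_0}\to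 V_N$, i.e. $(\mathcal L_0g)|_{\partial\Omega_0}=g$ for all $g\in V_N|_{\partial\Omega_0}$, such that for every $\varepsilon\in(0,1]$ $$\|\mathcal L_0\|\le\|\mathcal L_0\|_+\le C\left(p^2\,\frac{\varepsilon^{1/2}}{\kappa^{1/2}}+\frac{\kappa^{1/2}}{\varepsilon^{1/2}}\right).$$ -/

import Mathlib

open Set Filter Topology MeasureTheory
open scoped ENNReal NNReal ContDiff Gradient

noncomputable section

namespace HpFEM

/-- The Euclidean plane. -/
abbrev Plane : Type := EuclideanSpace ℝ (Fin 2)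

/-! ### Sobolev spaces on a plane set, by weak derivatives -/

/-- `φ ∈ C_c^∞(Ω)`. -/
def IsTestFunction (Ω : Set Plane) (φ : Plane → ℝ) : Prop :=
  ContDiff ℝ ∞ φ ∧ HasCompactSupport φ ∧ tsupport φ ⊆ Ω

/-- `u ∈ H¹(Ω)` with weak gradient `G`: both are square integrable on `Ω` and
`∫_Ω u ∂_w φ = - ∫_Ω (G · w) φ` for all directions `w` and all test functions `φ`. -/
def IsH1WithGradient (Ω : Set Plane) (u : Plane → ℝ) (G : Plane → Plane) : Prop :=
  MemLp u 2 (volume.restrict Ω) ∧ MemLp G 2 (volume.restrict Ω) ∧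
    ∀ φ : Plane → ℝ, IsTestFunction Ω φ → ∀ w : Plane,
      ∫ x in Ω, u x * fderiv ℝ φ x w = - ∫ x in Ω, inner ℝ (G x) w * φ x

/-- `u` (with weak gradient `G`) is a limit in `H¹(Ω)` of test functions. -/
def IsH1LimitOfTestFunctions (Ω : Set Plane) (u : Plane → ℝ) (G : Plane → Plane) : Prop :=
  ∃ φ : ℕ → Plane → ℝ, (∀ m, IsTestFunction Ω (φ m)) ∧
    Tendsto (fun m => eLpNorm (fun x => u x - φ m x) 2 (volume.restrict Ω)) atTop (𝓝 0) ∧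
    Tendsto (fun m => eLpNorm (fun x => G x - ∇ (φ m) x) 2 (volume.restrict Ω)) atTop (𝓝 0)

theorem IsTestFunction.zero (Ω : Set Plane) : IsTestFunction Ω (fun _ => 0) := by
  refine ⟨contDiff_const, HasCompactSupport.zero, ?_⟩
  have : tsupport (fun _ : Plane => (0 : ℝ)) = ∅ := by
    rw [tsupport_eq_empty_iff]; rfl
  rw [this]; exact empty_subset _

theorem IsTestFunction.add {Ω : Set Plane} {φ ψ : Plane → ℝ}
    (hφ : IsTestFunction Ω φ) (hψ : IsTestFunction Ω ψ) :
    IsTestFunction Ω (fun x => φ x + ψ x) := by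
  refine ⟨hφ.1.add hψ.1, hφ.2.1.add hψ.2.1, ?_⟩
  exact (tsupport_add φ ψ).trans (union_subset hφ.2.2 hψ.2.2)

theorem IsTestFunction.const_mul {Ω : Set Plane} {φ : Plane → ℝ} (c : ℝ)
    (hφ : IsTestFunction Ω φ) : IsTestFunction Ω (fun x => c * φ x) := by
  refine ⟨contDiff_const.mul hφ.1, hφ.2.1.mul_left, ?_⟩
  exact (tsupport_mul_subset_right (f := fun _ : Plane => c) (g := φ)).trans hφ.2.2

theorem IsTestFunction.memLp {Ω : Set Plane} {φ : Plane → ℝ} (hφ : IsTestFunction Ω φ) :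
    MemLp φ 2 (volume.restrict Ω) :=
  (hφ.1.continuous.memLp_of_hasCompactSupport hφ.2.1).restrict Ω

theorem IsTestFunction.memLp_fderiv {Ω : Set Plane} {φ : Plane → ℝ}
    (hφ : IsTestFunction Ω φ) (w : Plane) :
    MemLp (fun x => fderiv ℝ φ x w) 2 (volume.restrict Ω) := by
  have hc : Continuous (fun x => fderiv ℝ φ x w) :=
    (hφ.1.continuous_fderiv (by simp)).clm_apply continuous_const
  exact (hc.memLp_of_hasCompactSupport (hφ.2.1.fderiv_apply (𝕜 := ℝ) w)).restrict Ω

theorem IsTestFunction.gradient_add {Ω : Set Plane} {φ ψ : Plane → ℝ}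
    (hφ : IsTestFunction Ω φ) (hψ : IsTestFunction Ω ψ) (x : Plane) :
    ∇ (fun y => φ y + ψ y) x = ∇ φ x + ∇ ψ x := by
  have h1 := (hφ.1.differentiable (by simp)) x
  have h2 := (hψ.1.differentiable (by simp)) x
  simp only [gradient]
  rw [fderiv_fun_add h1 h2, map_add]

theorem IsTestFunction.gradient_const_mul {Ω : Set Plane} {φ : Plane → ℝ}
    (hφ : IsTestFunction Ω φ) (c : ℝ) (x : Plane) :
    ∇ (fun y => c * φ y) x = c • ∇ φ x := by
  have h1 := (hφ.1.differentiable (by simp)) x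
  simp only [gradient]
  rw [fderiv_const_mul h1]
  simp

theorem IsTestFunction.memLp_gradient {Ω : Set Plane} {φ : Plane → ℝ}
    (hφ : IsTestFunction Ω φ) : MemLp (∇ φ) 2 (volume.restrict Ω) := by
  have hc : Continuous (∇ φ) := by
    unfold gradient
    exact (LinearIsometryEquiv.continuous _).comp (hφ.1.continuous_fderiv (by simp))
  have hs : HasCompactSupport (∇ φ) := by
    have h := hφ.2.1.fderiv (𝕜 := ℝ)
    exact h.comp_left (g := fun l => (InnerProductSpace.toDual ℝ Plane).symm l) (by simp)
  exact (hc.memLp_of_hasCompactSupport hs).restrict Ω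

theorem IsH1WithGradient.zero (Ω : Set Plane) : IsH1WithGradient Ω 0 0 := by
  refine ⟨MemLp.zero, MemLp.zero, ?_⟩
  intro φ _ w
  simp

theorem IsH1WithGradient.add {Ω : Set Plane} {u v : Plane → ℝ} {G H : Plane → Plane}
    (hu : IsH1WithGradient Ω u G) (hv : IsH1WithGradient Ω v H) :
    IsH1WithGradient Ω (u + v) (G + H) := by
  refine ⟨hu.1.add hv.1, hu.2.1.add hv.2.1, ?_⟩
  intro φ hφ w
  have i1 := MemLp.integrable_mul hu.1 (hφ.memLp_fderiv w)
  have i2 := MemLp.integrable_mul hv.1 (hφ.memLp_fderiv w)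
  have i3 := MemLp.integrable_mul (hu.2.1.inner_const w (𝕜 := ℝ)) hφ.memLp
  have i4 := MemLp.integrable_mul (hv.2.1.inner_const w (𝕜 := ℝ)) hφ.memLp
  have e1 := integral_add i1 i2
  have e2 := integral_add i3 i4
  simp only [Pi.mul_apply, Pi.add_apply, inner_add_left, add_mul] at e1 e2 ⊢
  rw [e1, e2, hu.2.2 φ hφ w, hv.2.2 φ hφ w]
  ring

theorem IsH1WithGradient.smul {Ω : Set Plane} {u : Plane → ℝ} {G : Plane → Plane} (c : ℝ)
    (hu : IsH1WithGradient Ω u G) : IsH1WithGradient Ω (c • u) (c • G) := by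
  refine ⟨hu.1.const_smul c, hu.2.1.const_smul c, ?_⟩
  intro φ hφ w
  simp only [Pi.smul_apply, smul_eq_mul, real_inner_smul_left, mul_assoc]
  rw [integral_const_mul, integral_const_mul, hu.2.2 φ hφ w]
  ring

theorem tendsto_eLpNorm_add {F : Type*} [NormedAddCommGroup F] {μ : Measure Plane}
    {f g : ℕ → Plane → F} (hf : ∀ m, AEStronglyMeasurable (f m) μ)
    (hg : ∀ m, AEStronglyMeasurable (g m) μ)
    (h1 : Tendsto (fun m => eLpNorm (f m) 2 μ) atTop (𝓝 0))
    (h2 : Tendsto (fun m => eLpNorm (g m) 2 μ) atTop (𝓝 0)) :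
    Tendsto (fun m => eLpNorm (f m + g m) 2 μ) atTop (𝓝 0) := by
  have h := h1.add h2
  rw [add_zero] at h
  exact tendsto_of_tendsto_of_tendsto_of_le_of_le tendsto_const_nhds h (fun _ => bot_le)
    (fun m => eLpNorm_add_le (hf m) (hg m) (by norm_num))

theorem tendsto_eLpNorm_smul {F : Type*} [NormedAddCommGroup F] [NormedSpace ℝ F]
    {μ : Measure Plane} {f : ℕ → Plane → F} (c : ℝ)
    (h1 : Tendsto (fun m => eLpNorm (f m) 2 μ) atTop (𝓝 0)) :
    Tendsto (fun m => eLpNorm (c • f m) 2 μ) atTop (𝓝 0) := by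
  simp only [eLpNorm_const_smul]
  have h := ENNReal.Tendsto.const_mul (a := ‖c‖ₑ) h1 (Or.inr enorm_ne_top)
  rwa [mul_zero] at h

/-- The Sobolev space `H¹(Ω)`. -/
def sobolevH1 (Ω : Set Plane) : Submodule ℝ (Plane → ℝ) where
  carrier := {u | ∃ G, IsH1WithGradient Ω u G}
  zero_mem' := ⟨0, IsH1WithGradient.zero Ω⟩
  add_mem' := by
    rintro u v ⟨G, hG⟩ ⟨H, hH⟩
    exact ⟨G + H, hG.add hH⟩
  smul_mem' := by
    rintro c u ⟨G, hG⟩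
    exact ⟨c • G, hG.smul c⟩

/-- The Sobolev space `H¹₀(Ω)`, the closure of `C_c^∞(Ω)` in `H¹(Ω)`. -/
def sobolevH10 (Ω : Set Plane) : Submodule ℝ (Plane → ℝ) where
  carrier := {u | ∃ G, IsH1WithGradient Ω u G ∧ IsH1LimitOfTestFunctions Ω u G}
  zero_mem' := by
    refine ⟨0, IsH1WithGradient.zero Ω, fun _ _ => 0, fun _ => IsTestFunction.zero Ω, ?_, ?_⟩
    · simp
    · have : ∀ x : Plane, ∇ (fun _ : Plane => (0 : ℝ)) x = 0 := by
        intro x; simp [gradient]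
      simp [this]
  add_mem' := by
    rintro u v ⟨G, hG, φ, hφ, a1, a2⟩ ⟨H, hH, ψ, hψ, b1, b2⟩
    refine ⟨G + H, hG.add hH, fun m x => φ m x + ψ m x, fun m => (hφ m).add (hψ m), ?_, ?_⟩
    · have := tendsto_eLpNorm_add (fun m => (hG.1.sub (hφ m).memLp).1)
        (fun m => (hH.1.sub (hψ m).memLp).1) a1 b1
      refine Tendsto.congr (fun m => ?_) this
      refine congrArg (fun f => eLpNorm f 2 (volume.restrict Ω)) ?_
      funext x
      simp only [Pi.add_apply, Pi.sub_apply]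
      ring
    · have := tendsto_eLpNorm_add (fun m => (hG.2.1.sub (hφ m).memLp_gradient).1)
        (fun m => (hH.2.1.sub (hψ m).memLp_gradient).1) a2 b2
      refine Tendsto.congr (fun m => ?_) this
      refine congrArg (fun f => eLpNorm f 2 (volume.restrict Ω)) ?_
      funext x
      simp only [Pi.add_apply, Pi.sub_apply, (hφ m).gradient_add (hψ m)]
      abel
  smul_mem' := by
    rintro c u ⟨G, hG, φ, hφ, a1, a2⟩
    refine ⟨c • G, hG.smul c, fun m x => c * φ m x, fun m => (hφ m).const_mul c, ?_, ?_⟩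
    · refine Tendsto.congr (fun m => ?_) (tendsto_eLpNorm_smul c a1)
      refine congrArg (fun f => eLpNorm f 2 (volume.restrict Ω)) ?_
      funext x
      simp only [Pi.smul_apply, smul_eq_mul]
      ring
    · refine Tendsto.congr (fun m => ?_) (tendsto_eLpNorm_smul c a2)
      refine congrArg (fun f => eLpNorm f 2 (volume.restrict Ω)) ?_
      funext x
      simp only [Pi.smul_apply, (hφ m).gradient_const_mul c, smul_sub]

/-- The seminorm `|u|_{H¹(D)} = ‖∇u‖_{L²(D)}` of `u ∈ H¹(Ω)` on a subset `D` of `Ω`. The weak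
gradient is unique up to null sets, so that the infimum is over equal values; it is `∞` when
`u ∉ H¹(Ω)`. -/
def h1Seminorm (Ω D : Set Plane) (u : Plane → ℝ) : ℝ≥0∞ :=
  ⨅ (G : Plane → Plane) (_ : IsH1WithGradient Ω u G), eLpNorm G 2 (volume.restrict D)

/-- A bounded Lipschitz domain: near each boundary point, and in suitable Cartesian coordinates,
`Ω` is the set of points above the graph of a Lipschitz function. -/
structure IsBoundedLipschitzDomain (Ω : Set Plane) : Prop where
  isOpen : IsOpen Ω
  isConnected : IsConnected Ω
  isBounded : Bornology.IsBounded Ω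
  lipschitz : ∀ x ∈ frontier Ω, ∃ (A : Plane ≃ₗᵢ[ℝ] Plane) (r : ℝ) (c : ℝ≥0) (g : ℝ → ℝ),
    0 < r ∧ LipschitzWith c g ∧
      Ω ∩ Metric.ball x r = {y ∈ Metric.ball x r | g ((A y) 0) < (A y) 1}

/-! ### Reference cells -/

/-- The two reference cells: the square `(0,1)²` and the triangle `{0 < x < 1, 0 < y < 1 - x}`. -/
inductive Shape where
  | square
  | triangle

/-- The open reference cell. -/
def Shape.cell : Shape → Set Plane
  | .square => {z | 0 < z 0 ∧ z 0 < 1 ∧ 0 < z 1 ∧ z 1 < 1}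
  | .triangle => {z | 0 < z 0 ∧ z 0 < 1 ∧ 0 < z 1 ∧ z 1 < 1 - z 0}

/-- The closed reference cell. -/
def Shape.closedCell : Shape → Set Plane
  | .square => {z | 0 ≤ z 0 ∧ z 0 ≤ 1 ∧ 0 ≤ z 1 ∧ z 1 ≤ 1}
  | .triangle => {z | 0 ≤ z 0 ∧ z 0 ≤ 1 ∧ 0 ≤ z 1 ∧ z 1 ≤ 1 - z 0}

/-- The vertices of the reference cell. -/
def Shape.vertices : Shape → List Plane
  | .square => [!₂[0, 0], !₂[1, 0], !₂[1, 1], !₂[0, 1]]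
  | .triangle => [!₂[0, 0], !₂[1, 0], !₂[0, 1]]

/-- The edges of the reference cell, as pairs of end points. -/
def Shape.edges : Shape → List (Plane × Plane)
  | .square => [(!₂[0, 0], !₂[1, 0]), (!₂[1, 0], !₂[1, 1]), (!₂[0, 1], !₂[1, 1]),
      (!₂[0, 0], !₂[0, 1])]
  | .triangle => [(!₂[0, 0], !₂[1, 0]), (!₂[1, 0], !₂[0, 1]), (!₂[0, 0], !₂[0, 1])]

/-- The closed edge with the given end points. -/
def edgeSet (e : Plane × Plane) : Set Plane := segment ℝ e.1 e.2

/-- The polynomial space on a reference cell: `Q_p` on the square, `P_p` on the triangle. -/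
def Shape.polynomials : Shape → ℕ → Submodule ℝ (MvPolynomial (Fin 2) ℝ)
  | .square, p => MvPolynomial.restrictDegree (Fin 2) ℝ p
  | .triangle, p => MvPolynomial.restrictTotalDegree (Fin 2) ℝ p

/-- The closed elements `f(s)` and `g(t)` are disjoint, or share exactly one common vertex, or
share exactly one common entire edge. -/
def MeetRegularly (s t : Shape) (f g : Plane → Plane) : Prop :=
  f '' s.closedCell ∩ g '' t.closedCell = ∅ ∨
  (∃ a ∈ s.vertices, ∃ b ∈ t.vertices,
    f '' s.closedCell ∩ g '' t.closedCell = {f a} ∧ f a = g b) ∨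
  (∃ e ∈ s.edges, ∃ e' ∈ t.edges,
    f '' s.closedCell ∩ g '' t.closedCell = f '' edgeSet e ∧ f '' edgeSet e = g '' edgeSet e')

/-! ### Macro-triangulations -/

/-- A macro-triangulation of `Ω` by `n` curvilinear quadrilaterals with analytic element maps. -/
structure MacroTriangulation (Ω : Set Plane) (n : ℕ) where
  /-- The element maps. -/
  F : Fin n → Plane → Plane
  analytic : ∀ i, AnalyticOnNhd ℝ (F i) Shape.square.closedCell
  injOn : ∀ i, InjOn (F i) Shape.square.closedCell
  det_ne_zero : ∀ i, ∀ z ∈ Shape.square.closedCell, (fderiv ℝ (F i) z).det ≠ 0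
  subset : ∀ i, F i '' Shape.square.cell ⊆ Ω
  disjoint : ∀ i j, i ≠ j → Disjoint (F i '' Shape.square.cell) (F j '' Shape.square.cell)
  cover : ⋃ i, F i '' Shape.square.closedCell = closure Ω
  /-- There are no hanging nodes. -/
  regular : ∀ i j, i ≠ j → MeetRegularly .square .square (F i) (F j)
  /-- The two parametrizations of a common edge agree up to orientation. -/
  compatible : ∀ i j, i ≠ j → ∀ e ∈ Shape.square.edges, ∀ e' ∈ Shape.square.edges,
    F i '' edgeSet e = F j '' edgeSet e' →
      (∀ t ∈ Icc (0 : ℝ) 1,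
        F i (AffineMap.lineMap e.1 e.2 t) = F j (AffineMap.lineMap e'.1 e'.2 t)) ∨
      (∀ t ∈ Icc (0 : ℝ) 1,
        F i (AffineMap.lineMap e.1 e.2 t) = F j (AffineMap.lineMap e'.1 e'.2 (1 - t)))

/-- `Λ` is a shape-regularity constant of the macro-triangulation: the Jacobians of the element
maps and their inverses are bounded by `Λ` on the closed reference square. -/
def MacroTriangulation.ShapeRegular {Ω : Set Plane} {n : ℕ} (T : MacroTriangulation Ω n)
    (Λ : ℝ) : Prop :=
  ∀ i, ∀ z ∈ Shape.square.closedCell, ∀ w : Plane,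
    ‖fderiv ℝ (T.F i) z w‖ ≤ Λ * ‖w‖ ∧ ‖w‖ ≤ Λ * ‖fderiv ℝ (T.F i) z w‖

/-! ### Refinement patterns of the reference square -/

/-- Large elements, anisotropic elements and corner layer elements. -/
inductive ElementKind where
  | large
  | aniso
  | corner

/-- An element of a refinement pattern: the image of a reference cell under the affine map
`(x, y) ↦ origin + x • dirX + y • dirY`. -/
structure PatchElement where
  kind : ElementKind
  shape : Shape
  origin : Plane
  dirX : Plane
  dirY : Plane

/-- The affine map from the reference cell onto the element of the pattern. -/
def PatchElement.map (e : PatchElement) (z : Plane) : Plane :=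
  e.origin + z 0 • e.dirX + z 1 • e.dirY

/-- The rectangle `(x₀, x₁) × (y₀, y₁)`. -/
def rectangle (k : ElementKind) (x₀ x₁ y₀ y₁ : ℝ) : PatchElement :=
  ⟨k, .square, !₂[x₀, y₀], !₂[x₁ - x₀, 0], !₂[0, y₁ - y₀]⟩

/-- The triangle with vertices `P`, `Q`, `R`. -/
def triangle (k : ElementKind) (P Q R : Plane) : PatchElement :=
  ⟨k, .triangle, P, Q - P, R - P⟩

/-- One layer `(0, H)² ∖ (0, h]²` of a geometric refinement, in four triangles. -/
def cornerLayer (h H : ℝ) : List PatchElement :=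
  [triangle .corner !₂[h, 0] !₂[H, 0] !₂[h, h],
   triangle .corner !₂[h, h] !₂[H, 0] !₂[H, H],
   triangle .corner !₂[h, h] !₂[H, H] !₂[0, H],
   triangle .corner !₂[0, h] !₂[h, h] !₂[0, H]]

/-- The geometric refinement of `(0, κ)²` towards the origin with `L` layers and grading
factor `σ`. -/
def cornerMesh (σ κ : ℝ) (L : ℕ) : List PatchElement :=
  rectangle .corner 0 (κ * σ ^ L) 0 (κ * σ ^ L) ::
    (List.range L).flatMap fun l => cornerLayer (κ * σ ^ (l + 1)) (κ * σ ^ l)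

/-- The five types of refinement patterns. -/
inductive Pattern where
  | trivial
  | boundaryLayer
  | tensorProduct
  | mixed
  | geometric

/-- The elements of a refinement pattern. -/
def Pattern.elements (σ κ : ℝ) (L : ℕ) : Pattern → List PatchElement
  | .trivial => [rectangle .large 0 1 0 1]
  | .boundaryLayer => [rectangle .aniso 0 1 0 κ, rectangle .large 0 1 κ 1]
  | .tensorProduct =>
      rectangle .large κ 1 κ 1 :: rectangle .aniso κ 1 0 κ :: rectangle .aniso 0 κ κ 1 ::
        cornerMesh σ κ L
  | .mixed =>
      triangle .large !₂[κ, κ] !₂[1, κ] !₂[1, 1] :: triangle .large !₂[κ, κ] !₂[1, 1] !₂[0, 1] ::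
        rectangle .aniso κ 1 0 κ :: triangle .aniso !₂[0, κ] !₂[κ, κ] !₂[0, 1] ::
        cornerMesh σ κ L
  | .geometric =>
      triangle .large !₂[κ, κ] !₂[1, 0] !₂[1, 1] :: triangle .large !₂[κ, κ] !₂[1, 1] !₂[0, 1] ::
        triangle .aniso !₂[κ, 0] !₂[1, 0] !₂[κ, κ] :: triangle .aniso !₂[0, κ] !₂[κ, κ] !₂[0, 1] ::
        cornerMesh σ κ L

/-! ### Spectral boundary layer meshes -/

/-- The elements of the mesh that results from refining the `i`-th macro-element by the pattern
`P i` with `L i` layers: pairs of a macro-element and an element of its pattern. -/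
def meshElements {n : ℕ} (P : Fin n → Pattern) (σ κ : ℝ) (L : Fin n → ℕ) :
    Set (Fin n × PatchElement) :=
  {K | K.2 ∈ (P K.1).elements σ κ (L K.1)}

/-- The element maps: affine maps followed by the macro-element maps. -/
def MacroTriangulation.elementMap {Ω : Set Plane} {n : ℕ} (T : MacroTriangulation Ω n)
    (K : Fin n × PatchElement) (z : Plane) : Plane :=
  T.F K.1 (K.2.map z)

/-- The closed `i`-th macro-element intersected with `∂Ω`. -/
def MacroTriangulation.boundaryPart {Ω : Set Plane} {n : ℕ} (T : MacroTriangulation Ω n)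
    (i : Fin n) : Set Plane :=
  T.F i '' Shape.square.closedCell ∩ frontier Ω

/-- A spectral boundary layer mesh `𝒯(κ, L)` on a macro-triangulation. -/
structure SpectralBoundaryLayerMesh {Ω : Set Plane} {n : ℕ} (T : MacroTriangulation Ω n)
    (σ κ : ℝ) (L : Fin n → ℕ) where
  /-- The refinement pattern chosen for each macro-element. -/
  pattern : Fin n → Pattern
  /-- The mesh has no hanging nodes. -/
  regular : ∀ K ∈ meshElements pattern σ κ L, ∀ K' ∈ meshElements pattern σ κ L, K ≠ K' →
    MeetRegularly K.2.shape K'.2.shape (T.elementMap K) (T.elementMap K')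
  /-- A macro-element meets `∂Ω` not at all, or in exactly one vertex, or in exactly one edge, or
  in exactly two adjacent edges; this restricts the orientation and the pattern. -/
  boundary : ∀ i,
    T.boundaryPart i = ∅ ∨
    (T.boundaryPart i = {T.F i !₂[0, 0]} ∧
      (pattern i = .tensorProduct ∨ pattern i = .mixed ∨ pattern i = .geometric)) ∨
    (T.boundaryPart i = T.F i '' segment ℝ !₂[0, 0] !₂[1, 0] ∧
      (pattern i = .boundaryLayer ∨ pattern i = .mixed)) ∨
    (T.boundaryPart i =
        T.F i '' (segment ℝ !₂[0, 0] !₂[1, 0] ∪ segment ℝ !₂[0, 0] !₂[0, 1]) ∧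
      pattern i = .tensorProduct)

namespace SpectralBoundaryLayerMesh

variable {Ω : Set Plane} {n : ℕ} {T : MacroTriangulation Ω n} {σ κ : ℝ} {L : Fin n → ℕ}

/-- The elements of the mesh. -/
def elements (M : SpectralBoundaryLayerMesh T σ κ L) : Set (Fin n × PatchElement) :=
  meshElements M.pattern σ κ L

/-- `Ω₀`, the interior of the union of the closed large elements. -/
def Ω₀ (M : SpectralBoundaryLayerMesh T σ κ L) : Set Plane :=
  interior (⋃ K ∈ {K ∈ M.elements | K.2.kind = .large},
    T.elementMap K '' K.2.shape.closedCell)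

/-- The space `S^{p,1}(𝒯)` of functions in `H¹(Ω)` whose pull-backs to the reference cells are
polynomials of degree `p`. A function is represented by its version that is continuous on the
closure of `Ω`, extended by zero. -/
def S (M : SpectralBoundaryLayerMesh T σ κ L) (p : ℕ) : Submodule ℝ (Plane → ℝ) where
  carrier := {u | u ∈ sobolevH1 Ω ∧ ContinuousOn u (closure Ω) ∧ (∀ x ∉ closure Ω, u x = 0) ∧
    ∀ K ∈ M.elements, ∃ q ∈ K.2.shape.polynomials p,
      ∀ z ∈ K.2.shape.cell, u (T.elementMap K z) = MvPolynomial.eval (fun i => z i) q}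
  zero_mem' := by
    refine ⟨Submodule.zero_mem _, continuousOn_const, fun _ _ => rfl, fun K _ => ?_⟩
    exact ⟨0, Submodule.zero_mem _, by simp⟩
  add_mem' := by
    rintro u v ⟨u1, u2, u3, u4⟩ ⟨v1, v2, v3, v4⟩
    refine ⟨Submodule.add_mem _ u1 v1, u2.add v2, fun x hx => ?_, fun K hK => ?_⟩
    · simp [u3 x hx, v3 x hx]
    · obtain ⟨q, hq, eq⟩ := u4 K hK
      obtain ⟨r, hr, er⟩ := v4 K hK
      exact ⟨q + r, Submodule.add_mem _ hq hr, fun z hz => by simp [eq z hz, er z hz]⟩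
  smul_mem' := by
    rintro c u ⟨u1, u2, u3, u4⟩
    refine ⟨Submodule.smul_mem _ c u1, u2.const_smul c, fun x hx => ?_, fun K hK => ?_⟩
    · simp [u3 x hx]
    · obtain ⟨q, hq, eq⟩ := u4 K hK
      exact ⟨c • q, Submodule.smul_mem _ c hq, fun z hz => by
        simp [eq z hz, MvPolynomial.smul_eval]⟩

/-- The finite element space `V_N = S^{p,1}_0(𝒯) = S^{p,1}(𝒯) ∩ H¹₀(Ω)`. -/
def S₀ (M : SpectralBoundaryLayerMesh T σ κ L) (p : ℕ) : Submodule ℝ (Plane → ℝ) :=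
  M.S p ⊓ sobolevH10 Ω

/-- The restriction `v ↦ v|_{∂Ω₀}`. -/
def restrict (M : SpectralBoundaryLayerMesh T σ κ L) :
    (Plane → ℝ) →ₗ[ℝ] (frontier M.Ω₀ → ℝ) :=
  LinearMap.funLeft ℝ ℝ Subtype.val

/-- The space `V_N|_{∂Ω₀}`. -/
def traceSpace (M : SpectralBoundaryLayerMesh T σ κ L) (p : ℕ) :
    Submodule ℝ (frontier M.Ω₀ → ℝ) :=
  (M.S₀ p).map M.restrict

/-- The trace of `v ∈ V_N` as an element of `V_N|_{∂Ω₀}`. -/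
def trace (M : SpectralBoundaryLayerMesh T σ κ L) (p : ℕ) (v : M.S₀ p) : M.traceSpace p :=
  ⟨M.restrict v, Submodule.mem_map_of_mem v.2⟩

/-- `ε^{1/2} |w|_{H¹(Ω∖Ω₀)} + ε^{-1/2} ‖w‖_{L²(Ω∖Ω₀)}`. -/
def layerNorm (M : SpectralBoundaryLayerMesh T σ κ L) (ε : ℝ) (w : Plane → ℝ) : ℝ≥0∞ :=
  ENNReal.ofReal (ε ^ (1 / 2 : ℝ)) * h1Seminorm Ω (Ω \ M.Ω₀) w +
    ENNReal.ofReal (ε ^ (-(1 / 2) : ℝ)) * eLpNorm w 2 (volume.restrict (Ω \ M.Ω₀))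

/-- `‖g‖_{L^∞(∂Ω₀)}` for a function `g` in `V_N|_{∂Ω₀}`; such `g` are continuous. -/
def boundarySup (M : SpectralBoundaryLayerMesh T σ κ L) (g : frontier M.Ω₀ → ℝ) : ℝ≥0∞ :=
  ⨆ x, ‖g x‖ₑ

/-- The operator norm `‖𝓛‖`. -/
def liftingNorm (M : SpectralBoundaryLayerMesh T σ κ L) (p : ℕ) (ε : ℝ)
    (Lift : M.traceSpace p →ₗ[ℝ] M.S₀ p) : ℝ≥0∞ :=
  ⨆ (v : M.S₀ p) (_ : M.trace p v ≠ 0),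
    M.layerNorm ε (Lift (M.trace p v) : Plane → ℝ) / M.boundarySup (M.trace p v)

/-- The operator norm `‖𝓛‖₊`. -/
def liftingNormPlus (M : SpectralBoundaryLayerMesh T σ κ L) (p : ℕ) (ε : ℝ)
    (Lift : M.traceSpace p →ₗ[ℝ] M.S₀ p) : ℝ≥0∞ :=
  ⨆ (v : M.S₀ p) (_ : M.trace p v ≠ 0),
    (eLpNorm (Lift (M.trace p v) : Plane → ℝ) ∞ (volume.restrict Ω) +
      M.layerNorm ε (Lift (M.trace p v) : Plane → ℝ)) / M.boundarySup (M.trace p v)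

end SpectralBoundaryLayerMesh

end HpFEM

end

/-!
The data `g` on `∂Ω₀`, bounded by `B`, are lifted element by element. The boundary `∂Ω₀` consists
of the common points of large and other elements (`mem_frontier_Ω₀_iff`), and as there are no
hanging nodes, an edge that has an inner point in `∂Ω₀` lies in `∂Ω₀`. On such an edge the lifting
is `g`; on every other edge it is the linear interpolant of nodal values (`edgeValue`); inside an
element it is the transfinite interpolation of its edge values on a square, and linear interpolation
plus edge bubbles on a triangle (`Shape.lift`). The nodal values are those of `g`, extended by zero
off `∂Ω₀`, except in the geometrically refined squares `[0, κ]²`, where they are read off the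
function that is affine on both sides of the diagonal and interpolates the values in the four
corners (`nodalValue`). Since the meshes in these squares resolve the diagonal, the lifting coincides
there with this function as soon as `L ≥ 1`: no edge of such a refinement lies in `∂Ω₀`
(`not_subset_frontier_of_corner`). So neither the grading factor nor the number of layers enters.

The lifting is conforming: common points of two elements are inner points, points of common edges,
or common vertices, and the values agree there (`elementLift_eq`). It vanishes on `∂Ω`
(`globalLift_eq_zero`), and it is a polynomial of the right degree on each element
(`exists_elementLift_polynomial`). Being Lipschitz on finitely many closed sets that cover the
plane, it is Lipschitz, and a Lipschitz function that vanishes outside a bounded open set is in `H¹₀`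
(`lipschitz_mem_sobolev`).

For the bounds, the values of the lifting are at most `7 B` by construction. An element that is not
large either has two axis-parallel sides of length at least `κ`, so that Markov's inequality
bounds the gradient of a polynomial of degree `p` by a multiple of `p² B / κ`, or it belongs to a
corner refinement with `L ≥ 1`, where the gradient of the interpolant is at most a multiple of `B / κ`
(`diagonal_or_corner`, `norm_fderiv_globalLift_le`). The area of `Ω \ Ω₀` is at most a multiple
of `κ` (`volume_diff_le`), so the `H¹` seminorm is of order `p² B κ^{-1/2}` and the `L²` norm of
order `B κ^{1/2}` (`norms_globalLift_le`). Weighted with `ε^{1/2}` and `ε^{-1/2}` these are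
the two terms of the claim, and the supremum is absorbed because
`ε^{1/2} / κ^{1/2} + κ^{1/2} / ε^{1/2} ≥ 1` (`sum_norms_le`).
-/

noncomputable section

namespace HpFEM

/-! ### Gluing Lipschitz functions -/

/-- In a normed space, a function that is `C`-Lipschitz on each set of a finite closed cover is
`C`-Lipschitz: the estimate propagates along the segment between two points by continuous
induction. -/
theorem lipschitzWith_of_finite_closed_cover {E ι : Type*} [NormedAddCommGroup E]
    [NormedSpace ℝ E] [Finite ι] {f : E → ℝ} {S : ι → Set E} {C : ℝ≥0}
    (hS : ∀ k, IsClosed (S k)) (hcov : ⋃ k, S k = univ) (hf : ∀ k, LipschitzOnWith C f (S k)) :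
    LipschitzWith C f := by
  have hcont : Continuous f :=
    (locallyFinite_of_finite S).continuous hcov hS (fun k => (hf k).continuousOn)
  refine LipschitzWith.of_dist_le_mul fun x y => ?_
  set γ : ℝ → E := fun t => AffineMap.lineMap x y t with hγ
  have hγc : Continuous γ := AffineMap.lineMap_continuous
  set s : Set ℝ := {t | dist (f x) (f (γ t)) ≤ C * (t * dist x y)} with hs
  have hsc : IsClosed s := isClosed_le (by fun_prop) (by fun_prop)
  have key : Icc (0 : ℝ) 1 ⊆ s := by
    refine IsClosed.Icc_subset_of_forall_exists_gt (hsc.inter isClosed_Icc)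
      (by simp [hs, hγ]) ?_
    rintro t ⟨ht, ht0, ht1⟩ b (hb : t < b)
    have h1 : ∃ k, ∃ᶠ r in 𝓝[>] t, γ r ∈ S k := by
      rw [← frequently_exists]
      refine Eventually.frequently (Eventually.of_forall fun r => ?_)
      simpa using (hcov.symm ▸ mem_univ (γ r) : γ r ∈ ⋃ k, S k)
    obtain ⟨k, hk⟩ := h1
    have h2 : γ t ∈ S k := by
      refine (hS k).mem_of_frequently_of_tendsto hk ?_
      exact (hγc.tendsto t).mono_left nhdsWithin_le_nhds
    obtain ⟨r, hr, hr'⟩ := (hk.and_eventually (Ioc_mem_nhdsGT hb)).exists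
    refine ⟨r, ?_, hr'⟩
    have h3 := (hf k).dist_le_mul _ h2 _ hr
    have h4 : dist (γ t) (γ r) = (r - t) * dist x y := by
      simp only [hγ, dist_lineMap_lineMap, Real.dist_eq]
      rw [abs_sub_comm, abs_of_pos (sub_pos.2 hr'.1)]
    calc dist (f x) (f (γ r)) ≤ dist (f x) (f (γ t)) + dist (f (γ t)) (f (γ r)) :=
          dist_triangle _ _ _
      _ ≤ C * (t * dist x y) + C * ((r - t) * dist x y) := by
          rw [h4] at h3; exact add_le_add ht h3
      _ = C * (r * dist x y) := by ring
  simpa [hs, hγ] using key (right_mem_Icc.2 zero_le_one)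

/-! ### Lipschitz functions in Sobolev spaces -/

theorem tendsto_eLpNorm_two_of_bounded {α F : Type*} [MeasurableSpace α] [NormedAddCommGroup F]
    {μ : Measure α} [IsFiniteMeasure μ] {f : ℕ → α → F} {B : ℝ}
    (hf : ∀ m, AEStronglyMeasurable (f m) μ) (hB : ∀ m, ∀ᵐ x ∂μ, ‖f m x‖ ≤ B)
    (hlim : ∀ᵐ x ∂μ, Tendsto (fun m => f m x) atTop (𝓝 0)) :
    Tendsto (fun m => eLpNorm (f m) 2 μ) atTop (𝓝 0) := by
  simp only [eLpNorm_eq_lintegral_rpow_enorm_toReal (p := 2) (by norm_num) (by norm_num)]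
  have h : Tendsto (fun m => ∫⁻ x, ‖f m x‖ₑ ^ (2 : ℝ≥0∞).toReal ∂μ) atTop (𝓝 (∫⁻ _, 0 ∂μ)) := by
    refine tendsto_lintegral_of_dominated_convergence' (fun _ => ENNReal.ofReal B ^ (2 : ℝ≥0∞).toReal)
      (fun m => (hf m).enorm.pow_const _) (fun m => ?_) ?_ ?_
    · filter_upwards [hB m] with x hx
      gcongr
      rw [← ofReal_norm]
      exact ENNReal.ofReal_le_ofReal hx
    · rw [lintegral_const]
      exact ENNReal.mul_ne_top (by simp) (measure_ne_top _ _)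
    · filter_upwards [hlim] with x hx
      have h1 : Tendsto (fun m => ‖f m x‖ₑ) atTop (𝓝 0) := by
        simpa using hx.enorm
      have h2 := ((ENNReal.continuous_rpow_const (y := (2 : ℝ≥0∞).toReal)).tendsto 0).comp h1
      simpa [Function.comp_def] using h2
  rw [lintegral_zero] at h
  have h2 := ((ENNReal.continuous_rpow_const (y := 1 / (2 : ℝ≥0∞).toReal)).tendsto 0).comp h
  simpa [Function.comp_def] using h2

theorem norm_gradient_sub_eq (u v : Plane → ℝ) (x : Plane) :
    ‖∇ u x - ∇ v x‖ = ‖fderiv ℝ u x - fderiv ℝ v x‖ := by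
  simp only [gradient, ← map_sub, LinearIsometryEquiv.norm_map]

theorem norm_gradient_eq (u : Plane → ℝ) (x : Plane) : ‖∇ u x‖ = ‖fderiv ℝ u x‖ := by
  simp only [gradient, LinearIsometryEquiv.norm_map]

theorem measurable_gradient (u : Plane → ℝ) : Measurable (∇ u) := by
  unfold gradient
  exact (LinearIsometryEquiv.continuous _).measurable.comp (measurable_fderiv ℝ u)

open ContinuousLinearMap in
/-- A compactly supported Lipschitz function is a limit of test functions: its mollifications
converge, and so do their derivatives, which are mollifications of the (bounded) derivative. -/
theorem exists_testFunctions_of_lipschitz {Ω : Set Plane} (hΩ : IsOpen Ω)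
    (hb : Bornology.IsBounded Ω) {w : Plane → ℝ} {K : ℝ≥0} (hw : LipschitzWith K w)
    (hc : HasCompactSupport w) (hs : tsupport w ⊆ Ω) :
    IsH1LimitOfTestFunctions Ω w (∇ w) := by
  obtain ⟨δ, hδ, hδΩ⟩ := hc.isCompact.exists_cthickening_subset_open hΩ hs
  have hfin : IsFiniteMeasure (volume.restrict Ω) :=
    ⟨by rw [Measure.restrict_apply_univ]; exact hb.measure_lt_top⟩
  let ρ : ℕ → ContDiffBump (0 : Plane) := fun m =>
    ⟨δ / (2 * (m + 1)), δ / (m + 1), by positivity, by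
      apply div_lt_div_of_pos_left hδ (by positivity); linarith [(m.cast_nonneg : (0 : ℝ) ≤ m)]⟩
  have hρ0 : Tendsto (fun m => (ρ m).rOut) atTop (𝓝 0) := by
    have := (tendsto_one_div_add_atTop_nhds_zero_nat (𝕜 := ℝ)).const_mul δ
    simpa [ρ, div_eq_mul_inv] using this
  have hρK : ∀ m, (ρ m).rOut ≤ 2 * (ρ m).rIn := by
    intro m
    change δ / (m + 1) ≤ 2 * (δ / (2 * (m + 1)))
    apply le_of_eq; field_simp
  have hρδ : ∀ m, (ρ m).rOut ≤ δ := by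
    intro m
    exact div_le_self hδ.le (by linarith [(m.cast_nonneg : (0 : ℝ) ≤ m)])
  set φ : ℕ → Plane → ℝ := fun m => convolution ((ρ m).normed volume) w (lsmul ℝ ℝ) volume with hφ
  have hwc := hw.continuous
  have hwd : ∀ᵐ x : Plane, DifferentiableAt ℝ w x := hw.ae_differentiableAt
  have hfb : ∀ x, ‖fderiv ℝ w x‖ ≤ K := fun x => norm_fderiv_le_of_lipschitz ℝ hw
  have hfm : Measurable (fderiv ℝ w) := measurable_fderiv ℝ w
  have hfl : LocallyIntegrable (fderiv ℝ w) (volume : Measure Plane) :=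
    (memLp_top_of_bound hfm.aestronglyMeasurable K (.of_forall hfb)).locallyIntegrable le_top
  have hint1 : ∀ m, ∫ x, (ρ m).normed volume x = 1 := fun m => (ρ m).integral_normed
  have hrc : ∀ m, HasCompactSupport ((ρ m).normed (volume : Measure Plane)) :=
    fun m => (ρ m).hasCompactSupport_normed
  have hrcont : ∀ m, Continuous ((ρ m).normed (volume : Measure Plane)) :=
    fun m => (ρ m).continuous_normed
  have hri : ∀ m, Integrable ((ρ m).normed (volume : Measure Plane)) :=
    fun m => (hrcont m).integrable_of_hasCompactSupport (hrc m)
  -- the derivative of the mollification falls on the Lipschitz factor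
  have hder : ∀ m x, HasFDerivAt (φ m)
      (convolution ((ρ m).normed volume) (fderiv ℝ w) (lsmul ℝ ℝ) volume x) x := by
    intro m x
    have := hasFDerivAt_integral_of_dominated_loc_of_lip (𝕜 := ℝ) (μ := (volume : Measure Plane))
      (F := fun y t => (ρ m).normed volume t • w (y - t))
      (F' := fun t => (ρ m).normed volume t • fderiv ℝ w (x - t)) (x₀ := x)
      (bound := fun t => (ρ m).normed volume t * K) (s := univ) univ_mem
      (Eventually.of_forall fun y => Continuous.aestronglyMeasurable (by fun_prop)) ?_ ?_ ?_ ?_ ?_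
    · exact this.2
    · refine Continuous.integrable_of_hasCompactSupport (by fun_prop) ?_
      exact (hrc m).smul_right
    · exact (hrcont m).aestronglyMeasurable.smul
        (hfm.comp (measurable_const.sub measurable_id)).aestronglyMeasurable
    · refine .of_forall fun t => ?_
      have h1 : LipschitzWith (Real.nnabs ((ρ m).normed volume t * K))
          (fun y => (ρ m).normed volume t • w (y - t)) := by
        refine LipschitzWith.of_dist_le_mul fun a b => ?_
        rw [dist_smul₀, Real.coe_nnabs, abs_mul, NNReal.abs_eq, mul_assoc, Real.norm_eq_abs]
        gcongr
        simpa using hw.dist_le_mul (a - t) (b - t)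
      exact h1.lipschitzOnWith
    · exact (hri m).mul_const _
    · have h2 : ∀ᵐ t : Plane, DifferentiableAt ℝ w (x - t) :=
        (Measure.measurePreserving_sub_left (volume : Measure Plane) x).quasiMeasurePreserving.ae hwd
      filter_upwards [h2] with t ht
      have h3 : HasFDerivAt (fun y => w (y - t)) (fderiv ℝ w (x - t)) x := by
        have := ht.hasFDerivAt.comp x ((hasFDerivAt_id x).sub_const t)
        rw [ContinuousLinearMap.comp_id] at this
        exact this
      exact h3.fun_const_smul _
  have hfd : ∀ m x, fderiv ℝ (φ m) x
      = convolution ((ρ m).normed volume) (fderiv ℝ w) (lsmul ℝ ℝ) volume x :=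
    fun m x => (hder m x).fderiv
  have hfdb : ∀ m x, ‖fderiv ℝ (φ m) x‖ ≤ K := by
    intro m x
    rw [hfd]
    calc ‖convolution ((ρ m).normed volume) (fderiv ℝ w) (lsmul ℝ ℝ) volume x‖
        ≤ ∫ t, (ρ m).normed volume t * K := by
          refine norm_integral_le_of_norm_le ((hri m).mul_const _) (.of_forall fun t => ?_)
          simp only [lsmul_apply, norm_smul, Real.norm_eq_abs, abs_of_nonneg ((ρ m).nonneg_normed t)]
          exact mul_le_mul_of_nonneg_left (hfb _) ((ρ m).nonneg_normed t)
      _ = K := by rw [integral_mul_const, hint1, one_mul]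
  refine ⟨φ, fun m => ⟨?_, ?_, ?_⟩, ?_, ?_⟩
  · exact (hrc m).contDiff_convolution_left _ (ρ m).contDiff_normed hwc.locallyIntegrable
  · exact (hrc m).convolution _ hc
  · refine subset_trans ?_ hδΩ
    refine closure_minimal ?_ Metric.isClosed_cthickening
    refine (support_convolution_subset _).trans ?_
    rw [(ρ m).support_normed_eq]
    rintro _ ⟨a, ha, b, hb, rfl⟩
    refine Metric.mem_cthickening_of_dist_le _ b _ _ (subset_tsupport _ hb) ?_
    rw [mem_ball_zero_iff] at ha
    simpa using ha.le.trans (hρδ m)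
  · have hest : ∀ m x, |w x - φ m x| ≤ K * (ρ m).rOut := by
      intro m x
      rw [abs_sub_comm, ← Real.dist_eq]
      refine ContDiffBump.dist_normed_convolution_le hwc.aestronglyMeasurable fun y hy => ?_
      exact (hw.dist_le_mul y x).trans (by gcongr; exact (Metric.mem_ball.1 hy).le)
    refine tendsto_eLpNorm_two_of_bounded (B := K * δ) (fun m => ?_) (fun m => .of_forall fun x => ?_)
      (.of_forall fun x => ?_)
    · have : Continuous (φ m) := by
        rw [continuous_iff_continuousAt]; exact fun x => (hder m x).continuousAt
      exact (hwc.sub this).aestronglyMeasurable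
    · exact (hest m x).trans (by gcongr; exact hρδ m)
    · have h0 : Tendsto (fun m => (K : ℝ) * (ρ m).rOut) atTop (𝓝 0) := by
        simpa using hρ0.const_mul (K : ℝ)
      exact squeeze_zero_norm (fun m => hest m x) h0
  · refine tendsto_eLpNorm_two_of_bounded (B := K + K) (fun m => ?_)
      (fun m => .of_forall fun x => ?_) ?_
    · exact ((measurable_gradient w).sub (measurable_gradient (φ m))).aestronglyMeasurable
    · rw [norm_gradient_sub_eq]
      exact (norm_sub_le _ _).trans (add_le_add (hfb x) (hfdb m x))
    · have h1 := ContDiffBump.ae_convolution_tendsto_right_of_locallyIntegrable (φ := ρ)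
        (l := atTop) (K := 2) hρ0 (.of_forall hρK) hfl
      refine ae_restrict_of_ae ?_
      filter_upwards [h1] with x hx
      rw [tendsto_zero_iff_norm_tendsto_zero]
      simp only [norm_gradient_sub_eq, hfd]
      rw [tendsto_iff_norm_sub_tendsto_zero] at hx
      simpa only [norm_sub_rev] using hx

/-- The part of `s` beyond `[-δ, δ]`, moved to the origin. -/
def softThreshold (δ s : ℝ) : ℝ := s - max (-δ) (min δ s)

theorem softThreshold_eq_zero {δ s : ℝ} (h : |s| ≤ δ) : softThreshold δ s = 0 := by
  rw [abs_le] at h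
  simp [softThreshold, min_eq_right h.2, max_eq_right h.1]

theorem softThreshold_of_lt {δ s : ℝ} (hδ : 0 ≤ δ) (h : δ < s) : softThreshold δ s = s - δ := by
  rw [softThreshold, min_eq_left h.le, max_eq_right (by linarith)]

theorem softThreshold_of_lt_neg {δ s : ℝ} (hδ : 0 ≤ δ) (h : s < -δ) :
    softThreshold δ s = s + δ := by
  rw [softThreshold, min_eq_right (by linarith), max_eq_left h.le]; ring

theorem abs_sub_softThreshold_le {δ : ℝ} (hδ : 0 ≤ δ) (s : ℝ) : |s - softThreshold δ s| ≤ δ := by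
  rw [softThreshold, sub_sub_cancel, abs_le]
  exact ⟨le_max_left _ _, max_le (by linarith) (min_le_left _ _)⟩

theorem lipschitzWith_softThreshold (δ : ℝ) : LipschitzWith 2 (softThreshold δ) := by
  have h := LipschitzWith.id.sub ((LipschitzWith.id.const_min δ).const_max (-δ))
  rw [one_add_one_eq_two] at h
  exact h

theorem fderiv_softThreshold {u : Plane → ℝ} (hu : Continuous u) (x : Plane) :
    ∀ᶠ δ in 𝓝[>] (0 : ℝ), fderiv ℝ (fun y => softThreshold δ (u y)) x
      = if u x = 0 then 0 else fderiv ℝ u x := by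
  split_ifs with h
  · filter_upwards [self_mem_nhdsWithin] with δ (hδ : 0 < δ)
    have h1 : (fun y => softThreshold δ (u y)) =ᶠ[𝓝 x] fun _ => 0 := by
      have : ∀ᶠ y in 𝓝 x, |u y| < δ :=
        hu.abs.continuousAt.eventually_lt continuousAt_const (by simpa [h] using hδ)
      filter_upwards [this] with y hy using softThreshold_eq_zero hy.le
    rw [h1.fderiv_eq]; simp
  · have h0 : ∀ᶠ δ in 𝓝[>] (0 : ℝ), δ < |u x| :=
      nhdsWithin_le_nhds (eventually_lt_nhds (abs_pos.2 h))
    filter_upwards [self_mem_nhdsWithin, h0] with δ (hδ : 0 < δ) hδu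
    rcases lt_abs.1 hδu with h2 | h2
    · have h1 : (fun y => softThreshold δ (u y)) =ᶠ[𝓝 x] fun y => u y - δ := by
        filter_upwards [continuousAt_const.eventually_lt hu.continuousAt h2] with y hy
        exact softThreshold_of_lt hδ.le hy
      rw [h1.fderiv_eq, fderiv_sub_const]
    · have h1 : (fun y => softThreshold δ (u y)) =ᶠ[𝓝 x] fun y => u y + δ := by
        filter_upwards [hu.continuousAt.eventually_lt continuousAt_const (lt_neg.2 h2)] with y hy
        exact softThreshold_of_lt_neg hδ.le hy
      rw [h1.fderiv_eq, fderiv_add_const]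

theorem integral_mul_fderiv_of_lipschitz {Ω : Set Plane} {w φ : Plane → ℝ}
    {K : ℝ≥0} (hw : LipschitzWith K w) (hφ : IsTestFunction Ω φ) (v : Plane) :
    ∫ x in Ω, w x * fderiv ℝ φ x v = - ∫ x in Ω, fderiv ℝ w x v * φ x := by
  obtain ⟨D, hD⟩ := (hφ.1.of_le (m := 1) (by simp)).lipschitzWith_of_hasCompactSupport hφ.2.1
    (by simp)
  have h := hw.integral_lineDeriv_mul_eq (μ := (volume : Measure Plane)) hD hφ.2.1 v
  have hs : ∀ x, x ∉ Ω → φ x = 0 := fun x hx => by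
    by_contra h; exact hx (hφ.2.2 (subset_tsupport _ h))
  have hs' : ∀ x, x ∉ Ω → fderiv ℝ φ x = 0 := fun x hx => by
    by_contra h
    exact hx (hφ.2.2 (support_fderiv_subset ℝ h))
  rw [setIntegral_eq_integral_of_forall_compl_eq_zero (fun x hx => by simp [hs' x hx]),
    setIntegral_eq_integral_of_forall_compl_eq_zero (fun x hx => by simp [hs x hx])]
  have h1 : ∫ x, fderiv ℝ w x v * φ x = ∫ x, lineDeriv ℝ w x v * φ x := by
    refine integral_congr_ae ?_
    filter_upwards [hw.ae_differentiableAt (μ := (volume : Measure Plane))] with x hx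
    rw [hx.lineDeriv_eq_fderiv]
  rw [h1, h, ← integral_neg]
  congr 1; funext x
  rw [(hφ.1.differentiable (by simp) x).lineDeriv_eq_fderiv, map_neg]; ring

/-- The gradient of a Lipschitz function, set to zero on the zero set of the function; it
coincides almost everywhere with the gradient. -/
def truncGradient (u : Plane → ℝ) (x : Plane) : Plane :=
  (InnerProductSpace.toDual ℝ Plane).symm (if u x = 0 then 0 else fderiv ℝ u x)

theorem norm_truncGradient_le (u : Plane → ℝ) (x : Plane) : ‖truncGradient u x‖ ≤ ‖fderiv ℝ u x‖ := by
  rw [truncGradient, LinearIsometryEquiv.norm_map]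
  split_ifs <;> simp

/-- A Lipschitz function that vanishes outside a bounded open set is in `H¹₀`: its soft
thresholdings have compact support and converge to it in `H¹`, because their gradients vanish
near every zero of the function. -/
theorem lipschitz_mem_sobolev {Ω : Set Plane} (hΩ : IsOpen Ω) (hb : Bornology.IsBounded Ω)
    {u : Plane → ℝ} {K : ℝ≥0} (hu : LipschitzWith K u) (h0 : ∀ x ∉ Ω, u x = 0) :
    IsH1WithGradient Ω u (truncGradient u) ∧ IsH1LimitOfTestFunctions Ω u (truncGradient u) := by
  have hfin : IsFiniteMeasure (volume.restrict Ω) :=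
    ⟨by rw [Measure.restrict_apply_univ]; exact hb.measure_lt_top⟩
  have huc := hu.continuous
  have hcs : HasCompactSupport u :=
    HasCompactSupport.of_support_subset_isCompact hb.isCompact_closure
      (fun x hx => by by_contra h; exact hx (h0 x fun h' => h (subset_closure h')))
  set δ : ℕ → ℝ := fun m => 1 / ((m : ℝ) + 1) with hδ
  have hδ0 : ∀ m, 0 < δ m := fun m => by positivity
  have hδ1 : ∀ m, δ m ≤ 1 := fun m => by
    rw [hδ]; simp only; rw [div_le_one (by positivity)]; linarith [(m.cast_nonneg : (0 : ℝ) ≤ m)]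
  have hδt : Tendsto δ atTop (𝓝 0) := tendsto_one_div_add_atTop_nhds_zero_nat
  have hδt' : Tendsto δ atTop (𝓝[>] 0) :=
    tendsto_nhdsWithin_iff.2 ⟨hδt, .of_forall hδ0⟩
  set w : ℕ → Plane → ℝ := fun m x => softThreshold (δ m) (u x) with hw
  have hwL : ∀ m, LipschitzWith (2 * K) (w m) := fun m => (lipschitzWith_softThreshold _).comp hu
  have hwc : ∀ m, HasCompactSupport (w m) := fun m =>
    hcs.comp_left (g := softThreshold (δ m)) (softThreshold_eq_zero (by simpa using (hδ0 m).le))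
  have hws : ∀ m, tsupport (w m) ⊆ Ω := fun m => by
    have h1 : tsupport (w m) ⊆ {x | δ m ≤ |u x|} := by
      refine closure_minimal (fun x hx => ?_) (isClosed_le continuous_const huc.abs)
      by_contra h
      exact hx (softThreshold_eq_zero (not_le.1 h).le)
    refine h1.trans fun x hx => ?_
    by_contra h
    have : δ m ≤ 0 := by simpa [h0 x h] using hx
    exact absurd (hδ0 m) (not_lt.2 this)
  have hd : ∀ x, Tendsto (fun m => fderiv ℝ (w m) x) atTop
      (𝓝 (if u x = 0 then 0 else fderiv ℝ u x)) := fun x =>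
    tendsto_const_nhds.congr' ((hδt'.eventually (fderiv_softThreshold huc x)).mono
      fun m hm => hm.symm)
  have hub : ∀ x, ‖fderiv ℝ u x‖ ≤ K := fun x => norm_fderiv_le_of_lipschitz ℝ hu
  have hwb : ∀ m x, ‖fderiv ℝ (w m) x‖ ≤ 2 * K := fun m x => by
    simpa using norm_fderiv_le_of_lipschitz ℝ (hwL m) (x₀ := x)
  have hGb : ∀ x, ‖truncGradient u x‖ ≤ K := fun x => (norm_truncGradient_le u x).trans (hub x)
  have hGm : Measurable (truncGradient u) := by
    refine (LinearIsometryEquiv.continuous _).measurable.comp ?_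
    exact Measurable.ite (huc.measurable (measurableSet_singleton 0)) measurable_const
      (measurable_fderiv ℝ u)
  have hwest : ∀ m x, |u x - w m x| ≤ δ m := fun m x => abs_sub_softThreshold_le (hδ0 m).le _
  have hwt : ∀ x, Tendsto (fun m => w m x) atTop (𝓝 (u x)) := fun x => by
    rw [tendsto_iff_norm_sub_tendsto_zero]
    refine squeeze_zero_norm (fun m => ?_) hδt
    rw [norm_norm, norm_sub_rev]; exact hwest m x
  have huM : MemLp u 2 (volume.restrict Ω) := (huc.memLp_of_hasCompactSupport hcs).restrict Ω
  refine ⟨⟨huM, MemLp.of_bound hGm.aestronglyMeasurable K (.of_forall hGb), fun φ hφ v => ?_⟩, ?_⟩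
  · have hφi : Integrable φ (volume.restrict Ω) := hφ.memLp.integrable (by norm_num)
    have hφi' := (hφ.memLp_fderiv v).integrable (μ := volume.restrict Ω) (by norm_num)
    obtain ⟨B, hB⟩ := huc.bounded_above_of_compact_support hcs
    have l1 : Tendsto (fun m => ∫ x in Ω, w m x * fderiv ℝ φ x v) atTop
        (𝓝 (∫ x in Ω, u x * fderiv ℝ φ x v)) := by
      refine tendsto_integral_of_dominated_convergence (fun x => (B + 1) * ‖fderiv ℝ φ x v‖)
        (fun m => (hwL m).continuous.aestronglyMeasurable.mul hφi'.1)
        (hφi'.norm.const_mul _) (fun m => .of_forall fun x => ?_)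
        (.of_forall fun x => (hwt x).mul_const _)
      rw [norm_mul]
      gcongr
      have h1 := hwest m x
      have h2 := hB x
      rw [Real.norm_eq_abs] at h2 ⊢
      have h3 := abs_sub_abs_le_abs_sub (w m x) (u x)
      rw [abs_sub_comm] at h3
      linarith [hδ1 m]
    have l2 : Tendsto (fun m => - ∫ x in Ω, fderiv ℝ (w m) x v * φ x) atTop
        (𝓝 (- ∫ x in Ω, inner ℝ (truncGradient u x) v * φ x)) := by
      refine (tendsto_integral_of_dominated_convergence (fun x => (2 * K * ‖v‖) * ‖φ x‖)
        (fun m => (((measurable_fderiv_apply_const ℝ (w m) v)).aestronglyMeasurable).mul hφi.1)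
        (hφi.norm.const_mul _) (fun m => .of_forall fun x => ?_)
        (.of_forall fun x => ?_)).neg
      · rw [Pi.mul_apply, norm_mul]
        gcongr
        exact (ContinuousLinearMap.le_opNorm _ _).trans (by gcongr; exact hwb m x)
      · refine Tendsto.mul_const _ ?_
        simp only [truncGradient, InnerProductSpace.toDual_symm_apply]
        exact ((ContinuousLinearMap.apply ℝ ℝ v).continuous.tendsto _).comp (hd x)
    refine tendsto_nhds_unique l1 (l2.congr fun m => ?_)
    exact (integral_mul_fderiv_of_lipschitz (hwL m) hφ v).symm
  · have c1 : Tendsto (fun m => eLpNorm (fun x => u x - w m x) 2 (volume.restrict Ω)) atTop (𝓝 0) := by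
      refine tendsto_eLpNorm_two_of_bounded (B := 1)
        (fun m => (huc.sub (hwL m).continuous).aestronglyMeasurable)
        (fun m => .of_forall fun x => (hwest m x).trans (hδ1 m)) (.of_forall fun x => ?_)
      simpa using (hwt x).const_sub (u x)
    have c2 : Tendsto (fun m => eLpNorm (fun x => truncGradient u x - ∇ (w m) x) 2
        (volume.restrict Ω)) atTop (𝓝 0) := by
      refine tendsto_eLpNorm_two_of_bounded (B := K + 2 * K)
        (fun m => (hGm.sub (measurable_gradient _)).aestronglyMeasurable)
        (fun m => .of_forall fun x => ?_) (.of_forall fun x => ?_)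
      · refine (norm_sub_le _ _).trans (add_le_add (hGb x) ?_)
        rw [norm_gradient_eq]; exact hwb m x
      · have := ((LinearIsometryEquiv.continuous
          (InnerProductSpace.toDual ℝ Plane).symm).tendsto _).comp (hd x)
        have h2 := this.const_sub (truncGradient u x)
        rw [show (InnerProductSpace.toDual ℝ Plane).symm (if u x = 0 then 0 else fderiv ℝ u x)
          = truncGradient u x from rfl, sub_self] at h2
        exact h2
    choose φ hφ a b using fun m => exists_testFunctions_of_lipschitz hΩ hb (hwL m) (hwc m) (hws m)
    have hsel : ∀ m, ∃ k,
        eLpNorm (fun x => w m x - φ m k x) 2 (volume.restrict Ω) ≤ ENNReal.ofReal (δ m) ∧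
        eLpNorm (fun x => ∇ (w m) x - ∇ (φ m k) x) 2 (volume.restrict Ω)
          ≤ ENNReal.ofReal (δ m) := fun m => by
      have hp : (0 : ℝ≥0∞) < ENNReal.ofReal (δ m) := ENNReal.ofReal_pos.2 (hδ0 m)
      exact (((a m).eventually (eventually_le_nhds hp)).and
        ((b m).eventually (eventually_le_nhds hp))).exists
    choose k hk1 hk2 using hsel
    have hδe : Tendsto (fun m => ENNReal.ofReal (δ m)) atTop (𝓝 0) := by
      simpa using ENNReal.tendsto_ofReal hδt
    refine ⟨fun m => φ m (k m), fun m => hφ m (k m), ?_, ?_⟩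
    · have := tendsto_eLpNorm_add (μ := volume.restrict Ω) (f := fun m x => u x - w m x)
        (g := fun m x => w m x - φ m (k m) x)
        (fun m => (huc.sub (hwL m).continuous).aestronglyMeasurable)
        (fun m => ((hwL m).continuous.sub (hφ m (k m)).1.continuous).aestronglyMeasurable) c1
        (tendsto_of_tendsto_of_tendsto_of_le_of_le tendsto_const_nhds hδe (fun _ => bot_le) hk1)
      refine this.congr fun m => congrArg (fun f => eLpNorm f 2 (volume.restrict Ω)) ?_
      funext x; simp
    · have := tendsto_eLpNorm_add (μ := volume.restrict Ω)
        (f := fun m x => truncGradient u x - ∇ (w m) x)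
        (g := fun m x => ∇ (w m) x - ∇ (φ m (k m)) x)
        (fun m => (hGm.sub (measurable_gradient _)).aestronglyMeasurable)
        (fun m => ((measurable_gradient _).sub (measurable_gradient _)).aestronglyMeasurable) c2
        (tendsto_of_tendsto_of_tendsto_of_le_of_le tendsto_const_nhds hδe (fun _ => bot_le) hk2)
      refine this.congr fun m => congrArg (fun f => eLpNorm f 2 (volume.restrict Ω)) ?_
      funext x; simp

end HpFEM

namespace HpFEM

/-! ### Markov's inequality -/

/-- Markov's inequality at an end point of `[-1, 1]`. -/
theorem abs_derivative_one_le {p : ℕ} {P : Polynomial ℝ} {B : ℝ} (hdeg : P.natDegree ≤ p)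
    (hB : ∀ x ∈ Icc (-1 : ℝ) 1, |P.eval x| ≤ B) :
    |P.derivative.eval 1| ≤ (p : ℝ) ^ 2 * B := by
  have main : ∀ (Q : Polynomial ℝ) (B : ℝ), 0 < B → Q.natDegree ≤ p →
      (∀ x ∈ Icc (-1 : ℝ) 1, |Q.eval x| ≤ B) → Q.derivative.eval 1 ≤ (p : ℝ) ^ 2 * B := by
    intro Q B hB0 hQ hQB
    have h := Polynomial.Chebyshev.eval_iterate_derivative_le_of_forall_abs_le_one (n := p)
      (P := Polynomial.C B⁻¹ * Q) (k := 1) (x := 1) le_rfl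
      (Polynomial.natDegree_le_iff_degree_le.1 ((Polynomial.natDegree_C_mul_le _ _).trans hQ))
      (fun x hx => by
        rw [Polynomial.eval_C_mul, abs_mul, abs_of_pos (inv_pos.2 hB0), inv_mul_le_iff₀ hB0, mul_one]
        exact hQB x hx)
    simp only [Function.iterate_one, Polynomial.derivative_C_mul,
      Polynomial.Chebyshev.T_derivative_eq_U, Polynomial.eval_mul,
      Polynomial.Chebyshev.U_eval_one] at h
    rw [Polynomial.eval_C, inv_mul_le_iff₀ hB0] at h
    refine h.trans (le_of_eq ?_)
    simp; ring
  have hB0 : 0 ≤ B := (abs_nonneg _).trans (hB 0 (by norm_num))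
  refine le_of_forall_pos_le_add fun ε hε => ?_
  have hpos : 0 < (p : ℝ) ^ 2 + 1 := by positivity
  have hB' : 0 < B + ε / ((p : ℝ) ^ 2 + 1) := by positivity
  have h1 := main P _ hB' hdeg fun x hx => (hB x hx).trans (by linarith [div_pos hε hpos])
  have h2 := main (-P) _ hB' (by simpa using hdeg) fun x hx => by
    rw [Polynomial.eval_neg, abs_neg]; exact (hB x hx).trans (by linarith [div_pos hε hpos])
  have h3 : (p : ℝ) ^ 2 * (ε / ((p : ℝ) ^ 2 + 1)) ≤ ε := by
    rw [mul_div_assoc', div_le_iff₀ hpos]; nlinarith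
  rw [Polynomial.derivative_neg, Polynomial.eval_neg] at h2
  rw [abs_le]
  constructor <;> nlinarith

theorem abs_derivative_right_le {p : ℕ} {P : Polynomial ℝ} {B a c : ℝ}
    (hdeg : P.natDegree ≤ p) (hB : ∀ x ∈ uIcc a c, |P.eval x| ≤ B) :
    |P.derivative.eval c| * |c - a| ≤ 2 * (p : ℝ) ^ 2 * B := by
  have h := abs_derivative_one_le (p := p)
    (P := P.comp (Polynomial.C ((c - a) / 2) * Polynomial.X + Polynomial.C ((c + a) / 2)))
    (B := B) ?_ ?_
  · rw [Polynomial.derivative_comp] at h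
    simp only [Polynomial.derivative_add, Polynomial.derivative_C_mul, Polynomial.derivative_X,
      Polynomial.derivative_C, Polynomial.eval_mul, Polynomial.eval_comp, Polynomial.eval_add,
      Polynomial.eval_C, Polynomial.eval_X, mul_one, add_zero] at h
    rw [show (c - a) / 2 + (c + a) / 2 = c by ring, abs_mul, abs_div, abs_two] at h
    linarith
  · rw [Polynomial.natDegree_comp]
    refine le_trans (Nat.mul_le_mul hdeg Polynomial.natDegree_linear_le) (by simp)
  · intro x hx
    simp only [Polynomial.eval_comp, Polynomial.eval_add, Polynomial.eval_mul, Polynomial.eval_C,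
      Polynomial.eval_X]
    refine hB _ ?_
    rw [mem_uIcc]
    rcases le_total a c with h | h
    · left; constructor <;> nlinarith [hx.1, hx.2]
    · right; constructor <;> nlinarith [hx.1, hx.2]

/-- Markov's inequality inside an interval, from the end point version on the longer half. -/
theorem abs_derivative_le {p : ℕ} {P : Polynomial ℝ} {B a b t : ℝ}
    (ht : t ∈ Icc a b) (hdeg : P.natDegree ≤ p) (hB : ∀ x ∈ Icc a b, |P.eval x| ≤ B) :
    |P.derivative.eval t| * (b - a) ≤ 4 * (p : ℝ) ^ 2 * B := by
  rcases le_total (t - a) (b - t) with h | h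
  · have := abs_derivative_right_le hdeg (B := B) fun x hx => hB x
      (by rw [uIcc_of_ge ht.2] at hx; exact ⟨ht.1.trans hx.1, hx.2⟩)
    rw [abs_sub_comm, abs_of_nonneg (sub_nonneg.2 ht.2)] at this
    nlinarith [abs_nonneg (P.derivative.eval t)]
  · have := abs_derivative_right_le hdeg (B := B) fun x hx => hB x
      (by rw [uIcc_of_le ht.1] at hx; exact ⟨hx.1, hx.2.trans ht.2⟩)
    rw [abs_of_nonneg (sub_nonneg.2 ht.1)] at this
    nlinarith [abs_nonneg (P.derivative.eval t)]

/-! ### Polynomials on the reference cells -/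

/-- The restriction of a polynomial in `Π_p` to a line has degree at most `p`; on the square
the line has to be parallel to an axis. -/
theorem exists_polynomial_on_line {s : Shape} {p : ℕ} {q : MvPolynomial (Fin 2) ℝ}
    (hq : q ∈ s.polynomials p) (a d : Plane) (hd : s = .triangle ∨ d 0 = 0 ∨ d 1 = 0) :
    ∃ P : Polynomial ℝ, P.natDegree ≤ p ∧
      ∀ t : ℝ, P.eval t = MvPolynomial.eval (fun i => (a + t • d) i) q := by
  classical
  refine ⟨∑ m ∈ q.support, Polynomial.C (q.coeff m) *
    ∏ i : Fin 2, (Polynomial.C (d i) * Polynomial.X + Polynomial.C (a i)) ^ m i, ?_, fun t => ?_⟩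
  · refine Polynomial.natDegree_sum_le_of_forall_le _ _ fun m hm => ?_
    refine (Polynomial.natDegree_C_mul_le _ _).trans ?_
    rw [Fin.prod_univ_two]
    refine Polynomial.natDegree_mul_le.trans ?_
    have hlin : ∀ i, ((Polynomial.C (d i) * Polynomial.X
        + Polynomial.C (a i)) ^ m i).natDegree ≤ m i := fun i =>
      Polynomial.natDegree_pow_le.trans
        ((Nat.mul_le_mul_left _ Polynomial.natDegree_linear_le).trans (by simp))
    have hzero : ∀ i, d i = 0 → ((Polynomial.C (d i) * Polynomial.X
        + Polynomial.C (a i)) ^ m i).natDegree = 0 := fun i hi => by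
      rw [hi, Polynomial.C_0, zero_mul, zero_add, ← Polynomial.C_pow, Polynomial.natDegree_C]
    have h0 := hlin 0
    have h1 := hlin 1
    cases s with
    | square =>
      have hm' := (MvPolynomial.mem_restrictDegree _ _ _).1 hq m hm
      rcases hd with hd | hd | hd
      · cases hd
      · rw [hzero 0 hd, zero_add]; exact h1.trans (hm' 1)
      · rw [hzero 1 hd, add_zero]; exact h0.trans (hm' 0)
    | triangle =>
      have hm' : m.sum (fun _ e => e) ≤ p :=
        (MvPolynomial.le_totalDegree hm).trans ((MvPolynomial.mem_restrictTotalDegree _ _ _).1 hq)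
      rw [Finsupp.sum_fintype _ _ (by simp), Fin.sum_univ_two] at hm'
      omega
  · rw [MvPolynomial.eval_eq, Polynomial.eval_finsetSum]
    refine Finset.sum_congr rfl fun m _ => ?_
    rw [Polynomial.eval_C_mul, Polynomial.eval_prod, Fin.prod_univ_two, Finset.prod_subset
      (Finset.subset_univ m.support) (fun i _ hi => by simp [Finsupp.notMem_support_iff.1 hi]),
      Fin.prod_univ_two]
    simp only [Polynomial.eval_pow, Polynomial.eval_add, Polynomial.eval_mul, Polynomial.eval_C,
      Polynomial.eval_X, PiLp.add_apply, PiLp.smul_apply, smul_eq_mul]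
    ring_nf

theorem contDiff_eval (q : MvPolynomial (Fin 2) ℝ) :
    ContDiff ℝ ∞ (fun z : Plane => MvPolynomial.eval (fun i => z i) q) := by
  simp only [MvPolynomial.eval_eq]
  refine ContDiff.sum fun m _ => contDiff_const.mul (contDiff_prod fun i _ => ContDiff.pow ?_ _)
  exact (EuclideanSpace.proj (𝕜 := ℝ) i).contDiff

/-- Markov's inequality on a chord of a reference cell. -/
theorem abs_fderiv_eval_le {s : Shape} {p : ℕ} {q : MvPolynomial (Fin 2) ℝ} {B : ℝ}
    (hq : q ∈ s.polynomials p)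
    (hB : ∀ z ∈ s.closedCell, |MvPolynomial.eval (fun i => z i) q| ≤ B) {z d : Plane}
    (hd : s = .triangle ∨ d 0 = 0 ∨ d 1 = 0) {a b : ℝ} (ha : a ≤ 0) (hb : 0 ≤ b)
    (hab : 1 / 2 ≤ b - a) (hz : ∀ t ∈ Icc a b, z + t • d ∈ s.closedCell) :
    |fderiv ℝ (fun z : Plane => MvPolynomial.eval (fun i => z i) q) z d| ≤ 8 * (p : ℝ) ^ 2 * B := by
  obtain ⟨P, hP, hPe⟩ := exists_polynomial_on_line hq z d hd
  have h1 : HasDerivAt (fun t : ℝ => MvPolynomial.eval (fun i => (z + t • d) i) q)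
      (fderiv ℝ (fun z : Plane => MvPolynomial.eval (fun i => z i) q) z d) 0 := by
    have hq := ((contDiff_eval q).differentiable (by simp) z).hasFDerivAt
    have hl : HasDerivAt (fun t : ℝ => z + t • d) d 0 := by
      simpa using ((hasDerivAt_id (0 : ℝ)).smul_const d).const_add z
    have hq' : HasFDerivAt (fun z : Plane => MvPolynomial.eval (fun i => z i) q)
      (fderiv ℝ (fun z : Plane => MvPolynomial.eval (fun i => z i) q) z) (z + (0 : ℝ) • d) := by
      simpa using hq
    exact hq'.comp_hasDerivAt (0 : ℝ) hl
  have h2 : P.derivative.eval 0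
      = fderiv ℝ (fun z : Plane => MvPolynomial.eval (fun i => z i) q) z d := by
    refine (P.hasDerivAt 0).unique ?_
    exact h1.congr_of_eventuallyEq (.of_forall hPe)
  rw [← h2]
  have h3 := abs_derivative_le ⟨ha, hb⟩ hP (B := B) fun t ht => by
    rw [hPe]; exact hB _ (hz t ht)
  nlinarith [abs_nonneg (P.derivative.eval 0)]

theorem norm_clm_le_of_basis {A : Plane →L[ℝ] ℝ} {B : ℝ} (h0 : |A !₂[1, 0]| ≤ B)
    (h1 : |A !₂[0, 1]| ≤ B) : ‖A‖ ≤ 2 * B := by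
  have hB : 0 ≤ B := (abs_nonneg _).trans h0
  refine A.opNorm_le_bound (by positivity) fun w => ?_
  have hw : w = w 0 • !₂[1, 0] + w 1 • !₂[0, 1] := by
    ext i; fin_cases i <;> simp
  have n0 : |w 0| ≤ ‖w‖ := PiLp.norm_apply_le w 0
  have n1 : |w 1| ≤ ‖w‖ := PiLp.norm_apply_le w 1
  calc ‖A w‖ = |w 0 * A !₂[1, 0] + w 1 * A !₂[0, 1]| := by
        conv_lhs => rw [hw]
        simp [Real.norm_eq_abs]
    _ ≤ |w 0| * |A !₂[1, 0]| + |w 1| * |A !₂[0, 1]| := by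
        rw [← abs_mul, ← abs_mul]; exact abs_add_le _ _
    _ ≤ ‖w‖ * B + ‖w‖ * B := by gcongr
    _ = 2 * B * ‖w‖ := by ring

/-- The inverse inequality on the reference cells. In the triangle, at least two of the three edge
directions have a chord of parameter length at least `1 / 2` through a given point. -/
theorem norm_fderiv_eval_le {s : Shape} {p : ℕ} {q : MvPolynomial (Fin 2) ℝ} {B : ℝ}
    (hq : q ∈ s.polynomials p)
    (hB : ∀ z ∈ s.closedCell, |MvPolynomial.eval (fun i => z i) q| ≤ B) {z : Plane}
    (hz : z ∈ s.cell) :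
    ‖fderiv ℝ (fun z : Plane => MvPolynomial.eval (fun i => z i) q) z‖ ≤ 32 * (p : ℝ) ^ 2 * B := by
  set A := fderiv ℝ (fun z : Plane => MvPolynomial.eval (fun i => z i) q) z with hA
  suffices h : |A !₂[1, 0]| ≤ 16 * (p : ℝ) ^ 2 * B ∧ |A !₂[0, 1]| ≤ 16 * (p : ℝ) ^ 2 * B by
    refine (norm_clm_le_of_basis h.1 h.2).trans (le_of_eq ?_); ring
  have hBp : ∀ x : ℝ, |x| ≤ 8 * (p : ℝ) ^ 2 * B → |x| ≤ 16 * (p : ℝ) ^ 2 * B := fun x hx => by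
    have := (abs_nonneg x).trans hx; linarith
  cases s with
  | square =>
    obtain ⟨h1, h2, h3, h4⟩ := hz
    refine ⟨hBp _ (abs_fderiv_eval_le hq hB (Or.inr (Or.inr (by simp))) (a := - z 0)
      (b := 1 - z 0) (by linarith) (by linarith) (by linarith) fun t ht => ?_),
      hBp _ (abs_fderiv_eval_le hq hB (Or.inr (Or.inl (by simp))) (a := - z 1)
      (b := 1 - z 1) (by linarith) (by linarith) (by linarith) fun t ht => ?_)⟩
    all_goals
      obtain ⟨ht1, ht2⟩ := ht
      simp only [Shape.closedCell, mem_ofPred_eq, PiLp.add_apply, PiLp.smul_apply, smul_eq_mul]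
      simp
      refine ⟨?_, ?_, ?_, ?_⟩ <;> linarith
  | triangle =>
    obtain ⟨h1, h2, h3, h4⟩ := hz
    have c0 : z 1 ≤ 1 / 2 → |A !₂[1, 0]| ≤ 8 * (p : ℝ) ^ 2 * B := fun h => by
      refine abs_fderiv_eval_le hq hB (Or.inl rfl) (a := - z 0)
        (b := 1 - z 0 - z 1) (by linarith) (by linarith) (by linarith) fun t ht => ?_
      obtain ⟨ht1, ht2⟩ := ht
      simp [Shape.closedCell]
      refine ⟨?_, ?_, ?_, ?_⟩ <;> linarith
    have c1 : z 0 ≤ 1 / 2 → |A !₂[0, 1]| ≤ 8 * (p : ℝ) ^ 2 * B := fun h => by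
      refine abs_fderiv_eval_le hq hB (Or.inl rfl) (a := - z 1)
        (b := 1 - z 0 - z 1) (by linarith) (by linarith) (by linarith) fun t ht => ?_
      obtain ⟨ht1, ht2⟩ := ht
      simp [Shape.closedCell]
      refine ⟨?_, ?_, ?_, ?_⟩ <;> linarith
    have c2 : 1 / 2 ≤ z 0 + z 1 → |A !₂[1, 0] - A !₂[0, 1]| ≤ 8 * (p : ℝ) ^ 2 * B := fun h => by
      rw [← map_sub]
      refine abs_fderiv_eval_le hq hB (Or.inl rfl) (a := - z 0)
        (b := z 1) (by linarith) (by linarith) (by linarith) fun t ht => ?_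
      obtain ⟨ht1, ht2⟩ := ht
      simp [Shape.closedCell]
      refine ⟨?_, ?_, ?_, ?_⟩ <;> linarith
    by_cases g1 : z 1 ≤ 1 / 2
    · by_cases g0 : z 0 ≤ 1 / 2
      · exact ⟨hBp _ (c0 g1), hBp _ (c1 g0)⟩
      · refine ⟨hBp _ (c0 g1), ?_⟩
        have a1 := abs_le.1 (c0 g1)
        have a2 := abs_le.1 (c2 (by linarith))
        rw [abs_le]; constructor <;> linarith
    · refine ⟨?_, hBp _ (c1 (by linarith))⟩
      have a1 := abs_le.1 (c1 (by linarith))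
      have a2 := abs_le.1 (c2 (by linarith))
      rw [abs_le]; constructor <;> linarith

end HpFEM

namespace HpFEM

/-! ### Lifting boundary data into a reference cell -/

/-- Given a function `f` on an edge `AB` of the triangle that vanishes at the end points, written
in the barycentric coordinate `lB`, the function `f(lB) lA / (1 - lB)` extends it to the triangle
and vanishes on the other two edges. The value at the vertex `B` is `0`, by division by zero. -/
def bubble (f : ℝ → ℝ) (lB lA : ℝ) : ℝ := f lB * (lA / (1 - lB))

/-- The lifting of the data `b e` on the edges `e` of a reference cell, with vertex values `ν`: the
transfinite interpolation on the square, and the linear interpolation of the vertex values plus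
three edge bubbles on the triangle. -/
def Shape.lift : Shape → (Plane → ℝ) → (Plane × Plane → ℝ → ℝ) → Plane → ℝ
  | .square, ν, b, z =>
    (1 - z 1) * b (!₂[0, 0], !₂[1, 0]) (z 0) + z 1 * b (!₂[0, 1], !₂[1, 1]) (z 0)
      + (1 - z 0) * b (!₂[0, 0], !₂[0, 1]) (z 1) + z 0 * b (!₂[1, 0], !₂[1, 1]) (z 1)
      - ((1 - z 0) * (1 - z 1) * ν !₂[0, 0] + z 0 * (1 - z 1) * ν !₂[1, 0]
        + (1 - z 0) * z 1 * ν !₂[0, 1] + z 0 * z 1 * ν !₂[1, 1])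
  | .triangle, ν, b, z =>
    (1 - z 0 - z 1) * ν !₂[0, 0] + z 0 * ν !₂[1, 0] + z 1 * ν !₂[0, 1]
      + bubble (fun t => b (!₂[0, 0], !₂[1, 0]) t - ((1 - t) * ν !₂[0, 0] + t * ν !₂[1, 0]))
        (z 0) (1 - z 0 - z 1)
      + bubble (fun t => b (!₂[1, 0], !₂[0, 1]) t - ((1 - t) * ν !₂[1, 0] + t * ν !₂[0, 1]))
        (z 1) (z 0)
      + bubble (fun t => b (!₂[0, 0], !₂[0, 1]) t - ((1 - t) * ν !₂[0, 0] + t * ν !₂[0, 1]))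
        (z 1) (1 - z 0 - z 1)

theorem Shape.lift_add (s : Shape) (ν ν' : Plane → ℝ) (b b' : Plane × Plane → ℝ → ℝ) (z : Plane) :
    s.lift (fun v => ν v + ν' v) (fun e t => b e t + b' e t) z = s.lift ν b z + s.lift ν' b' z := by
  cases s <;> simp only [Shape.lift, bubble] <;> ring

theorem Shape.lift_smul (s : Shape) (c : ℝ) (ν : Plane → ℝ) (b : Plane × Plane → ℝ → ℝ)
    (z : Plane) :
    s.lift (fun v => c * ν v) (fun e t => c * b e t) z = c * s.lift ν b z := by
  cases s <;> simp only [Shape.lift, bubble] <;> ring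

theorem abs_bubble_le {f : ℝ → ℝ} {B lA lB : ℝ} (hA : 0 ≤ lA) (hB : lA + lB ≤ 1)
    (hf : |f lB| ≤ B) : |bubble f lB lA| ≤ B := by
  have h0 : 0 ≤ 1 - lB := by linarith
  have h1 : lA / (1 - lB) ≤ 1 := div_le_one_of_le₀ (by linarith) h0
  rw [bubble, abs_mul, abs_of_nonneg (div_nonneg hA h0)]
  have := abs_nonneg (f lB)
  nlinarith [div_nonneg hA h0]

theorem abs_convex_comb_le {a b t B : ℝ} (ha : |a| ≤ B) (hb : |b| ≤ B) (ht0 : 0 ≤ t)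
    (ht1 : t ≤ 1) : |(1 - t) * a + t * b| ≤ B := by
  rw [abs_le] at *
  constructor <;> nlinarith

theorem abs_add_sub_le {a b c B : ℝ} (ha : |a| ≤ B) (hb : |b| ≤ B) (hc : |c| ≤ B) :
    |a + b - c| ≤ 3 * B := by
  rw [abs_le] at *
  constructor <;> linarith

/-- The lifting is bounded by the data with an absolute constant. -/
theorem Shape.abs_lift_le {s : Shape} {ν : Plane → ℝ} {b : Plane × Plane → ℝ → ℝ} {B : ℝ}
    (hν : ∀ v ∈ s.vertices, |ν v| ≤ B) (hb : ∀ e ∈ s.edges, ∀ t ∈ Icc (0 : ℝ) 1, |b e t| ≤ B)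
    {z : Plane} (hz : z ∈ s.closedCell) : |s.lift ν b z| ≤ 7 * B := by
  cases s with
  | square =>
    simp only [Shape.vertices, Shape.edges, List.mem_cons, List.not_mem_nil, or_false,
      forall_eq_or_imp, forall_eq] at hν hb
    obtain ⟨h1, h2, h3, h4⟩ := hz
    obtain ⟨b1, b2, b3, b4⟩ := hb
    obtain ⟨n1, n2, n3, n4⟩ := hν
    have a1 := abs_convex_comb_le (b1 _ ⟨h1, h2⟩) (b3 _ ⟨h1, h2⟩) h3 h4
    have a2 := abs_convex_comb_le (b4 _ ⟨h3, h4⟩) (b2 _ ⟨h3, h4⟩) h1 h2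
    have a3 := abs_convex_comb_le (abs_convex_comb_le n1 n2 h1 h2) (abs_convex_comb_le n4 n3 h1 h2)
      h3 h4
    have := abs_add_sub_le a1 a2 a3
    have hB := (abs_nonneg _).trans n1
    rw [Shape.lift]
    refine le_trans (le_of_eq ?_) (this.trans (by linarith))
    congr 1; ring
  | triangle =>
    simp only [Shape.vertices, Shape.edges, List.mem_cons, List.not_mem_nil, or_false,
      forall_eq_or_imp, forall_eq] at hν hb
    obtain ⟨h1, h2, h3, h4⟩ := hz
    have h5 : z 1 ≤ 1 := by linarith
    obtain ⟨b1, b2, b3⟩ := hb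
    obtain ⟨n1, n2, n3⟩ := hν
    have key : ∀ {x a c t : ℝ}, |x| ≤ B → |a| ≤ B → |c| ≤ B → 0 ≤ t → t ≤ 1 →
        |x - ((1 - t) * a + t * c)| ≤ 2 * B := fun hx ha hc ht0 ht1 => by
      have h1 := abs_le.1 (abs_convex_comb_le ha hc ht0 ht1)
      have h2 := abs_le.1 hx
      rw [abs_le]; constructor <;> linarith
    have e1 := abs_bubble_le (f := fun t => b (!₂[0, 0], !₂[1, 0]) t
      - ((1 - t) * ν !₂[0, 0] + t * ν !₂[1, 0])) (lA := 1 - z 0 - z 1) (by linarith) (by linarith)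
      (key (b1 _ ⟨h1, h2⟩) n1 n2 h1 h2)
    have e2 := abs_bubble_le (f := fun t => b (!₂[1, 0], !₂[0, 1]) t
      - ((1 - t) * ν !₂[1, 0] + t * ν !₂[0, 1])) (lA := z 0) h1 (by linarith)
      (key (b2 _ ⟨h3, h5⟩) n2 n3 h3 h5)
    have e3 := abs_bubble_le (f := fun t => b (!₂[0, 0], !₂[0, 1]) t
      - ((1 - t) * ν !₂[0, 0] + t * ν !₂[0, 1])) (lA := 1 - z 0 - z 1) (by linarith) (by linarith)
      (key (b3 _ ⟨h3, h5⟩) n1 n3 h3 h5)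
    have e0 : |(1 - z 0 - z 1) * ν !₂[0, 0] + z 0 * ν !₂[1, 0] + z 1 * ν !₂[0, 1]| ≤ B := by
      rw [abs_le] at n1 n2 n3 ⊢
      constructor <;> nlinarith
    rw [Shape.lift]
    rw [abs_le] at e0 e1 e2 e3 ⊢
    constructor <;> linarith

/-- The lifting has the prescribed traces. -/
theorem Shape.lift_lineMap {s : Shape} {ν : Plane → ℝ} {b : Plane × Plane → ℝ → ℝ}
    (hb : ∀ e ∈ s.edges, b e 0 = ν e.1 ∧ b e 1 = ν e.2) {e : Plane × Plane} (he : e ∈ s.edges)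
    (t : ℝ) : s.lift ν b (AffineMap.lineMap e.1 e.2 t) = b e t := by
  cases s with
  | square =>
    simp only [Shape.edges, List.mem_cons, List.not_mem_nil, or_false,
      forall_eq_or_imp, forall_eq] at hb he
    obtain ⟨⟨_, _⟩, ⟨_, _⟩, ⟨_, _⟩, ⟨_, _⟩⟩ := hb
    rcases he with rfl | rfl | rfl | rfl <;>
    · simp [Shape.lift, AffineMap.lineMap_apply, *]; try ring
  | triangle =>
    simp only [Shape.edges, List.mem_cons, List.not_mem_nil, or_false,
      forall_eq_or_imp, forall_eq] at hb he
    obtain ⟨⟨_, _⟩, ⟨_, _⟩, ⟨_, _⟩⟩ := hb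
    rcases he with rfl | rfl | rfl <;>
    · rcases eq_or_ne t 1 with rfl | ht
      · simp [Shape.lift, AffineMap.lineMap_apply, bubble, *]
      · have : 1 - t ≠ 0 := sub_ne_zero.2 ht.symm
        simp [Shape.lift, AffineMap.lineMap_apply, bubble, *]
        try field_simp
        try ring

open MvPolynomial in
theorem monomial_mem_square {p : ℕ} {i j : ℕ} (hi : i ≤ p) (hj : j ≤ p) :
    (X 0 ^ i * X 1 ^ j : MvPolynomial (Fin 2) ℝ) ∈ Shape.square.polynomials p := by
  rw [Shape.polynomials, mem_restrictDegree]
  intro m hm k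
  rw [X_pow_eq_monomial, X_pow_eq_monomial, monomial_mul] at hm
  have := support_monomial_subset hm
  rw [Finset.mem_singleton] at this
  subst this
  fin_cases k <;> simpa

open MvPolynomial in
theorem aeval_mul_mem_square {p : ℕ} {P Q : Polynomial ℝ} (hP : P.natDegree ≤ p)
    (hQ : Q.natDegree ≤ p) :
    Polynomial.aeval (X 0 : MvPolynomial (Fin 2) ℝ) P * Polynomial.aeval (X 1) Q
      ∈ Shape.square.polynomials p := by
  rw [Polynomial.aeval_eq_sum_range' (Nat.lt_succ_of_le hP),
    Polynomial.aeval_eq_sum_range' (Nat.lt_succ_of_le hQ), Finset.sum_mul_sum]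
  refine Submodule.sum_mem _ fun i hi => Submodule.sum_mem _ fun j hj => ?_
  rw [smul_mul_smul_comm]
  exact Submodule.smul_mem _ _ (monomial_mem_square (Nat.lt_succ_iff.1 (Finset.mem_range.1 hi))
    (Nat.lt_succ_iff.1 (Finset.mem_range.1 hj)))

open MvPolynomial in
theorem totalDegree_aeval_le {p : ℕ} {P : Polynomial ℝ} (hP : P.natDegree ≤ p)
    {l : MvPolynomial (Fin 2) ℝ} (hl : l.totalDegree ≤ 1) :
    (Polynomial.aeval l P).totalDegree ≤ p := by
  rw [Polynomial.aeval_eq_sum_range' (Nat.lt_succ_of_le hP)]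
  refine (totalDegree_finsetSum _ _).trans (Finset.sup_le fun i hi => ?_)
  refine (totalDegree_smul_le _ _).trans ((totalDegree_pow _ _).trans ?_)
  have := Nat.lt_succ_iff.1 (Finset.mem_range.1 hi)
  nlinarith

open MvPolynomial in
theorem eval_aeval (P : Polynomial ℝ) (l : MvPolynomial (Fin 2) ℝ) (z : Fin 2 → ℝ) :
    MvPolynomial.eval z (Polynomial.aeval l P) = P.eval (MvPolynomial.eval z l) := by
  rw [← MvPolynomial.coe_aeval_eq_eval, RingHom.coe_coe, ← Polynomial.aeval_algHom_apply,
    Polynomial.coe_aeval_eq_eval]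

open MvPolynomial in
/-- The bubble of a polynomial that vanishes at both end points of the edge is a polynomial of the
same degree, as the factor `1 - lB` cancels. -/
theorem exists_bubble_polynomial {p : ℕ} (hp : 1 ≤ p) {P : Polynomial ℝ} (hP : P.natDegree ≤ p)
    (hP1 : P.eval 1 = 0) {lA lB : MvPolynomial (Fin 2) ℝ} (hA : lA.totalDegree ≤ 1)
    (hB : lB.totalDegree ≤ 1) :
    ∃ q ∈ Shape.triangle.polynomials p, ∀ z : Fin 2 → ℝ, (eval z lB = 1 → eval z lA = 0) →
      bubble (fun t => P.eval t) (eval z lB) (eval z lA) = eval z q := by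
  obtain ⟨R, rfl⟩ := Polynomial.dvd_iff_isRoot.2 hP1
  refine ⟨-(Polynomial.aeval lB R * lA), ?_, fun z hz => ?_⟩
  · refine Submodule.neg_mem _ ((mem_restrictTotalDegree _ _ _).2 ?_)
    have hR : R.natDegree ≤ p - 1 := by
      rcases eq_or_ne R 0 with rfl | hR0
      · simp
      · rw [Polynomial.natDegree_mul (Polynomial.X_sub_C_ne_zero 1) hR0,
          Polynomial.natDegree_X_sub_C] at hP
        omega
    refine (totalDegree_mul _ _).trans ?_
    have := totalDegree_aeval_le hR hB
    omega
  · rw [map_neg, map_mul, eval_aeval, bubble, Polynomial.eval_mul]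
    rcases eq_or_ne (eval z lB) 1 with h | h
    · simp [h, hz h]
    · have : 1 - eval z lB ≠ 0 := sub_ne_zero.2 h.symm
      simp only [Polynomial.eval_sub, Polynomial.eval_X, Polynomial.eval_C]
      field_simp
      ring

open MvPolynomial in
/-- The lifting of polynomial edge data is a polynomial. -/
theorem Shape.exists_lift_polynomial {s : Shape} {p : ℕ} (hp : 1 ≤ p) {ν : Plane → ℝ}
    {b : Plane × Plane → ℝ → ℝ} (hb : ∀ e ∈ s.edges, b e 0 = ν e.1 ∧ b e 1 = ν e.2)
    (hP : ∀ e ∈ s.edges, ∃ P : Polynomial ℝ, P.natDegree ≤ p ∧ ∀ t ∈ Icc (0 : ℝ) 1, b e t = P.eval t) :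
    ∃ q ∈ s.polynomials p, ∀ z ∈ s.closedCell, s.lift ν b z = eval (fun i => z i) q := by
  cases s with
  | square =>
    simp only [Shape.edges, List.mem_cons, List.not_mem_nil, or_false,
      forall_eq_or_imp, forall_eq] at hb hP
    obtain ⟨⟨P1, d1, e1⟩, ⟨P2, d2, e2⟩, ⟨P3, d3, e3⟩, ⟨P4, d4, e4⟩⟩ := hP
    have dX : (Polynomial.X : Polynomial ℝ).natDegree ≤ p := by simpa using hp
    have dY : (1 - Polynomial.X : Polynomial ℝ).natDegree ≤ p :=
      (Polynomial.natDegree_sub_le _ _).trans (by simpa using hp)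
    refine ⟨Polynomial.aeval (X 0) P1 * Polynomial.aeval (X 1) (1 - Polynomial.X : Polynomial ℝ)
      + Polynomial.aeval (X 0) P3 * Polynomial.aeval (X 1) (Polynomial.X : Polynomial ℝ)
      + Polynomial.aeval (X 0) (1 - Polynomial.X : Polynomial ℝ) * Polynomial.aeval (X 1) P4
      + Polynomial.aeval (X 0) (Polynomial.X : Polynomial ℝ) * Polynomial.aeval (X 1) P2
      - (ν !₂[0, 0] • (Polynomial.aeval (X 0) (1 - Polynomial.X : Polynomial ℝ)
          * Polynomial.aeval (X 1) (1 - Polynomial.X : Polynomial ℝ))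
        + ν !₂[1, 0] • (Polynomial.aeval (X 0) (Polynomial.X : Polynomial ℝ)
          * Polynomial.aeval (X 1) (1 - Polynomial.X : Polynomial ℝ))
        + ν !₂[0, 1] • (Polynomial.aeval (X 0) (1 - Polynomial.X : Polynomial ℝ)
          * Polynomial.aeval (X 1) (Polynomial.X : Polynomial ℝ))
        + ν !₂[1, 1] • (Polynomial.aeval (X 0) (Polynomial.X : Polynomial ℝ)
          * Polynomial.aeval (X 1) (Polynomial.X : Polynomial ℝ))), ?_, ?_⟩
    · refine Submodule.sub_mem _ (Submodule.add_mem _ (Submodule.add_mem _ (Submodule.add_mem _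
        (aeval_mul_mem_square d1 dY) (aeval_mul_mem_square d3 dX)) (aeval_mul_mem_square dY d4))
        (aeval_mul_mem_square dX d2)) (Submodule.add_mem _ (Submodule.add_mem _
        (Submodule.add_mem _ ?_ ?_) ?_) ?_) <;> refine Submodule.smul_mem _ _ ?_
      exacts [aeval_mul_mem_square dY dY, aeval_mul_mem_square dX dY,
        aeval_mul_mem_square dY dX, aeval_mul_mem_square dX dX]
    · rintro z ⟨h1, h2, h3, h4⟩
      simp only [Shape.lift, map_add, map_sub, map_mul, smul_eval, eval_aeval, eval_X,
        e1 _ ⟨h1, h2⟩, e3 _ ⟨h1, h2⟩, e2 _ ⟨h3, h4⟩, e4 _ ⟨h3, h4⟩,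
        Polynomial.eval_one, Polynomial.eval_X]
      ring
  | triangle =>
    simp only [Shape.edges, List.mem_cons, List.not_mem_nil, or_false,
      forall_eq_or_imp, forall_eq] at hb hP
    obtain ⟨⟨P1, d1, e1⟩, ⟨P2, d2, e2⟩, ⟨P3, d3, e3⟩⟩ := hP
    obtain ⟨⟨-, b1⟩, ⟨-, b2⟩, ⟨-, b3⟩⟩ := hb
    have dlin : ∀ a c : ℝ, ((1 - Polynomial.X) * Polynomial.C a + Polynomial.X * Polynomial.C c :
        Polynomial ℝ).natDegree ≤ p := fun a c => by
      rw [show ((1 - Polynomial.X) * Polynomial.C a + Polynomial.X * Polynomial.C c :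
        Polynomial ℝ) = Polynomial.C (c - a) * Polynomial.X + Polynomial.C a by
          rw [Polynomial.C_sub]; ring]
      exact Polynomial.natDegree_linear_le.trans hp
    have lX : ∀ i : Fin 2, (X i : MvPolynomial (Fin 2) ℝ).totalDegree ≤ 1 := fun i => by simp
    have l0 : (1 - X 0 - X 1 : MvPolynomial (Fin 2) ℝ).totalDegree ≤ 1 :=
      (totalDegree_sub _ _).trans (max_le ((totalDegree_sub _ _).trans (by simp)) (lX 1))
    have one_mem : (Icc (0 : ℝ) 1) 1 := ⟨zero_le_one, le_rfl⟩
    obtain ⟨q1, m1, f1⟩ := exists_bubble_polynomial hp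
      ((Polynomial.natDegree_sub_le P1 _).trans (max_le d1 (dlin (ν !₂[0, 0]) (ν !₂[1, 0]))))
      (by simp [← e1 1 one_mem, b1]) l0 (lX 0)
    obtain ⟨q2, m2, f2⟩ := exists_bubble_polynomial hp
      ((Polynomial.natDegree_sub_le P2 _).trans (max_le d2 (dlin (ν !₂[1, 0]) (ν !₂[0, 1]))))
      (by simp [← e2 1 one_mem, b2]) (lX 0) (lX 1)
    obtain ⟨q3, m3, f3⟩ := exists_bubble_polynomial hp
      ((Polynomial.natDegree_sub_le P3 _).trans (max_le d3 (dlin (ν !₂[0, 0]) (ν !₂[0, 1]))))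
      (by simp [← e3 1 one_mem, b3]) l0 (lX 1)
    refine ⟨ν !₂[0, 0] • (1 - X 0 - X 1) + ν !₂[1, 0] • X 0 + ν !₂[0, 1] • X 1 + q1 + q2 + q3,
      ?_, ?_⟩
    · refine Submodule.add_mem _ (Submodule.add_mem _ (Submodule.add_mem _ (Submodule.add_mem _
        (Submodule.add_mem _ ?_ ?_) ?_) m1) m2) m3 <;>
      refine Submodule.smul_mem _ _ ((mem_restrictTotalDegree _ _ _).2 (le_trans ?_ hp))
      exacts [l0, lX 0, lX 1]
    · rintro z ⟨h1, h2, h3, h4⟩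
      have g1 := f1 (fun i => z i) (by simp only [map_sub, map_one, eval_X]; intro h; linarith)
      have g2 := f2 (fun i => z i) (by simp only [eval_X]; intro h; linarith)
      have g3 := f3 (fun i => z i) (by simp only [map_sub, map_one, eval_X]; intro h; linarith)
      simp only [bubble, map_sub, map_one, eval_X, Polynomial.eval_sub, Polynomial.eval_add,
        Polynomial.eval_mul, Polynomial.eval_one, Polynomial.eval_X, Polynomial.eval_C] at g1 g2 g3
      simp only [Shape.lift, bubble, map_add, map_sub, map_one, smul_eval, eval_X, ← g1, ← g2, ← g3,
        e1 _ ⟨h1, h2⟩, e2 _ ⟨h3, (by linarith : z 1 ≤ 1)⟩, e3 _ ⟨h3, (by linarith : z 1 ≤ 1)⟩]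
      ring

end HpFEM

namespace HpFEM

/-! ### Geometry of the reference cells -/

theorem mem_edgeSet {e : Plane × Plane} {w : Plane} :
    w ∈ edgeSet e ↔ ∃ t ∈ Icc (0 : ℝ) 1, AffineMap.lineMap e.1 e.2 t = w := by
  rw [edgeSet, segment_eq_image_lineMap]; rfl

theorem lineMap_apply_coord (a b : Plane) (t : ℝ) (i : Fin 2) :
    AffineMap.lineMap a b t i = (1 - t) * a i + t * b i := by
  simp [AffineMap.lineMap_apply]; ring

theorem plane_ext {a b : Plane} (h0 : a 0 = b 0) (h1 : a 1 = b 1) : a = b := by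
  ext i; fin_cases i <;> assumption

theorem continuous_coord (i : Fin 2) : Continuous (fun z : Plane => z i) :=
  (EuclideanSpace.proj (𝕜 := ℝ) i).continuous

theorem Shape.isOpen_cell (s : Shape) : IsOpen s.cell := by
  have h0 := continuous_coord 0
  have h1 := continuous_coord 1
  cases s with
  | square =>
    exact (isOpen_lt continuous_const h0).inter ((isOpen_lt h0 continuous_const).inter
      ((isOpen_lt continuous_const h1).inter (isOpen_lt h1 continuous_const)))
  | triangle =>
    exact (isOpen_lt continuous_const h0).inter ((isOpen_lt h0 continuous_const).inter
      ((isOpen_lt continuous_const h1).inter (isOpen_lt h1 (continuous_const.sub h0))))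

theorem Shape.isClosed_closedCell (s : Shape) : IsClosed s.closedCell := by
  have h0 := continuous_coord 0
  have h1 := continuous_coord 1
  cases s with
  | square =>
    exact (isClosed_le continuous_const h0).inter ((isClosed_le h0 continuous_const).inter
      ((isClosed_le continuous_const h1).inter (isClosed_le h1 continuous_const)))
  | triangle =>
    exact (isClosed_le continuous_const h0).inter ((isClosed_le h0 continuous_const).inter
      ((isClosed_le continuous_const h1).inter (isClosed_le h1 (continuous_const.sub h0))))

theorem Shape.closedCell_subset_square (s : Shape) : s.closedCell ⊆ Shape.square.closedCell := by
  cases s with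
  | square => exact subset_rfl
  | triangle => rintro z ⟨h1, h2, h3, h4⟩; exact ⟨h1, h2, h3, by linarith⟩

theorem Shape.isCompact_closedCell (s : Shape) : IsCompact s.closedCell := by
  refine Metric.isCompact_of_isClosed_isBounded s.isClosed_closedCell ?_
  refine (Metric.isBounded_closedBall (x := (0 : Plane)) (r := 2)).subset fun z hz => ?_
  obtain ⟨h1, h2, h3, h4⟩ := s.closedCell_subset_square hz
  rw [mem_closedBall_zero_iff, EuclideanSpace.norm_eq, Fin.sum_univ_two, Real.sqrt_le_left zero_le_two]
  simp only [Real.norm_eq_abs, sq_abs]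
  nlinarith

theorem Shape.cell_subset_closedCell (s : Shape) : s.cell ⊆ s.closedCell := by
  cases s <;> exact fun z ⟨h1, h2, h3, h4⟩ => ⟨h1.le, h2.le, h3.le, h4.le⟩

theorem Shape.convex_closedCell (s : Shape) : Convex ℝ s.closedCell := by
  intro x hx y hy a b ha hb hab
  cases s <;>
  · obtain ⟨x1, x2, x3, x4⟩ := hx
    obtain ⟨y1, y2, y3, y4⟩ := hy
    simp only [Shape.closedCell, mem_ofPred_eq, PiLp.add_apply, PiLp.smul_apply, smul_eq_mul]
    refine ⟨?_, ?_, ?_, ?_⟩ <;> nlinarith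

theorem Shape.convex_cell (s : Shape) : Convex ℝ s.cell := by
  intro x hx y hy a b ha hb hab
  obtain rfl : b = 1 - a := by linarith
  cases s <;>
  · obtain ⟨x1, x2, x3, x4⟩ := hx
    obtain ⟨y1, y2, y3, y4⟩ := hy
    simp only [Shape.cell, mem_ofPred_eq, PiLp.add_apply, PiLp.smul_apply, smul_eq_mul]
    rcases ha.eq_or_lt with rfl | ha
    · simp only [zero_mul, zero_add, sub_zero, one_mul]
      exact ⟨y1, y2, y3, y4⟩
    · refine ⟨?_, ?_, ?_, ?_⟩ <;> nlinarith

theorem Shape.closedCell_subset_closure (s : Shape) : s.closedCell ⊆ closure s.cell := by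
  intro z hz
  have hc : Continuous fun t : ℝ => AffineMap.lineMap z (!₂[1 / 3, 1 / 3] : Plane) t :=
    AffineMap.lineMap_continuous
  have ht : Tendsto (fun t : ℝ => AffineMap.lineMap z (!₂[1 / 3, 1 / 3] : Plane) t) (𝓝[>] 0) (𝓝 z) := by
    have := (hc.tendsto 0).mono_left (nhdsWithin_le_nhds (s := Ioi 0))
    simpa using this
  refine mem_closure_of_tendsto ht ?_
  filter_upwards [Ioc_mem_nhdsGT (zero_lt_one (α := ℝ))] with t ht
  cases s <;>
  · obtain ⟨h1, h2, h3, h4⟩ := hz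
    simp only [Shape.cell, mem_ofPred_eq, lineMap_apply_coord]
    simp
    obtain ⟨ht0, ht1⟩ := ht
    refine ⟨?_, ?_, ?_, ?_⟩ <;> nlinarith

theorem Shape.volume_closedCell_diff (s : Shape) : volume (s.closedCell \ s.cell) = 0 := by
  refine measure_mono_null ?_ (s.convex_cell.addHaar_frontier (μ := volume))
  rw [s.isOpen_cell.frontier_eq]
  exact sdiff_subset_sdiff_left s.closedCell_subset_closure

theorem Shape.vertices_subset {s : Shape} {v : Plane} (hv : v ∈ s.vertices) :
    v ∈ s.closedCell ∧ v ∉ s.cell := by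
  cases s <;> simp only [Shape.vertices, List.mem_cons, List.not_mem_nil, or_false] at hv
  · rcases hv with rfl | rfl | rfl | rfl <;> simp [Shape.closedCell, Shape.cell]
  · rcases hv with rfl | rfl | rfl <;> simp [Shape.closedCell, Shape.cell]

theorem Shape.edges_mem_vertices {s : Shape} {e : Plane × Plane} (he : e ∈ s.edges) :
    e.1 ∈ s.vertices ∧ e.2 ∈ s.vertices := by
  cases s <;> simp only [Shape.edges, List.mem_cons, List.not_mem_nil, or_false] at he
  · rcases he with rfl | rfl | rfl | rfl <;> simp [Shape.vertices]
  · rcases he with rfl | rfl | rfl <;> simp [Shape.vertices]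

theorem Shape.edges_ne {s : Shape} {e : Plane × Plane} (he : e ∈ s.edges) : e.1 ≠ e.2 := by
  intro h
  have h0 := congrArg (fun z : Plane => z 0) h
  have h1 := congrArg (fun z : Plane => z 1) h
  cases s <;> simp only [Shape.edges, List.mem_cons, List.not_mem_nil, or_false] at he
  · rcases he with rfl | rfl | rfl | rfl <;> simp at h0 h1
  · rcases he with rfl | rfl | rfl <;> simp at h0 h1

theorem Shape.edgeSet_subset {s : Shape} {e : Plane × Plane} (he : e ∈ s.edges) :
    edgeSet e ⊆ s.closedCell :=
  s.convex_closedCell.segment_subset (vertices_subset (edges_mem_vertices he).1).1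
    (vertices_subset (edges_mem_vertices he).2).1

theorem Shape.notMem_cell_of_mem_edgeSet {s : Shape} {e : Plane × Plane} (he : e ∈ s.edges)
    {w : Plane} (hw : w ∈ edgeSet e) : w ∉ s.cell := by
  obtain ⟨t, -, rfl⟩ := mem_edgeSet.1 hw
  cases s <;> simp only [Shape.edges, List.mem_cons, List.not_mem_nil, or_false] at he
  · rcases he with rfl | rfl | rfl | rfl <;> simp [Shape.cell, AffineMap.lineMap_apply]
  · rcases he with rfl | rfl | rfl <;> simp [Shape.cell, AffineMap.lineMap_apply]

theorem Shape.exists_edge_of_notMem_cell {s : Shape} {w : Plane} (hw : w ∈ s.closedCell)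
    (hw' : w ∉ s.cell) : ∃ e ∈ s.edges, w ∈ edgeSet e := by
  obtain ⟨h1, h2, h3, h4⟩ := s.closedCell_subset_square hw
  cases s with
  | square =>
    rcases h1.eq_or_lt with g1 | g1
    · refine ⟨(!₂[0, 0], !₂[0, 1]), by simp [Shape.edges], mem_edgeSet.2 ⟨w 1, ⟨h3, h4⟩, ?_⟩⟩
      apply plane_ext <;> simp [lineMap_apply_coord, g1.symm]
    rcases h2.eq_or_lt with g2 | g2
    · refine ⟨(!₂[1, 0], !₂[1, 1]), by simp [Shape.edges], mem_edgeSet.2 ⟨w 1, ⟨h3, h4⟩, ?_⟩⟩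
      apply plane_ext <;> simp [lineMap_apply_coord, g2]
    rcases h3.eq_or_lt with g3 | g3
    · refine ⟨(!₂[0, 0], !₂[1, 0]), by simp [Shape.edges], mem_edgeSet.2 ⟨w 0, ⟨h1, h2⟩, ?_⟩⟩
      apply plane_ext <;> simp [lineMap_apply_coord, g3.symm]
    rcases h4.eq_or_lt with g4 | g4
    · refine ⟨(!₂[0, 1], !₂[1, 1]), by simp [Shape.edges], mem_edgeSet.2 ⟨w 0, ⟨h1, h2⟩, ?_⟩⟩
      apply plane_ext <;> simp [lineMap_apply_coord, g4]
    exact absurd ⟨g1, g2, g3, g4⟩ hw'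
  | triangle =>
    have h5 := hw.2.2.2
    rcases h1.eq_or_lt with g1 | g1
    · refine ⟨(!₂[0, 0], !₂[0, 1]), by simp [Shape.edges], mem_edgeSet.2 ⟨w 1, ⟨h3, h4⟩, ?_⟩⟩
      apply plane_ext <;> simp [lineMap_apply_coord, g1.symm]
    rcases h3.eq_or_lt with g3 | g3
    · refine ⟨(!₂[0, 0], !₂[1, 0]), by simp [Shape.edges], mem_edgeSet.2 ⟨w 0, ⟨h1, h2⟩, ?_⟩⟩
      apply plane_ext <;> simp [lineMap_apply_coord, g3.symm]
    rcases h5.eq_or_lt with g5 | g5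
    · refine ⟨(!₂[1, 0], !₂[0, 1]), by simp [Shape.edges], mem_edgeSet.2 ⟨w 1, ⟨h3, h4⟩, ?_⟩⟩
      apply plane_ext <;> simp [lineMap_apply_coord, g5]
    exact absurd ⟨g1, by linarith, g3, g5⟩ hw'

/-- Distinct edges of a reference cell meet at most in vertices. -/
theorem Shape.edge_unique {s : Shape} {e e' : Plane × Plane} (he : e ∈ s.edges) (he' : e' ∈ s.edges)
    {w : Plane} (hw : w ∈ edgeSet e) (hw' : w ∈ edgeSet e') (hv : w ∉ s.vertices) : e = e' := by
  obtain ⟨t, -, ht⟩ := mem_edgeSet.1 hw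
  obtain ⟨t', -, ht'⟩ := mem_edgeSet.1 hw'
  have key : ∀ {a b : ℝ}, w 0 = a → w 1 = b → w = !₂[a, b] := fun h0 h1 =>
    plane_ext (by simpa using h0) (by simpa using h1)
  have a0 : ∀ i, (1 - t) * e.1 i + t * e.2 i = w i := fun i => by rw [← ht, lineMap_apply_coord]
  have a1 : ∀ i, (1 - t') * e'.1 i + t' * e'.2 i = w i := fun i => by rw [← ht', lineMap_apply_coord]
  have b0 := a0 0
  have b1 := a0 1
  have c0 := a1 0
  have c1 := a1 1
  clear ht ht' hw hw' a0 a1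
  cases s with
  | square =>
    simp only [Shape.edges, Shape.vertices, List.mem_cons, List.not_mem_nil, or_false] at he he' hv
    push Not at hv
    obtain ⟨v1, v2, v3, v4⟩ := hv
    rcases he with rfl | rfl | rfl | rfl <;> rcases he' with rfl | rfl | rfl | rfl <;>
      simp at b0 b1 c0 c1 <;> first
      | rfl
      | exact absurd (key (by linarith) (by linarith)) v1
      | exact absurd (key (by linarith) (by linarith)) v2
      | exact absurd (key (by linarith) (by linarith)) v3
      | exact absurd (key (by linarith) (by linarith)) v4
  | triangle =>
    simp only [Shape.edges, Shape.vertices, List.mem_cons, List.not_mem_nil, or_false] at he he' hv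
    push Not at hv
    obtain ⟨v1, v2, v3⟩ := hv
    rcases he with rfl | rfl | rfl <;> rcases he' with rfl | rfl | rfl <;>
      simp at b0 b1 c0 c1 <;> first
      | rfl
      | exact absurd (key (by linarith) (by linarith)) v1
      | exact absurd (key (by linarith) (by linarith)) v2
      | exact absurd (key (by linarith) (by linarith)) v3

theorem Shape.eq_endpoint_of_vertex {s : Shape} {e : Plane × Plane} (he : e ∈ s.edges) {v : Plane}
    (hv : v ∈ s.vertices) (hve : v ∈ edgeSet e) : v = e.1 ∨ v = e.2 := by
  obtain ⟨t, -, rfl⟩ := mem_edgeSet.1 hve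
  have ht : t = 0 ∨ t = 1 := by
    cases s <;> simp only [Shape.edges, Shape.vertices, List.mem_cons, List.not_mem_nil, or_false] at he hv
    · rcases he with rfl | rfl | rfl | rfl <;> rcases hv with hv | hv | hv | hv <;>
      · have h0 := congrArg (fun z : Plane => z 0) hv
        have h1 := congrArg (fun z : Plane => z 1) hv
        simp [lineMap_apply_coord] at h0 h1 <;> first
          | (left; linarith)
          | (right; linarith)
    · rcases he with rfl | rfl | rfl <;> rcases hv with hv | hv | hv <;>
      · have h0 := congrArg (fun z : Plane => z 0) hv
        have h1 := congrArg (fun z : Plane => z 1) hv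
        simp [lineMap_apply_coord] at h0 h1 <;> first
          | (left; linarith)
          | (right; linarith)
  rcases ht with rfl | rfl <;> simp

/-! ### Segments -/

theorem lineMap_eq_of_segment_eq {E : Type*} [NormedAddCommGroup E] [NormedSpace ℝ E] {a b a' b' : E}
    (hab : a ≠ b) (h : segment ℝ a b = segment ℝ a' b') : (a = a' ∧ b = b') ∨ (a = b' ∧ b = a') := by
  have len : ∀ {a b a' b' : E}, segment ℝ a b ⊆ segment ℝ a' b' →
      ∃ t ∈ Icc (0 : ℝ) 1, ∃ s ∈ Icc (0 : ℝ) 1, AffineMap.lineMap a' b' t = a ∧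
        AffineMap.lineMap a' b' s = b ∧ dist a b = |t - s| * dist a' b' := by
    intro a b a' b' h
    have ha := h (left_mem_segment ℝ a b)
    have hb := h (right_mem_segment ℝ a b)
    rw [segment_eq_image_lineMap] at ha hb
    obtain ⟨t, ht, rfl⟩ := ha
    obtain ⟨s, hs, rfl⟩ := hb
    exact ⟨t, ht, s, hs, rfl, rfl, by rw [dist_lineMap_lineMap, Real.dist_eq]⟩
  obtain ⟨t, ht, s, hs, rfl, rfl, h1⟩ := len h.le
  obtain ⟨t', ht', s', hs', -, -, h2⟩ := len h.ge
  have hle : ∀ {x y : ℝ}, x ∈ Icc (0 : ℝ) 1 → y ∈ Icc (0 : ℝ) 1 → |x - y| ≤ 1 := fun hx hy => by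
    rw [abs_le]; constructor <;> linarith [hx.1, hx.2, hy.1, hy.2]
  have hpos := dist_pos.2 hab
  set D := dist (AffineMap.lineMap a' b' t : E) (AffineMap.lineMap a' b' s)
  set D' := dist a' b'
  have hD' : 0 ≤ D' := dist_nonneg
  have h3 : D' ≤ D := by
    rw [h2]; exact mul_le_of_le_one_left hpos.le (hle ht' hs')
  have hts : |t - s| = 1 := by
    refine le_antisymm (hle ht hs) ?_
    by_contra hlt
    nlinarith [abs_nonneg (t - s)]
  rcases (abs_eq zero_le_one).1 hts with h4 | h4
  · have : t = 1 := by linarith [ht.2, hs.1]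
    have : s = 0 := by linarith
    subst_vars
    right; simp
  · have : t = 0 := by linarith [ht.1, hs.2]
    have : s = 1 := by linarith
    subst_vars
    left; simp

end HpFEM

namespace HpFEM

/-! ### Elements of the refinement patterns -/

namespace PatchElement

theorem map_apply (e : PatchElement) (z : Plane) (i : Fin 2) :
    e.map z i = e.origin i + z 0 * e.dirX i + z 1 * e.dirY i := by
  simp [PatchElement.map]

theorem map_lineMap (e : PatchElement) (a b : Plane) (t : ℝ) :
    e.map (AffineMap.lineMap a b t) = AffineMap.lineMap (e.map a) (e.map b) t := by
  apply plane_ext <;> simp only [lineMap_apply_coord, map_apply] <;> ring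

theorem image_edgeSet (e : PatchElement) (d : Plane × Plane) :
    e.map '' edgeSet d = segment ℝ (e.map d.1) (e.map d.2) := by
  rw [edgeSet, segment_eq_image_lineMap, segment_eq_image_lineMap, image_image]
  simp only [map_lineMap]

/-- A patch element is contained in every convex set that contains its vertices. -/
theorem map_mem_of_vertices (e : PatchElement) {C : Set Plane} (hC : Convex ℝ C)
    (h : ∀ v ∈ e.shape.vertices, e.map v ∈ C) {z : Plane} (hz : z ∈ e.shape.closedCell) :
    e.map z ∈ C := by
  have hl : ∀ {a b : Plane} {t : ℝ}, e.map a ∈ C → e.map b ∈ C → 0 ≤ t → t ≤ 1 →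
      e.map (AffineMap.lineMap a b t) ∈ C := fun ha hb h0 h1 => by
    rw [map_lineMap]; exact hC.lineMap_mem ha hb ⟨h0, h1⟩
  obtain ⟨k, s, o, u, v⟩ := e
  cases s with
  | square =>
    simp only [Shape.vertices, List.mem_cons, List.not_mem_nil, or_false, forall_eq_or_imp,
      forall_eq] at h
    obtain ⟨h1, h2, h3, h4⟩ := h
    obtain ⟨z1, z2, z3, z4⟩ := hz
    have := hl (hl h1 h2 z1 z2) (hl h4 h3 z1 z2) z3 z4
    convert this using 2
    apply plane_ext <;> simp [lineMap_apply_coord] <;> ring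
  | triangle =>
    simp only [Shape.vertices, List.mem_cons, List.not_mem_nil, or_false, forall_eq_or_imp,
      forall_eq] at h
    obtain ⟨h1, h2, h3⟩ := h
    obtain ⟨z1, z2, z3, z4⟩ := hz
    rcases (by linarith : 0 ≤ z 0 + z 1).eq_or_lt with h0 | h0
    · have e0 : z 0 = 0 := by linarith
      have e1 : z 1 = 0 := by linarith
      convert h1 using 2
      apply plane_ext
      · simp [e0]
      · simp [e1]
    · have := hl h1 (hl h2 h3 (t := z 1 / (z 0 + z 1)) (by positivity)
        (div_le_one_of_le₀ (by linarith) h0.le)) h0.le (by linarith)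
      convert this using 2
      apply plane_ext <;> simp [lineMap_apply_coord]
      · field_simp; ring
      · field_simp

/-- The linear part of an element map is invertible. -/
def Nondegenerate (e : PatchElement) : Prop :=
  e.dirX 0 * e.dirY 1 - e.dirX 1 * e.dirY 0 ≠ 0

theorem Nondegenerate.injective {e : PatchElement} (h : e.Nondegenerate) :
    Function.Injective e.map := by
  intro a b hab
  have h0 := congrArg (fun z : Plane => z 0) hab
  have h1 := congrArg (fun z : Plane => z 1) hab
  simp only [map_apply] at h0 h1
  have k0 : (e.dirX 0 * e.dirY 1 - e.dirX 1 * e.dirY 0) * (a 0 - b 0) = 0 := by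
    linear_combination e.dirY 1 * h0 - e.dirY 0 * h1
  have k1 : (e.dirX 0 * e.dirY 1 - e.dirX 1 * e.dirY 0) * (a 1 - b 1) = 0 := by
    linear_combination e.dirX 0 * h1 - e.dirX 1 * h0
  exact plane_ext (sub_eq_zero.1 ((mul_eq_zero.1 k0).resolve_left h))
    (sub_eq_zero.1 ((mul_eq_zero.1 k1).resolve_left h))

end PatchElement

theorem forall_vertices_rectangle {k : ElementKind} {x₀ x₁ y₀ y₁ : ℝ} {Φ : Plane → Prop} :
    (∀ v ∈ (rectangle k x₀ x₁ y₀ y₁).shape.vertices, Φ ((rectangle k x₀ x₁ y₀ y₁).map v)) ↔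
      Φ !₂[x₀, y₀] ∧ Φ !₂[x₁, y₀] ∧ Φ !₂[x₁, y₁] ∧ Φ !₂[x₀, y₁] := by
  have e1 : (rectangle k x₀ x₁ y₀ y₁).map !₂[0, 0] = !₂[x₀, y₀] := by
    apply plane_ext <;> simp [PatchElement.map_apply, rectangle]
  have e2 : (rectangle k x₀ x₁ y₀ y₁).map !₂[1, 0] = !₂[x₁, y₀] := by
    apply plane_ext <;> simp [PatchElement.map_apply, rectangle]
  have e3 : (rectangle k x₀ x₁ y₀ y₁).map !₂[1, 1] = !₂[x₁, y₁] := by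
    apply plane_ext <;> simp [PatchElement.map_apply, rectangle]
  have e4 : (rectangle k x₀ x₁ y₀ y₁).map !₂[0, 1] = !₂[x₀, y₁] := by
    apply plane_ext <;> simp [PatchElement.map_apply, rectangle]
  rw [show (rectangle k x₀ x₁ y₀ y₁).shape = Shape.square from rfl]
  simp only [Shape.vertices, List.mem_cons, List.not_mem_nil, or_false, forall_eq_or_imp,
    forall_eq, e1, e2, e3, e4]

theorem forall_edges_rectangle {k : ElementKind} {x₀ x₁ y₀ y₁ : ℝ} {Φ : Plane → Plane → Prop} :
    (∀ d ∈ (rectangle k x₀ x₁ y₀ y₁).shape.edges,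
      Φ ((rectangle k x₀ x₁ y₀ y₁).map d.1) ((rectangle k x₀ x₁ y₀ y₁).map d.2)) ↔
      Φ !₂[x₀, y₀] !₂[x₁, y₀] ∧ Φ !₂[x₁, y₀] !₂[x₁, y₁] ∧ Φ !₂[x₀, y₁] !₂[x₁, y₁] ∧
        Φ !₂[x₀, y₀] !₂[x₀, y₁] := by
  have e1 : (rectangle k x₀ x₁ y₀ y₁).map !₂[0, 0] = !₂[x₀, y₀] := by
    apply plane_ext <;> simp [PatchElement.map_apply, rectangle]
  have e2 : (rectangle k x₀ x₁ y₀ y₁).map !₂[1, 0] = !₂[x₁, y₀] := by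
    apply plane_ext <;> simp [PatchElement.map_apply, rectangle]
  have e3 : (rectangle k x₀ x₁ y₀ y₁).map !₂[1, 1] = !₂[x₁, y₁] := by
    apply plane_ext <;> simp [PatchElement.map_apply, rectangle]
  have e4 : (rectangle k x₀ x₁ y₀ y₁).map !₂[0, 1] = !₂[x₀, y₁] := by
    apply plane_ext <;> simp [PatchElement.map_apply, rectangle]
  rw [show (rectangle k x₀ x₁ y₀ y₁).shape = Shape.square from rfl]
  simp only [Shape.edges, List.mem_cons, List.not_mem_nil, or_false, forall_eq_or_imp,
    forall_eq, e1, e2, e3, e4]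

theorem triangle_map_vertices {k : ElementKind} {P Q R : Plane} :
    (triangle k P Q R).map !₂[0, 0] = P ∧ (triangle k P Q R).map !₂[1, 0] = Q ∧
      (triangle k P Q R).map !₂[0, 1] = R := by
  refine ⟨?_, ?_, ?_⟩ <;> apply plane_ext <;> simp [PatchElement.map_apply, triangle]

theorem forall_vertices_triangle {k : ElementKind} {P Q R : Plane} {Φ : Plane → Prop} :
    (∀ v ∈ (triangle k P Q R).shape.vertices, Φ ((triangle k P Q R).map v)) ↔ Φ P ∧ Φ Q ∧ Φ R := by
  obtain ⟨e1, e2, e3⟩ := triangle_map_vertices (k := k) (P := P) (Q := Q) (R := R)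
  rw [show (triangle k P Q R).shape = Shape.triangle from rfl]
  simp only [Shape.vertices, List.mem_cons, List.not_mem_nil, or_false, forall_eq_or_imp,
    forall_eq, e1, e2, e3]

theorem forall_edges_triangle {k : ElementKind} {P Q R : Plane} {Φ : Plane → Plane → Prop} :
    (∀ d ∈ (triangle k P Q R).shape.edges,
      Φ ((triangle k P Q R).map d.1) ((triangle k P Q R).map d.2)) ↔ Φ P Q ∧ Φ Q R ∧ Φ P R := by
  obtain ⟨e1, e2, e3⟩ := triangle_map_vertices (k := k) (P := P) (Q := Q) (R := R)
  rw [show (triangle k P Q R).shape = Shape.triangle from rfl]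
  simp only [Shape.edges, List.mem_cons, List.not_mem_nil, or_false, forall_eq_or_imp,
    forall_eq, e1, e2, e3]

/-- The elements of the refinement patterns, where the layers of the corner refinement are
described by their sizes only. -/
inductive IsPatternElement (κ : ℝ) : ℕ → Pattern → PatchElement → Prop
  | trivial {L} : IsPatternElement κ L .trivial (rectangle .large 0 1 0 1)
  | layerA {L} : IsPatternElement κ L .boundaryLayer (rectangle .aniso 0 1 0 κ)
  | layerL {L} : IsPatternElement κ L .boundaryLayer (rectangle .large 0 1 κ 1)
  | tensorL {L} : IsPatternElement κ L .tensorProduct (rectangle .large κ 1 κ 1)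
  | tensorA {L} : IsPatternElement κ L .tensorProduct (rectangle .aniso κ 1 0 κ)
  | tensorB {L} : IsPatternElement κ L .tensorProduct (rectangle .aniso 0 κ κ 1)
  | mixedL {L} : IsPatternElement κ L .mixed (triangle .large !₂[κ, κ] !₂[1, κ] !₂[1, 1])
  | mixedM {L} : IsPatternElement κ L .mixed (triangle .large !₂[κ, κ] !₂[1, 1] !₂[0, 1])
  | mixedA {L} : IsPatternElement κ L .mixed (rectangle .aniso κ 1 0 κ)
  | mixedB {L} : IsPatternElement κ L .mixed (triangle .aniso !₂[0, κ] !₂[κ, κ] !₂[0, 1])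
  | geometricL {L} : IsPatternElement κ L .geometric (triangle .large !₂[κ, κ] !₂[1, 0] !₂[1, 1])
  | geometricM {L} : IsPatternElement κ L .geometric (triangle .large !₂[κ, κ] !₂[1, 1] !₂[0, 1])
  | geometricA {L} : IsPatternElement κ L .geometric (triangle .aniso !₂[κ, 0] !₂[1, 0] !₂[κ, κ])
  | geometricB {L} : IsPatternElement κ L .geometric (triangle .aniso !₂[0, κ] !₂[κ, κ] !₂[0, 1])
  | cornerSquare {L} {P : Pattern} {h : ℝ} (hP : P = .tensorProduct ∨ P = .mixed ∨ P = .geometric)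
      (h0 : 0 < h) (hκ : h ≤ κ) (hL : L = 0 → h = κ) (hL' : L ≠ 0 → h < κ) :
      IsPatternElement κ L P (rectangle .corner 0 h 0 h)
  | cornerLayer {L} {P : Pattern} {h H : ℝ} {e : PatchElement}
      (hP : P = .tensorProduct ∨ P = .mixed ∨ P = .geometric)
      (h0 : 0 < h) (hH : h < H) (hκ : H ≤ κ) (hL : L ≠ 0) (he : e ∈ HpFEM.cornerLayer h H) :
      IsPatternElement κ L P e

variable {σ κ : ℝ} {L : ℕ}

theorem layer_size_lt (hσ : σ ∈ Ioo (0 : ℝ) 1) (hκ : 0 < κ) (l : ℕ) :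
    0 < κ * σ ^ l ∧ κ * σ ^ (l + 1) < κ * σ ^ l ∧ κ * σ ^ l ≤ κ := by
  have h1 : 0 < σ ^ l := pow_pos hσ.1 l
  refine ⟨by positivity, ?_, mul_le_of_le_one_right hκ.le (pow_le_one₀ hσ.1.le hσ.2.le)⟩
  rw [pow_succ]
  exact mul_lt_mul_of_pos_left (mul_lt_of_lt_one_right h1 hσ.2) hκ

theorem isPatternElement_of_mem_cornerMesh (hσ : σ ∈ Ioo (0 : ℝ) 1) (hκ : 0 < κ) {P : Pattern}
    (hP : P = .tensorProduct ∨ P = .mixed ∨ P = .geometric) {e : PatchElement}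
    (he : e ∈ cornerMesh σ κ L) : IsPatternElement κ L P e := by
  rw [cornerMesh, List.mem_cons] at he
  rcases he with rfl | he
  · obtain ⟨h1, -, h3⟩ := layer_size_lt hσ hκ L
    refine .cornerSquare hP h1 h3 (by rintro rfl; simp) fun hL => ?_
    obtain ⟨l, rfl⟩ := Nat.exists_eq_succ_of_ne_zero hL
    obtain ⟨-, h5, h6⟩ := layer_size_lt hσ hκ l
    exact h5.trans_le h6
  · rw [List.mem_flatMap] at he
    obtain ⟨l, hl, he⟩ := he
    rw [List.mem_range] at hl
    exact .cornerLayer hP (layer_size_lt hσ hκ (l + 1)).1 (layer_size_lt hσ hκ l).2.1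
      (layer_size_lt hσ hκ l).2.2 (by omega) he

theorem isPatternElement_of_mem (hσ : σ ∈ Ioo (0 : ℝ) 1) (hκ : 0 < κ) {P : Pattern}
    {e : PatchElement} (he : e ∈ P.elements σ κ L) : IsPatternElement κ L P e := by
  cases P <;> simp only [Pattern.elements, List.mem_cons, List.not_mem_nil, or_false] at he
  · subst he; exact .trivial
  · rcases he with rfl | rfl
    exacts [.layerA, .layerL]
  · rcases he with rfl | rfl | rfl | he
    exacts [.tensorL, .tensorA, .tensorB,
      isPatternElement_of_mem_cornerMesh hσ hκ (Or.inl rfl) he]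
  · rcases he with rfl | rfl | rfl | rfl | he
    exacts [.mixedL, .mixedM, .mixedA, .mixedB,
      isPatternElement_of_mem_cornerMesh hσ hκ (Or.inr (Or.inl rfl)) he]
  · rcases he with rfl | rfl | rfl | rfl | he
    exacts [.geometricL, .geometricM, .geometricA, .geometricB,
      isPatternElement_of_mem_cornerMesh hσ hκ (Or.inr (Or.inr rfl)) he]

theorem mem_cornerLayer {h H : ℝ} {e : PatchElement} :
    e ∈ cornerLayer h H ↔ e = triangle .corner !₂[h, 0] !₂[H, 0] !₂[h, h] ∨
      e = triangle .corner !₂[h, h] !₂[H, 0] !₂[H, H] ∨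
      e = triangle .corner !₂[h, h] !₂[H, H] !₂[0, H] ∨
      e = triangle .corner !₂[0, h] !₂[h, h] !₂[0, H] := by
  simp [cornerLayer]

/-- The possible positions of the vertices of a refinement pattern. -/
def IsNode (κ : ℝ) (z : Plane) : Prop :=
  ((z 0 = 0 ∨ z 0 = κ ∨ z 0 = 1) ∧ (z 1 = 0 ∨ z 1 = κ ∨ z 1 = 1)) ∨
    ∃ h, 0 < h ∧ h ≤ κ ∧ (z = !₂[h, 0] ∨ z = !₂[0, h] ∨ z = !₂[h, h])

namespace IsPatternElement

variable {P : Pattern} {e : PatchElement}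

theorem nondegenerate (h : IsPatternElement κ L P e) (hκ : κ ∈ Ioc (0 : ℝ) (1 / 2)) :
    e.Nondegenerate := by
  obtain ⟨k0, k1⟩ := hκ
  have k2 : 0 < 1 - κ := by linarith
  cases h
  case cornerLayer h H h0 hH hκ hL hP he =>
    have h3 : 0 < H := h0.trans hH
    have h4 : 0 < H - h := sub_pos.2 hH
    rcases mem_cornerLayer.1 he with rfl | rfl | rfl | rfl <;>
      simp [PatchElement.Nondegenerate, triangle] <;> first
        | exact ⟨fun _ => by linarith, fun _ => by linarith⟩
        | exact fun _ => by nlinarith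
  all_goals simp [PatchElement.Nondegenerate, triangle, rectangle]
  all_goals first
    | exact ⟨by linarith, by linarith⟩
    | linarith

theorem vertices_mem_square (h : IsPatternElement κ L P e) (hκ : κ ∈ Ioc (0 : ℝ) (1 / 2)) :
    ∀ v ∈ e.shape.vertices, e.map v ∈ Shape.square.closedCell := by
  obtain ⟨k0, k1⟩ := hκ
  cases h
  case cornerLayer h H h0 hH hκ hL hP he =>
    rcases mem_cornerLayer.1 he with rfl | rfl | rfl | rfl <;>
      rw [forall_vertices_triangle] <;> simp [Shape.closedCell] <;>
      (repeat' constructor) <;> linarith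
  all_goals first
    | rw [forall_vertices_triangle]
    | rw [forall_vertices_rectangle]
  all_goals simp [Shape.closedCell]
  all_goals (repeat' constructor) <;> linarith

theorem map_mem_square (h : IsPatternElement κ L P e) (hκ : κ ∈ Ioc (0 : ℝ) (1 / 2)) {z : Plane}
    (hz : z ∈ e.shape.closedCell) : e.map z ∈ Shape.square.closedCell :=
  e.map_mem_of_vertices Shape.square.convex_closedCell (h.vertices_mem_square hκ) hz

theorem isNode (h : IsPatternElement κ L P e) : ∀ v ∈ e.shape.vertices, IsNode κ (e.map v) := by
  cases h
  case cornerLayer h H h0 hH hκ hL hP he =>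
    have h2 : h ≤ κ := hH.le.trans hκ
    have h3 : 0 < H := h0.trans hH
    have n1 : ∀ {t : ℝ}, 0 < t → t ≤ κ →
        IsNode κ !₂[t, 0] ∧ IsNode κ !₂[0, t] ∧ IsNode κ !₂[t, t] := fun ht ht' =>
      ⟨Or.inr ⟨_, ht, ht', Or.inl rfl⟩, Or.inr ⟨_, ht, ht', Or.inr (Or.inl rfl)⟩,
        Or.inr ⟨_, ht, ht', Or.inr (Or.inr rfl)⟩⟩
    obtain ⟨a1, a2, a3⟩ := n1 h0 h2
    obtain ⟨b1, b2, b3⟩ := n1 h3 hκ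
    rcases mem_cornerLayer.1 he with rfl | rfl | rfl | rfl <;>
      rw [forall_vertices_triangle] <;> simp only [*, and_self]
  case cornerSquare h h0 hκ hL hL' hP =>
    rw [forall_vertices_rectangle]
    exact ⟨Or.inl (by simp), Or.inr ⟨h, h0, hκ, Or.inl rfl⟩,
      Or.inr ⟨h, h0, hκ, Or.inr (Or.inr rfl)⟩, Or.inr ⟨h, h0, hκ, Or.inr (Or.inl rfl)⟩⟩
  all_goals first
    | rw [forall_vertices_triangle]
    | rw [forall_vertices_rectangle]
  all_goals simp [IsNode]

theorem isNode_of_large (h : IsPatternElement κ L P e) (hk : e.kind = .large) :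
    ∀ v ∈ e.shape.vertices, (e.map v 0 = 0 ∨ e.map v 0 = κ ∨ e.map v 0 = 1) ∧
      (e.map v 1 = 0 ∨ e.map v 1 = κ ∨ e.map v 1 = 1) := by
  cases h
  case cornerLayer h H h0 hH hκ hL hP he =>
    rcases mem_cornerLayer.1 he with rfl | rfl | rfl | rfl <;> cases hk
  all_goals first
    | (cases hk; done)
    | rw [forall_vertices_triangle (Φ := fun z : Plane => (z 0 = 0 ∨ z 0 = κ ∨ z 0 = 1) ∧
        (z 1 = 0 ∨ z 1 = κ ∨ z 1 = 1))]
    | rw [forall_vertices_rectangle (Φ := fun z : Plane => (z 0 = 0 ∨ z 0 = κ ∨ z 0 = 1) ∧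
        (z 1 = 0 ∨ z 1 = κ ∨ z 1 = 1))]
  all_goals simp

theorem convex_coord_le (i : Fin 2) (c : ℝ) : Convex ℝ {z : Plane | z i ≤ c} :=
  convex_halfSpace_le (EuclideanSpace.proj (𝕜 := ℝ) i).isLinear c

theorem convex_le_coord (i : Fin 2) (c : ℝ) : Convex ℝ {z : Plane | c ≤ z i} :=
  convex_halfSpace_ge (EuclideanSpace.proj (𝕜 := ℝ) i).isLinear c

/-- The elements that are not large lie in the strips of width `κ` at the two axes. -/
theorem le_or_le_of_not_large (h : IsPatternElement κ L P e) (k0 : 0 < κ) (hk : e.kind ≠ .large) {z : Plane}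
    (hz : z ∈ e.shape.closedCell) : e.map z 0 ≤ κ ∨ e.map z 1 ≤ κ := by
  suffices h : (∀ v ∈ e.shape.vertices, e.map v ∈ {z : Plane | z 0 ≤ κ}) ∨
      (∀ v ∈ e.shape.vertices, e.map v ∈ {z : Plane | z 1 ≤ κ}) by
    rcases h with h | h
    · exact Or.inl (e.map_mem_of_vertices (convex_coord_le 0 κ) h hz)
    · exact Or.inr (e.map_mem_of_vertices (convex_coord_le 1 κ) h hz)
  cases h
  case cornerLayer h H h0 hH hκ hL hP he =>
    left
    rcases mem_cornerLayer.1 he with rfl | rfl | rfl | rfl <;>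
      rw [forall_vertices_triangle] <;> simp <;> (repeat' constructor) <;> linarith
  case cornerSquare h h0 hκ hL hL' hP =>
    left; rw [forall_vertices_rectangle]; simp; (repeat' constructor) <;> linarith
  all_goals first
    | exact absurd rfl hk
    | (left; rw [forall_vertices_rectangle]; simp [k0.le]; done)
    | (left; rw [forall_vertices_triangle]; simp [k0.le]; done)
    | (right; rw [forall_vertices_rectangle]; simp [k0.le])
    | (right; rw [forall_vertices_triangle]; simp [k0.le])

theorem le_snd_of_large (h : IsPatternElement κ L P e) (hκ : κ ∈ Ioc (0 : ℝ) (1 / 2))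
    (hk : e.kind = .large) (hP : P = .boundaryLayer ∨ P = .mixed ∨ P = .tensorProduct) {z : Plane}
    (hz : z ∈ e.shape.closedCell) : κ ≤ e.map z 1 := by
  obtain ⟨k0, k1⟩ := hκ
  refine e.map_mem_of_vertices (convex_le_coord 1 κ) ?_ hz
  cases h
  case cornerLayer h H h0 hH hκ hL hP he =>
    rcases mem_cornerLayer.1 he with rfl | rfl | rfl | rfl <;> cases hk
  all_goals first
    | (exfalso; cases hk; done)
    | (exfalso; simp at hP; done)
    | (rw [forall_vertices_triangle]; simp; linarith)
    | (rw [forall_vertices_rectangle]; simp; linarith)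

theorem le_fst_of_large (h : IsPatternElement κ L P e) (hκ : κ ∈ Ioc (0 : ℝ) (1 / 2))
    (hk : e.kind = .large) (hP : P = .tensorProduct) {z : Plane}
    (hz : z ∈ e.shape.closedCell) : κ ≤ e.map z 0 := by
  obtain ⟨k0, k1⟩ := hκ
  refine e.map_mem_of_vertices (convex_le_coord 0 κ) ?_ hz
  cases h
  case cornerLayer h H h0 hH hκ hL hP he =>
    rcases mem_cornerLayer.1 he with rfl | rfl | rfl | rfl <;> cases hk
  all_goals first
    | (exfalso; cases hk; done)
    | (exfalso; simp at hP; done)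
    | (rw [forall_vertices_rectangle]; simp; linarith)

/-- The large elements meet the corner square only in its vertex opposite to the origin. -/
theorem eq_of_large_of_le (h : IsPatternElement κ L P e) (hκ : κ ∈ Ioc (0 : ℝ) (1 / 2))
    (hk : e.kind = .large) (hP : P = .tensorProduct ∨ P = .mixed ∨ P = .geometric) {z : Plane}
    (hz : z ∈ e.shape.closedCell) (h0 : e.map z 0 ≤ κ) (h1 : e.map z 1 ≤ κ) :
    e.map z 0 = κ ∧ e.map z 1 = κ := by
  obtain ⟨k0, k1⟩ := hκ
  have key : (κ ≤ e.map z 0 ∧ κ ≤ (1 - κ) * e.map z 1 + κ * e.map z 0) ∨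
      (κ ≤ e.map z 1 ∧ κ ≤ (1 - κ) * e.map z 0 + κ * e.map z 1) := by
    have c1 : Convex ℝ {z : Plane | κ ≤ (1 - κ) * z 1 + κ * z 0} :=
      convex_halfSpace_ge (((1 - κ) • EuclideanSpace.proj (𝕜 := ℝ) 1 +
        κ • EuclideanSpace.proj (𝕜 := ℝ) 0 : Plane →L[ℝ] ℝ)).isLinear κ
    have c2 : Convex ℝ {z : Plane | κ ≤ (1 - κ) * z 0 + κ * z 1} :=
      convex_halfSpace_ge (((1 - κ) • EuclideanSpace.proj (𝕜 := ℝ) 0 +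
        κ • EuclideanSpace.proj (𝕜 := ℝ) 1 : Plane →L[ℝ] ℝ)).isLinear κ
    suffices h : (∀ v ∈ e.shape.vertices,
        e.map v ∈ {z : Plane | κ ≤ z 0} ∩ {z : Plane | κ ≤ (1 - κ) * z 1 + κ * z 0}) ∨
        (∀ v ∈ e.shape.vertices,
        e.map v ∈ {z : Plane | κ ≤ z 1} ∩ {z : Plane | κ ≤ (1 - κ) * z 0 + κ * z 1}) by
      rcases h with h | h
      · exact Or.inl (e.map_mem_of_vertices ((convex_le_coord 0 κ).inter c1) h hz)
      · exact Or.inr (e.map_mem_of_vertices ((convex_le_coord 1 κ).inter c2) h hz)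
    cases h
    case cornerLayer h H h0 hH hκ hL hP he =>
      rcases mem_cornerLayer.1 he with rfl | rfl | rfl | rfl <;> cases hk
    case tensorL =>
      right; rw [forall_vertices_rectangle]; simp
      (repeat' constructor) <;> nlinarith
    case mixedL => right; rw [forall_vertices_triangle]; simp; (repeat' constructor) <;> nlinarith
    case mixedM => right; rw [forall_vertices_triangle]; simp; (repeat' constructor) <;> nlinarith
    case geometricL => left; rw [forall_vertices_triangle]; simp; (repeat' constructor) <;> nlinarith
    case geometricM => right; rw [forall_vertices_triangle]; simp; (repeat' constructor) <;> nlinarith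
    all_goals first
      | (cases hk; done)
      | (exfalso; simp at hP)
  rcases key with ⟨a1, a2⟩ | ⟨a1, a2⟩
  · have : e.map z 0 = κ := le_antisymm h0 a1
    rw [this] at a2
    exact ⟨this, le_antisymm h1 (by nlinarith)⟩
  · have : e.map z 1 = κ := le_antisymm h1 a1
    rw [this] at a2
    exact ⟨le_antisymm h0 (by nlinarith), this⟩

theorem half_le_dist {a b : Plane} (h : 1 / 2 ≤ |a 0 - b 0| ∨ 1 / 2 ≤ |a 1 - b 1|) :
    1 / 2 ≤ dist a b := by
  rw [dist_eq_norm]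
  rcases h with h | h
  · exact h.trans (PiLp.norm_apply_le (a - b) 0)
  · exact h.trans (PiLp.norm_apply_le (a - b) 1)

/-- The length of an edge excludes that a short edge of a corner refinement is also an edge of a
large element, possibly of another macro-element. -/
theorem half_le_dist_of_large (h : IsPatternElement κ L P e) (hκ : κ ∈ Ioc (0 : ℝ) (1 / 2))
    (hk : e.kind = .large) : ∀ d ∈ e.shape.edges, 1 / 2 ≤ dist (e.map d.1) (e.map d.2) := by
  obtain ⟨k0, k1⟩ := hκ
  have e1 : (1 : ℝ) / 2 ≤ |1 - κ| := (by linarith : (1 : ℝ) / 2 ≤ 1 - κ).trans (le_abs_self _)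
  have e2 : (1 : ℝ) / 2 ≤ |κ - 1| := by rwa [abs_sub_comm]
  have e4 : (2 : ℝ)⁻¹ ≤ |κ - 1| := by rwa [← one_div]
  suffices h : ∀ d ∈ e.shape.edges, 1 / 2 ≤ |e.map d.1 0 - e.map d.2 0| ∨
      1 / 2 ≤ |e.map d.1 1 - e.map d.2 1| from fun d hd => half_le_dist (h d hd)
  cases h
  case cornerLayer h H h0 hH hκ hL hP he =>
    rcases mem_cornerLayer.1 he with rfl | rfl | rfl | rfl <;> cases hk
  all_goals first
    | (exfalso; cases hk; done)
    | rw [forall_edges_triangle (Φ := fun a b : Plane => 1 / 2 ≤ |a 0 - b 0| ∨ 1 / 2 ≤ |a 1 - b 1|)]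
    | rw [forall_edges_rectangle (Φ := fun a b : Plane => 1 / 2 ≤ |a 0 - b 0| ∨ 1 / 2 ≤ |a 1 - b 1|)]
  all_goals simp [e4]
  all_goals norm_num

end IsPatternElement
end HpFEM

namespace HpFEM

variable {σ κ : ℝ} {L : ℕ} {P : Pattern} {e : PatchElement}

namespace IsPatternElement

/-- An edge of the corner refinement is short, or its midpoint lies inside the square and in the
corner square, but is not the vertex `(κ, κ)`. -/
theorem edge_of_corner (h : IsPatternElement κ L P e) (hκ : κ ∈ Ioc (0 : ℝ) (1 / 2)) (hL : L ≠ 0)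
    (hk : e.kind = .corner) : ∀ d ∈ e.shape.edges, dist (e.map d.1) (e.map d.2) < 1 / 2 ∨
      ((0 < e.map d.1 0 + e.map d.2 0 ∧ 0 < e.map d.1 1 + e.map d.2 1) ∧
      (e.map d.1 0 + e.map d.2 0 ≤ 2 * κ ∧ e.map d.1 1 + e.map d.2 1 ≤ 2 * κ) ∧
      (e.map d.1 0 + e.map d.2 0 < 2 * κ ∨ e.map d.1 1 + e.map d.2 1 < 2 * κ)) := by
  obtain ⟨k0, k1⟩ := hκ
  have hd : ∀ {a b : Plane} {x : ℝ}, 0 < x → x < 1 / 2 →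
      ((a 0 = b 0 ∧ b 1 - a 1 = x) ∨ (a 1 = b 1 ∧ b 0 - a 0 = x)) → dist a b < 1 / 2 := by
    intro a b x hx hx' h
    rw [EuclideanSpace.dist_eq, Fin.sum_univ_two, Real.dist_eq, Real.dist_eq, sq_abs, sq_abs]
    have : (a 0 - b 0) ^ 2 + (a 1 - b 1) ^ 2 = x ^ 2 := by
      rcases h with ⟨h1, h2⟩ | ⟨h1, h2⟩ <;> rw [h1, ← h2] <;> ring
    rwa [this, Real.sqrt_sq hx.le]
  cases h
  case cornerLayer h H h0 hH hκ _ hP he =>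
    rcases mem_cornerLayer.1 he with rfl | rfl | rfl | rfl
    · rw [forall_edges_triangle (Φ := fun a b : Plane => dist a b < 1 / 2 ∨
        ((0 < a 0 + b 0 ∧ 0 < a 1 + b 1) ∧ (a 0 + b 0 ≤ 2 * κ ∧ a 1 + b 1 ≤ 2 * κ) ∧
        (a 0 + b 0 < 2 * κ ∨ a 1 + b 1 < 2 * κ)))]
      refine ⟨Or.inl (hd (x := H - h) (by linarith) (by linarith) (by simp)), Or.inr ?_,
        Or.inl (hd (x := h) (by linarith) (by linarith) (by simp))⟩
      simp; (repeat' constructor) <;> linarith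
    · rw [forall_edges_triangle (Φ := fun a b : Plane => dist a b < 1 / 2 ∨
        ((0 < a 0 + b 0 ∧ 0 < a 1 + b 1) ∧ (a 0 + b 0 ≤ 2 * κ ∧ a 1 + b 1 ≤ 2 * κ) ∧
        (a 0 + b 0 < 2 * κ ∨ a 1 + b 1 < 2 * κ)))]
      refine ⟨Or.inr ?_, Or.inr ?_, Or.inr ?_⟩ <;> simp
      · exact ⟨⟨by linarith, by linarith⟩, ⟨by linarith, by linarith⟩, Or.inr (by linarith)⟩
      · refine ⟨?_, ?_, ?_⟩ <;> first | linarith | (constructor <;> linarith) | (right; linarith)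
      · (repeat' constructor) <;> linarith
    · rw [forall_edges_triangle (Φ := fun a b : Plane => dist a b < 1 / 2 ∨
        ((0 < a 0 + b 0 ∧ 0 < a 1 + b 1) ∧ (a 0 + b 0 ≤ 2 * κ ∧ a 1 + b 1 ≤ 2 * κ) ∧
        (a 0 + b 0 < 2 * κ ∨ a 1 + b 1 < 2 * κ)))]
      refine ⟨Or.inr ?_, Or.inr ?_, Or.inr ?_⟩ <;> simp
      · (repeat' constructor) <;> linarith
      · refine ⟨?_, ?_, ?_⟩ <;> first | linarith | (constructor <;> linarith)
      · exact ⟨⟨by linarith, by linarith⟩, ⟨by linarith, by linarith⟩, Or.inl (by linarith)⟩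
    · rw [forall_edges_triangle (Φ := fun a b : Plane => dist a b < 1 / 2 ∨
        ((0 < a 0 + b 0 ∧ 0 < a 1 + b 1) ∧ (a 0 + b 0 ≤ 2 * κ ∧ a 1 + b 1 ≤ 2 * κ) ∧
        (a 0 + b 0 < 2 * κ ∨ a 1 + b 1 < 2 * κ)))]
      refine ⟨Or.inl (hd (x := h) (by linarith) (by linarith) (by simp)), Or.inr ?_,
        Or.inl (hd (x := H - h) (by linarith) (by linarith) (by simp))⟩
      simp; refine ⟨⟨?_, ?_⟩, ⟨?_, ?_⟩, Or.inl ?_⟩ <;> linarith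
  case cornerSquare h h0 hκ _ hL' hP =>
    have h2 := hL' hL
    have e : ∀ {a b : Plane}, ((a 0 = b 0 ∧ b 1 - a 1 = h) ∨ (a 1 = b 1 ∧ b 0 - a 0 = h)) →
      dist a b < 1 / 2 := fun hab => hd h0 (by linarith) hab
    intro d hd
    left
    revert d
    rw [forall_edges_rectangle (Φ := fun a b : Plane => dist a b < 1 / 2)]
    refine ⟨e ?_, e ?_, e ?_, e ?_⟩ <;> simp
  all_goals cases hk

/-- An element that is not large either has two sides parallel to the axes of length at least `κ`,
or belongs to a corner refinement with at least one layer; in the latter case it is the innermost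
square, or a triangle in the corner square on one side of the diagonal. -/
theorem diagonal_or_corner (h : IsPatternElement κ L P e) (hκ : κ ∈ Ioc (0 : ℝ) (1 / 2))
    (hk : e.kind ≠ .large) :
    (∃ a b, κ ≤ a ∧ κ ≤ b ∧ e.dirX = !₂[a, 0] ∧ e.dirY = !₂[0, b]) ∨
    (L ≠ 0 ∧ e.kind = .corner ∧ ((∃ h, 0 < h ∧ h < κ ∧ e = rectangle .corner 0 h 0 h) ∨
      (e.shape = .triangle ∧ (∀ v ∈ e.shape.vertices, e.map v 0 ≤ κ ∧ e.map v 1 ≤ κ) ∧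
      ((∀ v ∈ e.shape.vertices, e.map v 1 ≤ e.map v 0) ∨
        (∀ v ∈ e.shape.vertices, e.map v 0 ≤ e.map v 1))))) := by
  obtain ⟨k0, k1⟩ := hκ
  cases h
  case cornerLayer h H h0 hH hκ hL hP he =>
    right
    refine ⟨hL, ?_, Or.inr ⟨?_, ?_, ?_⟩⟩
    · rcases mem_cornerLayer.1 he with rfl | rfl | rfl | rfl <;> rfl
    · rcases mem_cornerLayer.1 he with rfl | rfl | rfl | rfl <;> rfl
    · rcases mem_cornerLayer.1 he with rfl | rfl | rfl | rfl <;>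
        rw [forall_vertices_triangle (Φ := fun z : Plane => z 0 ≤ κ ∧ z 1 ≤ κ)] <;> simp <;>
        (repeat' constructor) <;> linarith
    · rcases mem_cornerLayer.1 he with rfl | rfl | rfl | rfl
      · left; rw [forall_vertices_triangle (Φ := fun z : Plane => z 1 ≤ z 0)]; simp
        (repeat' constructor) <;> linarith
      · left; rw [forall_vertices_triangle (Φ := fun z : Plane => z 1 ≤ z 0)]; simp; linarith
      · right; rw [forall_vertices_triangle (Φ := fun z : Plane => z 0 ≤ z 1)]; simp; linarith
      · right; rw [forall_vertices_triangle (Φ := fun z : Plane => z 0 ≤ z 1)]; simp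
        (repeat' constructor) <;> linarith
  case cornerSquare h h0 hκ hL hL' hP =>
    rcases eq_or_ne L 0 with h1 | h1
    · left; exact ⟨h, h, (hL h1).ge, (hL h1).ge, by simp [rectangle], by simp [rectangle]⟩
    · right; exact ⟨h1, rfl, Or.inl ⟨h, h0, hL' h1, rfl⟩⟩
  case layerA => exact Or.inl ⟨1, κ, by linarith, le_rfl, by simp [rectangle], by simp [rectangle]⟩
  case tensorA =>
    exact Or.inl ⟨1 - κ, κ, by linarith, le_rfl, by simp [rectangle], by simp [rectangle]⟩
  case mixedA =>
    exact Or.inl ⟨1 - κ, κ, by linarith, le_rfl, by simp [rectangle], by simp [rectangle]⟩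
  case tensorB =>
    exact Or.inl ⟨κ, 1 - κ, le_rfl, by linarith, by simp [rectangle], by simp [rectangle]⟩
  case mixedB =>
    refine Or.inl ⟨κ, 1 - κ, le_rfl, by linarith, ?_, ?_⟩ <;> apply plane_ext <;> simp [triangle]
  case geometricB =>
    refine Or.inl ⟨κ, 1 - κ, le_rfl, by linarith, ?_, ?_⟩ <;> apply plane_ext <;> simp [triangle]
  case geometricA =>
    refine Or.inl ⟨1 - κ, κ, by linarith, le_rfl, ?_, ?_⟩ <;> apply plane_ext <;> simp [triangle]
  all_goals exact absurd rfl hk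

theorem corner_pattern (h : IsPatternElement κ L P e) (hk : e.kind = .corner) :
    P = .tensorProduct ∨ P = .mixed ∨ P = .geometric := by
  cases h
  case cornerLayer h H h0 hH hκ hL hP he => exact hP
  case cornerSquare h h0 hκ hL hL' hP => exact hP
  all_goals cases hk

end IsPatternElement

/-! ### The refinement patterns cover the reference square -/

theorem exists_rectangle_map {k : ElementKind} {x₀ x₁ y₀ y₁ : ℝ} {z : Plane} (hx : x₀ < x₁)
    (hy : y₀ < y₁) (h0 : z 0 ∈ Icc x₀ x₁) (h1 : z 1 ∈ Icc y₀ y₁) :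
    ∃ w ∈ (rectangle k x₀ x₁ y₀ y₁).shape.closedCell, (rectangle k x₀ x₁ y₀ y₁).map w = z := by
  have hx' : 0 < x₁ - x₀ := sub_pos.2 hx
  have hy' : 0 < y₁ - y₀ := sub_pos.2 hy
  refine ⟨!₂[(z 0 - x₀) / (x₁ - x₀), (z 1 - y₀) / (y₁ - y₀)], ?_, ?_⟩
  · simp only [rectangle, Shape.closedCell, mem_ofPred_eq]
    simp only [Matrix.cons_val_zero, Matrix.cons_val_one]
    exact ⟨div_nonneg (by linarith [h0.1]) hx'.le, div_le_one_of_le₀ (by linarith [h0.2]) hx'.le,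
      div_nonneg (by linarith [h1.1]) hy'.le, div_le_one_of_le₀ (by linarith [h1.2]) hy'.le⟩
  · apply plane_ext <;> simp [PatchElement.map_apply, rectangle] <;> field_simp <;> ring

theorem exists_triangle_map {k : ElementKind} {A B C z : Plane} (s t : ℝ) (hs : 0 ≤ s) (ht : 0 ≤ t)
    (hst : s + t ≤ 1) (h0 : z 0 = A 0 + s * (B 0 - A 0) + t * (C 0 - A 0))
    (h1 : z 1 = A 1 + s * (B 1 - A 1) + t * (C 1 - A 1)) :
    ∃ w ∈ (triangle k A B C).shape.closedCell, (triangle k A B C).map w = z := by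
  refine ⟨!₂[s, t], ?_, ?_⟩
  · simp only [triangle, Shape.closedCell, mem_ofPred_eq]
    simp only [Matrix.cons_val_zero, Matrix.cons_val_one]
    exact ⟨hs, by linarith, ht, by linarith⟩
  · apply plane_ext <;> simp [PatchElement.map_apply, triangle, h0, h1]

section Layer

variable {h H : ℝ} {z : Plane} {k k' : ElementKind}

/-- The lower half of a layer `[0, H]² ∖ [0, h)²` is covered by two triangles. -/
theorem exists_layer_lower (h0 : 0 < h) (hH : h < H) (z1 : 0 ≤ z 1) (z0 : z 0 ∈ Icc h H)
    (hz : z 1 ≤ z 0) :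
    (∃ w ∈ (triangle k !₂[h, 0] !₂[H, 0] !₂[h, h]).shape.closedCell,
      (triangle k !₂[h, 0] !₂[H, 0] !₂[h, h]).map w = z) ∨
    (∃ w ∈ (triangle k' !₂[h, h] !₂[H, 0] !₂[H, H]).shape.closedCell,
      (triangle k' !₂[h, h] !₂[H, 0] !₂[H, H]).map w = z) := by
  have hH' : 0 < H - h := sub_pos.2 hH
  have hH0 : 0 < H := h0.trans hH
  have a1 : 0 ≤ (z 0 - h) / (H - h) := div_nonneg (by linarith [z0.1]) hH'.le
  have a2 : 0 ≤ z 1 / h := div_nonneg z1 h0.le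
  have a3 : 0 ≤ (z 0 - z 1) / H := div_nonneg (by linarith) hH0.le
  have a4 : (z 0 - h) / (H - h) ≤ 1 := div_le_one_of_le₀ (by linarith [z0.2]) hH'.le
  rcases le_total ((z 0 - h) / (H - h) + z 1 / h) 1 with hst | hst
  · left
    refine exists_triangle_map ((z 0 - h) / (H - h)) (z 1 / h) a1 a2 hst ?_ ?_ <;>
      simp <;> field_simp <;> ring
  · right
    refine exists_triangle_map ((z 0 - z 1) / H) ((z 0 - h) / (H - h) - (z 0 - z 1) / H) a3 ?_
      (by linarith) ?_ ?_
    · have : 0 ≤ (z 0 - h) * h + z 1 * (H - h) - h * (H - h) := by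
        rw [div_add_div _ _ hH'.ne' h0.ne', le_div_iff₀ (by positivity)] at hst
        linarith
      rw [div_sub_div _ _ hH'.ne' hH0.ne']
      refine div_nonneg ?_ (by positivity)
      nlinarith
    · simp; field_simp; ring
    · simp; field_simp; ring

theorem exists_layer_upper (h0 : 0 < h) (hH : h < H) (z0 : 0 ≤ z 0) (z1 : z 1 ∈ Icc h H)
    (hz : z 0 ≤ z 1) :
    (∃ w ∈ (triangle k !₂[h, h] !₂[H, H] !₂[0, H]).shape.closedCell,
      (triangle k !₂[h, h] !₂[H, H] !₂[0, H]).map w = z) ∨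
    (∃ w ∈ (triangle k' !₂[0, h] !₂[h, h] !₂[0, H]).shape.closedCell,
      (triangle k' !₂[0, h] !₂[h, h] !₂[0, H]).map w = z) := by
  have hH' : 0 < H - h := sub_pos.2 hH
  have hH0 : 0 < H := h0.trans hH
  have a1 : 0 ≤ (z 1 - h) / (H - h) := div_nonneg (by linarith [z1.1]) hH'.le
  have a2 : 0 ≤ z 0 / h := div_nonneg z0 h0.le
  have a3 : 0 ≤ (z 1 - z 0) / H := div_nonneg (by linarith) hH0.le
  have a4 : (z 1 - h) / (H - h) ≤ 1 := div_le_one_of_le₀ (by linarith [z1.2]) hH'.le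
  rcases le_total (z 0 / h + (z 1 - h) / (H - h)) 1 with hst | hst
  · right
    refine exists_triangle_map (z 0 / h) ((z 1 - h) / (H - h)) a2 a1 hst ?_ ?_ <;>
      simp <;> field_simp <;> ring
  · left
    refine exists_triangle_map ((z 1 - h) / (H - h) - (z 1 - z 0) / H) ((z 1 - z 0) / H) ?_ a3
      (by linarith) ?_ ?_
    · have : 0 ≤ (z 1 - h) * h + z 0 * (H - h) - h * (H - h) := by
        rw [div_add_div _ _ h0.ne' hH'.ne', le_div_iff₀ (by positivity)] at hst
        linarith
      rw [div_sub_div _ _ hH'.ne' hH0.ne']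
      refine div_nonneg ?_ (by positivity)
      nlinarith
    · simp; field_simp; ring
    · simp; field_simp; ring

end Layer

/-- A size in `[κ σ^L, κ]` lies between two consecutive layers. -/
theorem exists_layer {x : ℝ} (h1 : κ * σ ^ L ≤ x) (h2 : x ≤ κ) :
    x = κ * σ ^ L ∨ ∃ l < L, x ∈ Icc (κ * σ ^ (l + 1)) (κ * σ ^ l) := by
  induction L with
  | zero => left; simp at h1 ⊢; linarith
  | succ L ih =>
    rcases le_total (κ * σ ^ L) x with h3 | h3
    · rcases ih h3 with h4 | ⟨l, hl, h4⟩
      · exact Or.inr ⟨L, Nat.lt_succ_self L, h1, h4.le⟩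
      · exact Or.inr ⟨l, hl.trans (Nat.lt_succ_self L), h4⟩
    · exact Or.inr ⟨L, Nat.lt_succ_self L, h1, h3⟩

theorem exists_cornerMesh_map (hσ : σ ∈ Ioo (0 : ℝ) 1) (hκ : 0 < κ) {z : Plane}
    (h0 : z 0 ∈ Icc 0 κ) (h1 : z 1 ∈ Icc 0 κ) :
    ∃ e ∈ cornerMesh σ κ L, ∃ w ∈ e.shape.closedCell, e.map w = z := by
  have hs : ∀ l, κ * σ ^ (l + 1) < κ * σ ^ l := fun l => (layer_size_lt hσ hκ l).2.1
  have hp : ∀ l, 0 < κ * σ ^ l := fun l => (layer_size_lt hσ hκ l).1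
  rcases le_total (max (z 0) (z 1)) (κ * σ ^ L) with hm | hm
  · obtain ⟨w, hw, hwz⟩ := exists_rectangle_map (k := .corner) (hp L) (hp L)
      ⟨h0.1, (le_max_left _ _).trans hm⟩ ⟨h1.1, (le_max_right _ _).trans hm⟩
    exact ⟨_, List.mem_cons_self, w, hw, hwz⟩
  · rcases exists_layer hm (max_le h0.2 h1.2) with h3 | ⟨l, hl, h3⟩
    · obtain ⟨w, hw, hwz⟩ := exists_rectangle_map (k := .corner) (hp L) (hp L)
        ⟨h0.1, (le_max_left _ _).trans h3.le⟩ ⟨h1.1, (le_max_right _ _).trans h3.le⟩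
      exact ⟨_, List.mem_cons_self, w, hw, hwz⟩
    · have hmem : ∀ e ∈ cornerLayer (κ * σ ^ (l + 1)) (κ * σ ^ l), e ∈ cornerMesh σ κ L :=
        fun e he => List.mem_cons_of_mem _ (List.mem_flatMap.2 ⟨l, List.mem_range.2 hl, he⟩)
      rcases le_total (z 1) (z 0) with h4 | h4
      · rw [max_eq_left h4] at h3
        rcases exists_layer_lower (k := .corner) (k' := .corner) (hp (l + 1)) (hs l) h1.1 h3 h4 with
          ⟨w, hw, hwz⟩ | ⟨w, hw, hwz⟩
        · exact ⟨_, hmem _ (mem_cornerLayer.2 (Or.inl rfl)), w, hw, hwz⟩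
        · exact ⟨_, hmem _ (mem_cornerLayer.2 (Or.inr (Or.inl rfl))), w, hw, hwz⟩
      · rw [max_eq_right h4] at h3
        rcases exists_layer_upper (k := .corner) (k' := .corner) (hp (l + 1)) (hs l) h0.1 h3 h4 with
          ⟨w, hw, hwz⟩ | ⟨w, hw, hwz⟩
        · exact ⟨_, hmem _ (mem_cornerLayer.2 (Or.inr (Or.inr (Or.inl rfl)))), w, hw, hwz⟩
        · exact ⟨_, hmem _ (mem_cornerLayer.2 (Or.inr (Or.inr (Or.inr rfl)))), w, hw, hwz⟩

theorem exists_element_map (hσ : σ ∈ Ioo (0 : ℝ) 1) (hκ : κ ∈ Ioc (0 : ℝ) (1 / 2)) (P : Pattern)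
    {z : Plane} (hz : z ∈ Shape.square.closedCell) :
    ∃ e ∈ P.elements σ κ L, ∃ w ∈ e.shape.closedCell, e.map w = z := by
  obtain ⟨k0, k1⟩ := hκ
  obtain ⟨h1, h2, h3, h4⟩ := hz
  have hk1 : κ < 1 := by linarith
  have hz1 : (0 : ℝ) < 1 := one_pos
  have hcorner : z 0 ≤ κ → z 1 ≤ κ →
      ∃ e ∈ cornerMesh σ κ L, ∃ w ∈ e.shape.closedCell, e.map w = z := fun a b =>
    exists_cornerMesh_map hσ k0 ⟨h1, a⟩ ⟨h3, b⟩
  have pack : ∀ {e : PatchElement}, (∃ w ∈ e.shape.closedCell, e.map w = z) →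
      e ∈ P.elements σ κ L → ∃ e ∈ P.elements σ κ L, ∃ w ∈ e.shape.closedCell, e.map w = z :=
    fun h he => ⟨_, he, h⟩
  cases P with
  | trivial =>
    exact pack (exists_rectangle_map (k := .large) hz1 hz1 ⟨h1, h2⟩ ⟨h3, h4⟩)
      (by simp [Pattern.elements])
  | boundaryLayer =>
    rcases le_total (z 1) κ with a | a
    · exact pack (exists_rectangle_map (k := .aniso) hz1 k0 ⟨h1, h2⟩ ⟨h3, a⟩)
        (by simp [Pattern.elements])
    · exact pack (exists_rectangle_map (k := .large) hz1 hk1 ⟨h1, h2⟩ ⟨a, h4⟩)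
        (by simp [Pattern.elements])
  | tensorProduct =>
    rcases le_total (z 0) κ with a | a <;> rcases le_total (z 1) κ with b | b
    · obtain ⟨e, he, h⟩ := hcorner a b
      exact pack h (by simp [Pattern.elements, he])
    · exact pack (exists_rectangle_map (k := .aniso) k0 hk1 ⟨h1, a⟩ ⟨b, h4⟩)
        (by simp [Pattern.elements])
    · exact pack (exists_rectangle_map (k := .aniso) hk1 k0 ⟨a, h2⟩ ⟨h3, b⟩)
        (by simp [Pattern.elements])
    · exact pack (exists_rectangle_map (k := .large) hk1 hk1 ⟨a, h2⟩ ⟨b, h4⟩)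
        (by simp [Pattern.elements])
  | mixed =>
    rcases le_total (z 0) (z 1) with c | c
    · rcases le_total (z 1) κ with b | b
      · obtain ⟨e, he, h⟩ := hcorner (c.trans b) b
        exact pack h (by simp [Pattern.elements, he])
      · rcases exists_layer_upper (k := .large) (k' := .aniso) k0 hk1 h1 ⟨b, h4⟩ c with h | h
        · exact pack h (by simp [Pattern.elements])
        · exact pack h (by simp [Pattern.elements])
    · rcases le_total (z 0) κ with a | a
      · obtain ⟨e, he, h⟩ := hcorner a (c.trans a)
        exact pack h (by simp [Pattern.elements, he])
      · rcases le_total (z 1) κ with b | b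
        · exact pack (exists_rectangle_map (k := .aniso) hk1 k0 ⟨a, h2⟩ ⟨h3, b⟩)
            (by simp [Pattern.elements])
        · have hk' : 0 < 1 - κ := sub_pos.2 hk1
          refine pack (exists_triangle_map (k := .large) (A := !₂[κ, κ]) (B := !₂[1, κ])
            (C := !₂[1, 1]) ((z 0 - z 1) / (1 - κ)) ((z 1 - κ) / (1 - κ))
            (div_nonneg (by linarith) hk'.le) (div_nonneg (by linarith) hk'.le) ?_ ?_ ?_)
            (by simp [Pattern.elements])
          · rw [← add_div]; exact div_le_one_of_le₀ (by linarith) hk'.le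
          · simp; field_simp; ring
          · simp; field_simp; ring
  | geometric =>
    rcases le_total (z 0) (z 1) with c | c
    · rcases le_total (z 1) κ with b | b
      · obtain ⟨e, he, h⟩ := hcorner (c.trans b) b
        exact pack h (by simp [Pattern.elements, he])
      · rcases exists_layer_upper (k := .large) (k' := .aniso) k0 hk1 h1 ⟨b, h4⟩ c with h | h
        · exact pack h (by simp [Pattern.elements])
        · exact pack h (by simp [Pattern.elements])
    · rcases le_total (z 0) κ with a | a
      · obtain ⟨e, he, h⟩ := hcorner a (c.trans a)
        exact pack h (by simp [Pattern.elements, he])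
      · rcases exists_layer_lower (k := .aniso) (k' := .large) k0 hk1 h3 ⟨a, h2⟩ c with h | h
        · exact pack h (by simp [Pattern.elements])
        · exact pack h (by simp [Pattern.elements])

end HpFEM

namespace HpFEM

/-! ### Geometry of the mesh -/

theorem lineMap_of_image_segment_eq {V X : Type*} [NormedAddCommGroup V] [NormedSpace ℝ V]
    {p : V → X} {S : Set V} (hS : Convex ℝ S) (hp : InjOn p S) {a b a' b' : V} (ha : a ∈ S)
    (hb : b ∈ S) (ha' : a' ∈ S) (hb' : b' ∈ S) (hab : a ≠ b)
    (h : p '' segment ℝ a b = p '' segment ℝ a' b') :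
    (∀ t : ℝ, AffineMap.lineMap a b t = (AffineMap.lineMap a' b' t : V)) ∨
      (∀ t : ℝ, AffineMap.lineMap a b t = (AffineMap.lineMap a' b' (1 - t) : V)) := by
  have hs := (hp.image_eq_image_iff (hS.segment_subset ha hb) (hS.segment_subset ha' hb')).1 h
  rcases lineMap_eq_of_segment_eq hab hs with ⟨rfl, rfl⟩ | ⟨rfl, rfl⟩
  · exact Or.inl fun t => rfl
  · exact Or.inr fun t => (AffineMap.lineMap_apply_one_sub _ _ _).symm

/-- The linear part of an element map. -/
def PatchElement.linear (e : PatchElement) : Plane →L[ℝ] Plane :=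
  (EuclideanSpace.proj (𝕜 := ℝ) (0 : Fin 2)).smulRight e.dirX +
    (EuclideanSpace.proj (𝕜 := ℝ) (1 : Fin 2)).smulRight e.dirY

theorem PatchElement.linear_apply (e : PatchElement) (w : Plane) :
    e.linear w = w 0 • e.dirX + w 1 • e.dirY := rfl

theorem PatchElement.map_eq (e : PatchElement) (w : Plane) : e.map w = e.origin + e.linear w := by
  rw [PatchElement.map, linear_apply, add_assoc]

theorem PatchElement.hasStrictFDerivAt_map (e : PatchElement) (w : Plane) :
    HasStrictFDerivAt e.map e.linear w := by
  have : e.map = fun w => e.origin + e.linear w := funext e.map_eq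
  rw [this]
  exact e.linear.hasStrictFDerivAt.const_add _

theorem PatchElement.Nondegenerate.linear_injective {e : PatchElement} (h : e.Nondegenerate) :
    Function.Injective e.linear := fun a b hab =>
  h.injective (by rw [e.map_eq, e.map_eq, hab])

variable {Ω : Set Plane} {n : ℕ} {T : MacroTriangulation Ω n} {σ κ : ℝ} {L : Fin n → ℕ}

theorem MacroTriangulation.fderiv_injective (T : MacroTriangulation Ω n) (i : Fin n) {z : Plane}
    (hz : z ∈ Shape.square.closedCell) : Function.Injective (fderiv ℝ (T.F i) z) := by
  have := (ContinuousLinearMap.toContinuousLinearEquivOfDetNeZero _ (T.det_ne_zero i z hz)).injective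
  exact this

theorem dist_of_mem_square_edges {E : Plane × Plane} (hE : E ∈ Shape.square.edges) :
    dist E.1 E.2 = 1 := by
  simp only [Shape.edges, List.mem_cons, List.not_mem_nil, or_false] at hE
  rcases hE with rfl | rfl | rfl | rfl <;> simp [EuclideanSpace.dist_eq, Real.dist_eq]

namespace SpectralBoundaryLayerMesh

variable (M : SpectralBoundaryLayerMesh T σ κ L)

theorem isPatternElement (hσ : σ ∈ Ioo (0 : ℝ) 1) (hκ : κ ∈ Ioc (0 : ℝ) (1 / 2))
    {K : Fin n × PatchElement} (hK : K ∈ M.elements) :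
    IsPatternElement κ (L K.1) (M.pattern K.1) K.2 := isPatternElement_of_mem hσ hκ.1 hK

theorem finite_elements : M.elements.Finite := by
  have : M.elements = ⋃ i, (fun e => (i, e)) '' {e | e ∈ (M.pattern i).elements σ κ (L i)} := by
    ext ⟨i, e⟩
    simp [elements, meshElements]
  rw [this]
  exact finite_iUnion fun i => ((List.finite_toSet _).image _)

variable {M} (hσ : σ ∈ Ioo (0 : ℝ) 1) (hκ : κ ∈ Ioc (0 : ℝ) (1 / 2))
  {K K' : Fin n × PatchElement}

include hσ hκ

theorem map_mem_square (hK : K ∈ M.elements) {w : Plane} (hw : w ∈ K.2.shape.closedCell) :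
    K.2.map w ∈ Shape.square.closedCell := (M.isPatternElement hσ hκ hK).map_mem_square hκ hw

theorem injOn_elementMap (hK : K ∈ M.elements) :
    InjOn (T.elementMap K) K.2.shape.closedCell := by
  intro a ha b hb hab
  exact ((M.isPatternElement hσ hκ hK).nondegenerate hκ).injective
    (T.injOn K.1 (map_mem_square hσ hκ hK ha) (map_mem_square hσ hκ hK hb) hab)

theorem hasStrictFDerivAt_elementMap (hK : K ∈ M.elements) {w : Plane}
    (hw : w ∈ K.2.shape.closedCell) :
    HasStrictFDerivAt (T.elementMap K) ((fderiv ℝ (T.F K.1) (K.2.map w)).comp K.2.linear) w :=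
  ((T.analytic K.1 _ (map_mem_square hσ hκ hK hw)).hasStrictFDerivAt).comp w
    (K.2.hasStrictFDerivAt_map w)

theorem continuousOn_elementMap (hK : K ∈ M.elements) :
    ContinuousOn (T.elementMap K) K.2.shape.closedCell := fun _ hw =>
  (hasStrictFDerivAt_elementMap hσ hκ hK hw).hasFDerivAt.continuousAt.continuousWithinAt

theorem derivative_injective (hK : K ∈ M.elements) {w : Plane} (hw : w ∈ K.2.shape.closedCell) :
    Function.Injective ((fderiv ℝ (T.F K.1) (K.2.map w)).comp K.2.linear) :=
  (T.fderiv_injective K.1 (map_mem_square hσ hκ hK hw)).comp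
    ((M.isPatternElement hσ hκ hK).nondegenerate hκ).linear_injective

theorem map_nhds_elementMap (hK : K ∈ M.elements) {w : Plane} (hw : w ∈ K.2.shape.closedCell) :
    Filter.map (T.elementMap K) (𝓝 w) = 𝓝 (T.elementMap K w) := by
  refine (hasStrictFDerivAt_elementMap hσ hκ hK hw).map_nhds_eq_of_surj ?_
  rw [LinearMap.range_eq_top]
  exact LinearMap.injective_iff_surjective.1 (derivative_injective hσ hκ hK hw)

theorem isOpen_image_cell (hK : K ∈ M.elements) : IsOpen (T.elementMap K '' K.2.shape.cell) := by
  rw [isOpen_iff_mem_nhds]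
  rintro _ ⟨w, hw, rfl⟩
  rw [← map_nhds_elementMap hσ hκ hK (K.2.shape.cell_subset_closedCell hw)]
  exact image_mem_map (K.2.shape.isOpen_cell.mem_nhds hw)

theorem isCompact_image_closedCell (hK : K ∈ M.elements) :
    IsCompact (T.elementMap K '' K.2.shape.closedCell) :=
  K.2.shape.isCompact_closedCell.image_of_continuousOn (continuousOn_elementMap hσ hκ hK)

theorem image_closedCell_subset_closure (hK : K ∈ M.elements) :
    T.elementMap K '' K.2.shape.closedCell ⊆ closure (T.elementMap K '' K.2.shape.cell) := by
  rintro _ ⟨w, hw, rfl⟩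
  exact ((continuousOn_elementMap hσ hκ hK w hw).mono
    K.2.shape.cell_subset_closedCell).mem_closure_image (K.2.shape.closedCell_subset_closure hw)

theorem elementMap_mem_closure (hK : K ∈ M.elements) {w : Plane} (hw : w ∈ K.2.shape.closedCell) :
    T.elementMap K w ∈ closure Ω := by
  rw [← T.cover]
  exact mem_iUnion.2 ⟨K.1, mem_image_of_mem _ (map_mem_square hσ hκ hK hw)⟩

theorem exists_element {x : Plane} (hx : x ∈ closure Ω) :
    ∃ K ∈ M.elements, ∃ w ∈ K.2.shape.closedCell, T.elementMap K w = x := by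
  rw [← T.cover] at hx
  obtain ⟨i, z, hz, rfl⟩ := mem_iUnion.1 hx
  obtain ⟨e, he, w, hw, hwz⟩ := exists_element_map (L := L i) hσ hκ (M.pattern i) hz
  exact ⟨(i, e), he, w, hw, by simp [MacroTriangulation.elementMap, hwz]⟩

/-- Two elements with a common point share it as a vertex, or share an edge that contains it. -/
theorem meet (hK : K ∈ M.elements) (hK' : K' ∈ M.elements) (hne : K ≠ K') {w w' : Plane}
    (hw : w ∈ K.2.shape.closedCell) (hw' : w' ∈ K'.2.shape.closedCell)
    (h : T.elementMap K w = T.elementMap K' w') :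
    (w ∈ K.2.shape.vertices ∧ w' ∈ K'.2.shape.vertices) ∨
    ∃ e ∈ K.2.shape.edges, ∃ e' ∈ K'.2.shape.edges, w ∈ edgeSet e ∧ w' ∈ edgeSet e' ∧
      T.elementMap K '' edgeSet e = T.elementMap K' '' edgeSet e' := by
  have hx : T.elementMap K w ∈ T.elementMap K '' K.2.shape.closedCell ∩
      T.elementMap K' '' K'.2.shape.closedCell :=
    ⟨mem_image_of_mem _ hw, h ▸ mem_image_of_mem _ hw'⟩
  have i1 := injOn_elementMap hσ hκ hK
  have i2 := injOn_elementMap hσ hκ hK'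
  rcases M.regular K hK K' hK' hne with h1 | ⟨a, ha, b, hb, h1, h2⟩ | ⟨e, he, e', he', h1, h2⟩
  · rw [h1] at hx; exact absurd hx (notMem_empty _)
  · left
    rw [h1, mem_singleton_iff] at hx
    have e1 := i1 hw (Shape.vertices_subset ha).1 hx
    have e2 := i2 hw' (Shape.vertices_subset hb).1 (by rw [← h, hx, h2])
    exact ⟨e1 ▸ ha, e2 ▸ hb⟩
  · right
    rw [h1] at hx
    have hx' := hx
    rw [h2, h] at hx'
    exact ⟨e, he, e', he', (i1.mem_image_iff (Shape.edgeSet_subset he) hw).1 hx,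
      (i2.mem_image_iff (Shape.edgeSet_subset he') hw').1 hx', h2⟩

/-- The interior of an element does not meet other elements. -/
theorem eq_of_mem_cell (hK : K ∈ M.elements) (hK' : K' ∈ M.elements) {w w' : Plane}
    (hw : w ∈ K.2.shape.cell) (hw' : w' ∈ K'.2.shape.closedCell)
    (h : T.elementMap K w = T.elementMap K' w') : K = K' := by
  by_contra hne
  rcases meet hσ hκ hK hK' hne (K.2.shape.cell_subset_closedCell hw) hw' h with
    ⟨h1, -⟩ | ⟨e, he, -, -, h1, -⟩
  · exact (Shape.vertices_subset h1).2 hw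
  · exact Shape.notMem_cell_of_mem_edgeSet he h1 hw

omit hσ hκ in
/-- Points of different macro-elements coincide only in common vertices or on common edges, where
the parametrizations agree up to orientation. -/
theorem macro_meet (T : MacroTriangulation Ω n) {i j : Fin n} (hij : i ≠ j) :
    (T.F i '' Shape.square.closedCell ∩ T.F j '' Shape.square.closedCell = ∅) ∨
    (∃ a ∈ Shape.square.vertices, ∃ b ∈ Shape.square.vertices,
      T.F i '' Shape.square.closedCell ∩ T.F j '' Shape.square.closedCell = {T.F i a} ∧
        T.F i a = T.F j b) ∨
    ∃ E ∈ Shape.square.edges, ∃ E' ∈ Shape.square.edges, ∃ D : Plane × Plane,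
      (D = E' ∨ D = E'.swap) ∧
      T.F i '' Shape.square.closedCell ∩ T.F j '' Shape.square.closedCell = T.F i '' edgeSet E ∧
      ∀ t ∈ Icc (0 : ℝ) 1,
        T.F i (AffineMap.lineMap E.1 E.2 t) = T.F j (AffineMap.lineMap D.1 D.2 t) := by
  rcases T.regular i j hij with h | h | ⟨E, hE, E', hE', h1, h2⟩
  · exact Or.inl h
  · exact Or.inr (Or.inl h)
  · right; right
    rcases T.compatible i j hij E hE E' hE' h2 with h3 | h3
    · exact ⟨E, hE, E', hE', E', Or.inl rfl, h1, h3⟩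
    · refine ⟨E, hE, E', hE', E'.swap, Or.inr rfl, h1, fun t ht => ?_⟩
      rw [h3 t ht, Prod.fst_swap, Prod.snd_swap, AffineMap.lineMap_apply_one_sub]

omit hσ hκ in
theorem lineMap_lineMap (a b : Plane) (α β t : ℝ) :
    AffineMap.lineMap (AffineMap.lineMap a b α : Plane) (AffineMap.lineMap a b β) t =
      AffineMap.lineMap a b (AffineMap.lineMap α β t) := by
  simp only [AffineMap.lineMap_apply, vsub_eq_sub, vadd_eq_add, smul_eq_mul]
  module

/-- The two parametrizations of a common edge of two elements agree up to orientation, and the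
edges have the same length in the reference squares of their macro-elements. -/
theorem edge_param (hK : K ∈ M.elements) (hK' : K' ∈ M.elements)
    {e e' : Plane × Plane} (he : e ∈ K.2.shape.edges) (he' : e' ∈ K'.2.shape.edges)
    (h : T.elementMap K '' edgeSet e = T.elementMap K' '' edgeSet e') :
    ((∀ t ∈ Icc (0 : ℝ) 1, T.elementMap K (AffineMap.lineMap e.1 e.2 t) =
        T.elementMap K' (AffineMap.lineMap e'.1 e'.2 t)) ∨
      (∀ t ∈ Icc (0 : ℝ) 1, T.elementMap K (AffineMap.lineMap e.1 e.2 t) =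
        T.elementMap K' (AffineMap.lineMap e'.1 e'.2 (1 - t)))) ∧
    dist (K.2.map e.1) (K.2.map e.2) = dist (K'.2.map e'.1) (K'.2.map e'.2) := by
  set A := K.2.map e.1 with hA
  set B := K.2.map e.2 with hB
  set A' := K'.2.map e'.1 with hA'
  set B' := K'.2.map e'.2 with hB'
  have v1 := Shape.edges_mem_vertices he
  have v2 := Shape.edges_mem_vertices he'
  have mA : A ∈ Shape.square.closedCell := map_mem_square hσ hκ hK (Shape.vertices_subset v1.1).1
  have mB : B ∈ Shape.square.closedCell := map_mem_square hσ hκ hK (Shape.vertices_subset v1.2).1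
  have mA' : A' ∈ Shape.square.closedCell := map_mem_square hσ hκ hK' (Shape.vertices_subset v2.1).1
  have mB' : B' ∈ Shape.square.closedCell := map_mem_square hσ hκ hK' (Shape.vertices_subset v2.2).1
  have hAB : A ≠ B := fun hAB => Shape.edges_ne he
    (((M.isPatternElement hσ hκ hK).nondegenerate hκ).injective hAB)
  have hseg : T.F K.1 '' segment ℝ A B = T.F K'.1 '' segment ℝ A' B' := by
    rw [hA, hB, hA', hB', ← K.2.image_edgeSet, ← K'.2.image_edgeSet, image_image, image_image]
    exact h
  simp only [MacroTriangulation.elementMap, PatchElement.map_lineMap, ← hA, ← hB, ← hA', ← hB']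
  by_cases hij : K.1 = K'.1
  · rw [← hij] at hseg ⊢
    have hl := lineMap_of_image_segment_eq Shape.square.convex_closedCell (T.injOn K.1)
      mA mB mA' mB' hAB hseg
    refine ⟨hl.imp (fun h t _ => congrArg _ (h t)) (fun h t _ => congrArg _ (h t)), ?_⟩
    rcases hl with hl | hl
    · have h0 := hl 0; have h1 := hl 1
      simp only [AffineMap.lineMap_apply_zero, AffineMap.lineMap_apply_one] at h0 h1
      rw [h0, h1]
    · have h0 := hl 0; have h1 := hl 1
      simp only [sub_zero, sub_self, AffineMap.lineMap_apply_zero, AffineMap.lineMap_apply_one] at h0 h1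
      rw [h0, h1, dist_comm]
  · have hsub : T.F K.1 '' segment ℝ A B ⊆
        T.F K.1 '' Shape.square.closedCell ∩ T.F K'.1 '' Shape.square.closedCell :=
      subset_inter (image_mono (Shape.square.convex_closedCell.segment_subset mA mB))
        (hseg ▸ image_mono (Shape.square.convex_closedCell.segment_subset mA' mB'))
    have fA := hsub (mem_image_of_mem _ (left_mem_segment ℝ A B))
    have fB := hsub (mem_image_of_mem _ (right_mem_segment ℝ A B))
    rcases macro_meet T hij with h1 | ⟨a, ha, b, hb, h1, -⟩ | ⟨E, hE, E', hE', D, hD, h1, h2⟩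
    · rw [h1] at fA; exact absurd fA (notMem_empty _)
    · rw [h1, mem_singleton_iff] at fA fB
      exact absurd (T.injOn _ mA mB (fA.trans fB.symm)) hAB
    · have hD1 : edgeSet D ⊆ Shape.square.closedCell := by
        rcases hD with rfl | rfl
        · exact Shape.edgeSet_subset hE'
        · rw [edgeSet, Prod.fst_swap, Prod.snd_swap, segment_symm]
          exact Shape.edgeSet_subset hE'
      have dD : dist D.1 D.2 = 1 := by
        rcases hD with rfl | rfl
        · exact dist_of_mem_square_edges hE'
        · rw [Prod.fst_swap, Prod.snd_swap, dist_comm, dist_of_mem_square_edges hE']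
      have dE := dist_of_mem_square_edges hE
      rw [h1] at fA fB
      have gA := (T.injOn K.1).mem_image_iff (Shape.edgeSet_subset hE) mA |>.1 fA
      have gB := (T.injOn K.1).mem_image_iff (Shape.edgeSet_subset hE) mB |>.1 fB
      obtain ⟨α, hα, eA⟩ := mem_edgeSet.1 gA
      obtain ⟨β, hβ, eB⟩ := mem_edgeSet.1 gB
      have back : ∀ {Z : Plane}, Z ∈ segment ℝ A' B' → Z ∈ Shape.square.closedCell →
          ∃ γ ∈ Icc (0 : ℝ) 1, AffineMap.lineMap D.1 D.2 γ = Z := by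
        intro Z hZ mZ
        have h3 : T.F K'.1 Z ∈ T.F K.1 '' edgeSet E := by
          rw [← h1]; exact hsub (hseg ▸ mem_image_of_mem _ hZ)
        obtain ⟨Y, hY, hYZ⟩ := h3
        obtain ⟨γ, hγ, rfl⟩ := mem_edgeSet.1 hY
        refine ⟨γ, hγ, T.injOn K'.1 (hD1 (mem_edgeSet.2 ⟨γ, hγ, rfl⟩)) mZ ?_⟩
        rw [← h2 γ hγ, hYZ]
      obtain ⟨α', hα', eA'⟩ := back (left_mem_segment ℝ A' B') mA'
      obtain ⟨β', hβ', eB'⟩ := back (right_mem_segment ℝ A' B') mB'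
      have himg : ∀ {q : Plane → Plane} {X : Plane × Plane} {x y : ℝ},
          (fun τ : ℝ => q (AffineMap.lineMap X.1 X.2 τ)) '' segment ℝ x y =
            q '' segment ℝ (AffineMap.lineMap X.1 X.2 x) (AffineMap.lineMap X.1 X.2 y) := by
        intro q X x y
        rw [segment_eq_image_lineMap, segment_eq_image_lineMap, image_image, image_image]
        simp only [lineMap_lineMap]
      have hαβ : α ≠ β := fun h => hAB (by rw [← eA, ← eB, h])
      have hinj : InjOn (fun τ : ℝ => T.F K.1 (AffineMap.lineMap E.1 E.2 τ)) (Icc 0 1) := by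
        intro x hx y hy hxy
        exact AffineMap.lineMap_injective ℝ (Shape.edges_ne hE)
          (T.injOn K.1 (Shape.edgeSet_subset hE (mem_edgeSet.2 ⟨x, hx, rfl⟩))
            (Shape.edgeSet_subset hE (mem_edgeSet.2 ⟨y, hy, rfl⟩)) hxy)
      have hs' : (fun τ : ℝ => T.F K.1 (AffineMap.lineMap E.1 E.2 τ)) '' segment ℝ α β =
          (fun τ : ℝ => T.F K.1 (AffineMap.lineMap E.1 E.2 τ)) '' segment ℝ α' β' := by
        rw [himg, eA, eB, hseg, ← eA', ← eB', ← himg]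
        exact image_congr fun τ hτ => (h2 τ ((convex_Icc 0 1).segment_subset hα' hβ' hτ)).symm
      have hl := lineMap_of_image_segment_eq (convex_Icc (0 : ℝ) 1) hinj hα hβ hα' hβ' hαβ hs'
      have hmem : ∀ t ∈ Icc (0 : ℝ) 1, (AffineMap.lineMap α β t : ℝ) ∈ Icc (0 : ℝ) 1 := fun t ht =>
        (convex_Icc (0 : ℝ) 1).lineMap_mem hα hβ ht
      constructor
      · refine hl.imp (fun hl t ht => ?_) (fun hl t ht => ?_)
        · rw [← eA, ← eB, ← eA', ← eB', lineMap_lineMap, lineMap_lineMap, h2 _ (hmem t ht), hl]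
        · rw [← eA, ← eB, ← eA', ← eB', lineMap_lineMap, lineMap_lineMap, h2 _ (hmem t ht), hl]
      · rw [← eA, ← eB, ← eA', ← eB', dist_lineMap_lineMap, dist_lineMap_lineMap, dE, dD]
        rcases hl with hl | hl
        · have h0 := hl 0; have h1 := hl 1
          simp only [AffineMap.lineMap_apply_zero, AffineMap.lineMap_apply_one] at h0 h1
          rw [h0, h1]
        · have h0 := hl 0; have h1 := hl 1
          simp only [sub_zero, sub_self, AffineMap.lineMap_apply_zero, AffineMap.lineMap_apply_one] at h0 h1
          rw [h0, h1, dist_comm α' β']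

end SpectralBoundaryLayerMesh
end HpFEM

namespace HpFEM

/-! ### The region covered by the large elements -/

namespace SpectralBoundaryLayerMesh

variable {Ω : Set Plane} {n : ℕ} {T : MacroTriangulation Ω n} {σ κ : ℝ} {L : Fin n → ℕ}
  {M : SpectralBoundaryLayerMesh T σ κ L}

/-- The closed element `K` as a subset of the plane. -/
def closedElement (T : MacroTriangulation Ω n) (K : Fin n × PatchElement) : Set Plane :=
  T.elementMap K '' K.2.shape.closedCell

variable (hσ : σ ∈ Ioo (0 : ℝ) 1) (hκ : κ ∈ Ioc (0 : ℝ) (1 / 2))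
  {K K' : Fin n × PatchElement} {x : Plane}

include hσ hκ

theorem isClosed_biUnion (p : Fin n × PatchElement → Prop) :
    IsClosed (⋃ K ∈ {K ∈ M.elements | p K}, closedElement T K) :=
  (M.finite_elements.subset (sep_subset _ _)).isClosed_biUnion fun _ hK =>
    (isCompact_image_closedCell hσ hκ hK.1).isClosed

theorem kind_eq_large_of_mem (hx : x ∈ M.Ω₀) (hK : K ∈ M.elements) (hxK : x ∈ closedElement T K) :
    K.2.kind = .large := by
  have h1 := image_closedCell_subset_closure hσ hκ hK hxK
  obtain ⟨y, hy, v, hv, rfl⟩ := mem_closure_iff.1 h1 M.Ω₀ isOpen_interior hx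
  have hy' := interior_subset hy
  simp only [mem_iUnion] at hy'
  obtain ⟨K', hK', v', hv', h⟩ := hy'
  rw [eq_of_mem_cell hσ hκ hK hK'.1 hv hv' h.symm]
  exact hK'.2

theorem mem_Ω₀_of_forall (hΩ : IsOpen Ω) (hx : x ∈ Ω)
    (h : ∀ K ∈ M.elements, x ∈ closedElement T K → K.2.kind = .large) : x ∈ M.Ω₀ := by
  have hc := isClosed_biUnion (M := M) hσ hκ (fun K => x ∉ closedElement T K)
  have hxc : x ∉ ⋃ K ∈ {K ∈ M.elements | x ∉ closedElement T K}, closedElement T K := by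
    simp only [mem_iUnion, not_exists]
    exact fun K hK hxK => hK.2 hxK
  refine mem_interior.2 ⟨_, ?_, hΩ.inter hc.isOpen_compl, hx, hxc⟩
  rintro y ⟨hy, hyc⟩
  obtain ⟨K, hK, w, hw, rfl⟩ := exists_element (M := M) hσ hκ (subset_closure hy)
  have hxK : x ∈ closedElement T K := by
    by_contra hxK
    exact hyc (mem_biUnion (show K ∈ {K ∈ M.elements | x ∉ closedElement T K} from ⟨hK, hxK⟩)
      (mem_image_of_mem _ hw))
  exact mem_biUnion (show K ∈ {K ∈ M.elements | K.2.kind = .large} from ⟨hK, h K hK hxK⟩)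
    (mem_image_of_mem _ hw)

omit hσ hκ in
theorem closedElement_large_subset_union (hK : K ∈ M.elements) (hk : K.2.kind = .large) :
    closedElement T K ⊆ ⋃ K ∈ {K ∈ M.elements | K.2.kind = .large}, closedElement T K :=
  subset_biUnion_of_mem (u := closedElement T)
    (show K ∈ {K ∈ M.elements | K.2.kind = .large} from ⟨hK, hk⟩)

theorem closedElement_large_subset_closure (hK : K ∈ M.elements) (hk : K.2.kind = .large) :
    closedElement T K ⊆ closure M.Ω₀ := by
  refine (image_closedCell_subset_closure hσ hκ hK).trans (closure_mono ?_)
  refine interior_maximal ?_ (isOpen_image_cell hσ hκ hK)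
  exact (image_mono K.2.shape.cell_subset_closedCell).trans (closedElement_large_subset_union hK hk)

/-- The points of the boundary of `Ω` are the images of the bottom or left edge or of the corner
of the reference square, which the large elements do not touch. -/
theorem notMem_frontier_of_large (hK : K ∈ M.elements) (hk : K.2.kind = .large)
    (hx : x ∈ closedElement T K) : x ∉ frontier Ω := by
  obtain ⟨w, hw, rfl⟩ := hx
  intro hf
  have hp := M.isPatternElement hσ hκ hK
  have hz := map_mem_square hσ hκ hK hw
  have hb : T.F K.1 (K.2.map w) ∈ T.boundaryPart K.1 := ⟨mem_image_of_mem _ hz, hf⟩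
  have s0 : (!₂[0, 0] : Plane) ∈ Shape.square.closedCell := by simp [Shape.closedCell]
  have s1 : segment ℝ (!₂[0, 0] : Plane) !₂[1, 0] ⊆ Shape.square.closedCell :=
    Shape.square.convex_closedCell.segment_subset s0 (by simp [Shape.closedCell])
  have s2 : segment ℝ (!₂[0, 0] : Plane) !₂[0, 1] ⊆ Shape.square.closedCell :=
    Shape.square.convex_closedCell.segment_subset s0 (by simp [Shape.closedCell])
  have b1 : ∀ z ∈ segment ℝ (!₂[0, 0] : Plane) !₂[1, 0], z 1 = 0 := by
    intro z hz
    obtain ⟨t, -, rfl⟩ := (mem_edgeSet (e := (!₂[0, 0], !₂[1, 0]))).1 hz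
    simp [lineMap_apply_coord]
  have b2 : ∀ z ∈ segment ℝ (!₂[0, 0] : Plane) !₂[0, 1], z 0 = 0 := by
    intro z hz
    obtain ⟨t, -, rfl⟩ := (mem_edgeSet (e := (!₂[0, 0], !₂[0, 1]))).1 hz
    simp [lineMap_apply_coord]
  rcases M.boundary K.1 with h | ⟨h, hP⟩ | ⟨h, hP⟩ | ⟨h, hP⟩
  · rw [h] at hb; exact hb
  · rw [h, mem_singleton_iff] at hb
    have h1 := T.injOn K.1 hz s0 hb
    have h2 := hp.eq_of_large_of_le hκ hk hP hw (by rw [h1]; simpa using hκ.1.le)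
      (by rw [h1]; simpa using hκ.1.le)
    rw [h1] at h2
    have := hκ.1
    simp at h2
    linarith
  · rw [h] at hb
    have h1 := b1 _ ((T.injOn K.1).mem_image_iff s1 hz |>.1 hb)
    have h2 := hp.le_snd_of_large hκ hk (by tauto) hw
    linarith [hκ.1]
  · rw [h] at hb
    have h1 := (T.injOn K.1).mem_image_iff (union_subset s1 s2) hz |>.1 hb
    rcases h1 with h1 | h1
    · have h2 := hp.le_snd_of_large hκ hk (by tauto) hw
      linarith [hκ.1, b1 _ h1]
    · have h2 := hp.le_fst_of_large hκ hk hP hw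
      linarith [hκ.1, b2 _ h1]

theorem mem_of_large (hΩ : IsOpen Ω) (hK : K ∈ M.elements) (hk : K.2.kind = .large)
    (hx : x ∈ closedElement T K) : x ∈ Ω := by
  have h1 := notMem_frontier_of_large hσ hκ hK hk hx
  obtain ⟨w, hw, rfl⟩ := hx
  have h2 := elementMap_mem_closure hσ hκ hK hw
  rw [hΩ.frontier_eq] at h1
  by_contra h3
  exact h1 ⟨h2, h3⟩

/-- The boundary of `Ω₀` consists of the common points of large and other elements. -/
theorem mem_frontier_Ω₀_iff (hΩ : IsOpen Ω) : x ∈ frontier M.Ω₀ ↔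
    (∃ K ∈ M.elements, K.2.kind = .large ∧ x ∈ closedElement T K) ∧
      ∃ K ∈ M.elements, K.2.kind ≠ .large ∧ x ∈ closedElement T K := by
  have ho : IsOpen M.Ω₀ := isOpen_interior
  rw [ho.frontier_eq]
  constructor
  · rintro ⟨h1, h2⟩
    have h3 : x ∈ ⋃ K ∈ {K ∈ M.elements | K.2.kind = .large}, closedElement T K :=
      closure_minimal interior_subset
        (isClosed_biUnion (M := M) hσ hκ (fun K => K.2.kind = .large)) h1
    simp only [mem_iUnion] at h3
    obtain ⟨K, hK, hxK⟩ := h3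
    refine ⟨⟨K, hK.1, hK.2, hxK⟩, ?_⟩
    by_contra! h4
    refine h2 (mem_Ω₀_of_forall hσ hκ hΩ (mem_of_large hσ hκ hΩ hK.1 hK.2 hxK) ?_)
    intro K' hK' hx'
    by_contra h5
    exact h4 K' hK' h5 hx'
  · rintro ⟨⟨K, hK, hk, hxK⟩, K', hK', hk', hxK'⟩
    exact ⟨closedElement_large_subset_closure hσ hκ hK hk hxK,
      fun h => hk' (kind_eq_large_of_mem hσ hκ h hK' hxK')⟩

theorem frontier_Ω₀_subset (hΩ : IsOpen Ω) : frontier M.Ω₀ ⊆ Ω := by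
  intro x hx
  obtain ⟨⟨K, hK, hk, hxK⟩, -⟩ := (mem_frontier_Ω₀_iff hσ hκ hΩ).1 hx
  exact mem_of_large hσ hκ hΩ hK hk hxK

theorem exists_not_large_of_mem_diff (hΩ : IsOpen Ω) (hx : x ∈ Ω \ M.Ω₀) :
    ∃ K ∈ M.elements, K.2.kind ≠ .large ∧ x ∈ closedElement T K := by
  by_contra! h
  refine hx.2 (mem_Ω₀_of_forall hσ hκ hΩ hx.1 fun K' hK' hx' => ?_)
  by_contra h5
  exact h K' hK' h5 hx'

/-- If an element contains an inner point of an edge of another one, the edge is common. -/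
theorem exists_common_edge (hK : K ∈ M.elements) (hK' : K' ∈ M.elements) (hne : K ≠ K')
    {e : Plane × Plane} (he : e ∈ K.2.shape.edges) {w : Plane} (hw : w ∈ edgeSet e)
    (hv : w ∉ K.2.shape.vertices) (hx : T.elementMap K w ∈ closedElement T K') :
    ∃ e' ∈ K'.2.shape.edges, T.elementMap K '' edgeSet e = T.elementMap K' '' edgeSet e' := by
  obtain ⟨w', hw', h⟩ := hx
  rcases meet hσ hκ hK hK' hne (Shape.edgeSet_subset he hw) hw' h.symm with
    ⟨h1, -⟩ | ⟨d, hd, d', hd', h1, -, h2⟩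
  · exact absurd h1 hv
  · rw [Shape.edge_unique he hd hw h1 hv]
    exact ⟨d', hd', h2⟩

/-- An edge that has an inner point in the boundary of `Ω₀` is contained in it. -/
theorem image_edgeSet_subset_frontier (hΩ : IsOpen Ω) (hK : K ∈ M.elements)
    {e : Plane × Plane} (he : e ∈ K.2.shape.edges) {w : Plane} (hw : w ∈ edgeSet e)
    (hv : w ∉ K.2.shape.vertices) (hx : T.elementMap K w ∈ frontier M.Ω₀) :
    T.elementMap K '' edgeSet e ⊆ frontier M.Ω₀ := by
  have key : ∀ K' ∈ M.elements, T.elementMap K w ∈ closedElement T K' →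
      T.elementMap K '' edgeSet e ⊆ closedElement T K' := by
    intro K' hK' hx'
    by_cases hne : K = K'
    · rw [← hne]; exact image_mono (Shape.edgeSet_subset he)
    · obtain ⟨e', he', h⟩ := exists_common_edge hσ hκ hK hK' hne he hw hv hx'
      rw [h]
      exact image_mono (Shape.edgeSet_subset he')
  obtain ⟨⟨K₁, h1, k1, x1⟩, K₂, h2, k2, x2⟩ := (mem_frontier_Ω₀_iff hσ hκ hΩ).1 hx
  intro y hy
  exact (mem_frontier_Ω₀_iff hσ hκ hΩ).2
    ⟨⟨K₁, h1, k1, key K₁ h1 x1 hy⟩, K₂, h2, k2, key K₂ h2 x2 hy⟩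

omit hσ hκ in
theorem lineMap_half_notMem_vertices {s : Shape} {e : Plane × Plane} (he : e ∈ s.edges) :
    (AffineMap.lineMap e.1 e.2 (1 / 2 : ℝ) : Plane) ∉ s.vertices := by
  intro h
  have hne := Shape.edges_ne he
  have hinj := AffineMap.lineMap_injective ℝ hne
  rcases Shape.eq_endpoint_of_vertex he h (mem_edgeSet.2 ⟨1 / 2, by norm_num, rfl⟩) with h1 | h1
  · have := hinj (h1.trans (AffineMap.lineMap_apply_zero (k := ℝ) e.1 e.2).symm)
    norm_num at this
  · have := hinj (h1.trans (AffineMap.lineMap_apply_one (k := ℝ) e.1 e.2).symm)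
    norm_num at this

/-- An element of a corner refinement with at least one layer has no edge in the boundary
of `Ω₀`. -/
theorem not_subset_frontier_of_corner (hΩ : IsOpen Ω) (hK : K ∈ M.elements)
    (hk : K.2.kind = .corner) (hL : L K.1 ≠ 0) {e : Plane × Plane} (he : e ∈ K.2.shape.edges) :
    ¬ T.elementMap K '' edgeSet e ⊆ frontier M.Ω₀ := by
  intro hsub
  set w : Plane := AffineMap.lineMap e.1 e.2 (1 / 2 : ℝ) with hw
  have hwe : w ∈ edgeSet e := mem_edgeSet.2 ⟨1 / 2, by norm_num, rfl⟩
  have hwv := lineMap_half_notMem_vertices he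
  have hp := M.isPatternElement hσ hκ hK
  obtain ⟨⟨K', hK', hk', hx'⟩, -⟩ :=
    (mem_frontier_Ω₀_iff hσ hκ hΩ).1 (hsub (mem_image_of_mem _ hwe))
  have hp' := M.isPatternElement hσ hκ hK'
  have hne : K ≠ K' := by
    rintro rfl
    rw [hk] at hk'; exact ElementKind.noConfusion hk'
  obtain ⟨e', he', h⟩ := exists_common_edge hσ hκ hK hK' hne he hwe hwv hx'
  have hd := (edge_param hσ hκ hK hK' he he' h).2
  have hd' := hp'.half_le_dist_of_large hκ hk' e' he'
  rcases hp.edge_of_corner hκ hL hk e he with h1 | ⟨⟨a0, a1⟩, ⟨b0, b1⟩, c⟩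
  · linarith
  -- the midpoint is inside the open macro-element, so both elements belong to the same one
  have hm : ∀ i, K.2.map w i = (K.2.map e.1 i + K.2.map e.2 i) / 2 := by
    intro i
    rw [hw, PatchElement.map_lineMap, lineMap_apply_coord]; ring
  have hmc : K.2.map w ∈ Shape.square.cell := by
    have := hκ.2
    refine ⟨?_, ?_, ?_, ?_⟩ <;> simp only [hm] <;> linarith
  obtain ⟨w', hw', h'⟩ := hx'
  by_cases hij : K.1 = K'.1
  · have hz : K'.2.map w' = K.2.map w := by
      refine T.injOn K'.1 (map_mem_square hσ hκ hK' hw')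
        (map_mem_square hσ hκ hK (Shape.edgeSet_subset he hwe)) (h'.trans ?_)
      rw [← hij]; rfl
    have hP := hp.corner_pattern hk
    rw [hij] at hP
    have h2 := hp'.eq_of_large_of_le hκ hk' hP hw' (by rw [hz, hm]; linarith)
      (by rw [hz, hm]; linarith)
    rw [hz, hm, hm] at h2
    rcases c with c | c <;> linarith
  · have hmem : T.F K.1 (K.2.map w) ∈
        T.F K.1 '' Shape.square.closedCell ∩ T.F K'.1 '' Shape.square.closedCell :=
      ⟨mem_image_of_mem _ (Shape.cell_subset_closedCell _ hmc),
        ⟨_, map_mem_square hσ hκ hK' hw', h'⟩⟩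
    have hmcc := Shape.cell_subset_closedCell _ hmc
    rcases macro_meet T hij with h1 | ⟨a, ha, b, hb, h1, -⟩ | ⟨E, hE, E', hE', D, hD, h1, h2⟩
    · rw [h1] at hmem; exact hmem
    · rw [h1, mem_singleton_iff] at hmem
      have := T.injOn K.1 hmcc (Shape.vertices_subset ha).1 hmem
      exact (Shape.vertices_subset ha).2 (this ▸ hmc)
    · rw [h1] at hmem
      have := (T.injOn K.1).mem_image_iff (Shape.edgeSet_subset hE) hmcc |>.1 hmem
      exact Shape.notMem_cell_of_mem_edgeSet hE this hmc

end SpectralBoundaryLayerMesh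
end HpFEM

namespace HpFEM

/-! ### Vertex values of the lifting -/

/-- The continuous function on `[0, κ]²` that is affine above and below the diagonal and has the
values `a`, `b`, `c`, `d` in `(0, 0)`, `(κ, 0)`, `(κ, κ)`, `(0, κ)`. -/
def cornerInterpolant (κ a b c d : ℝ) (z : Plane) : ℝ :=
  if z 1 ≤ z 0 then a + (b - a) * (z 0 / κ) + (c - b) * (z 1 / κ)
  else a + (d - a) * (z 1 / κ) + (c - d) * (z 0 / κ)

variable {Ω : Set Plane} {n : ℕ}

open Classical in
/-- The value of the lifting of `G` in the vertex `F_i z` of the mesh: the value of `G` itself, if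
`z` is outside the corner square `[0, κ]²`, and the value of the interpolant of the values of `G`
in the four vertices of the corner square otherwise. The number of layers and the grading factor
do not enter. -/
def nodalValue (T : MacroTriangulation Ω n) (κ : ℝ) (G : Plane → ℝ) (i : Fin n) (z : Plane) : ℝ :=
  if z 0 ≤ κ ∧ z 1 ≤ κ then
    cornerInterpolant κ (G (T.F i !₂[0, 0])) (G (T.F i !₂[κ, 0])) (G (T.F i !₂[κ, κ]))
      (G (T.F i !₂[0, κ])) z
  else G (T.F i z)

variable {T : MacroTriangulation Ω n} {σ κ : ℝ} {L : Fin n → ℕ}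

theorem cornerInterpolant_add (a b c d a' b' c' d' : ℝ) (z : Plane) :
    cornerInterpolant κ (a + a') (b + b') (c + c') (d + d') z =
      cornerInterpolant κ a b c d z + cornerInterpolant κ a' b' c' d' z := by
  unfold cornerInterpolant; split_ifs <;> ring

theorem cornerInterpolant_mul (r a b c d : ℝ) (z : Plane) :
    cornerInterpolant κ (r * a) (r * b) (r * c) (r * d) z = r * cornerInterpolant κ a b c d z := by
  unfold cornerInterpolant; split_ifs <;> ring

theorem nodalValue_add (G G' : Plane → ℝ) (i : Fin n) (z : Plane) :
    nodalValue T κ (fun x => G x + G' x) i z = nodalValue T κ G i z + nodalValue T κ G' i z := by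
  unfold nodalValue; split_ifs
  · exact cornerInterpolant_add ..
  · rfl

theorem nodalValue_mul (r : ℝ) (G : Plane → ℝ) (i : Fin n) (z : Plane) :
    nodalValue T κ (fun x => r * G x) i z = r * nodalValue T κ G i z := by
  unfold nodalValue; split_ifs
  · exact cornerInterpolant_mul ..
  · rfl

theorem abs_cornerInterpolant_le {a b c d B : ℝ} {z : Plane} (hκ : 0 < κ) (ha : |a| ≤ B)
    (hb : |b| ≤ B) (hc : |c| ≤ B) (hd : |d| ≤ B) (h0 : 0 ≤ z 0) (h1 : 0 ≤ z 1) (k0 : z 0 ≤ κ)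
    (k1 : z 1 ≤ κ) : |cornerInterpolant κ a b c d z| ≤ B := by
  have key : ∀ {a b c s t : ℝ}, |a| ≤ B → |b| ≤ B → |c| ≤ B → 0 ≤ t → t ≤ s → s ≤ 1 →
      |a + (b - a) * s + (c - b) * t| ≤ B := by
    intro a b c s t ha hb hc ht hts hs
    rw [abs_le] at *
    constructor <;> nlinarith [mul_nonneg (sub_nonneg.2 hs) (sub_nonneg.2 ha.1),
      mul_nonneg (sub_nonneg.2 hs) (sub_nonneg.2 ha.2),
      mul_nonneg (sub_nonneg.2 hts) (sub_nonneg.2 hb.1),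
      mul_nonneg (sub_nonneg.2 hts) (sub_nonneg.2 hb.2), mul_nonneg ht (sub_nonneg.2 hc.1),
      mul_nonneg ht (sub_nonneg.2 hc.2)]
  unfold cornerInterpolant
  split_ifs with h
  · exact key ha hb hc (by positivity) (by gcongr) ((div_le_one hκ).2 k0)
  · exact key ha hd hc (by positivity) (by gcongr; linarith) ((div_le_one hκ).2 k1)

theorem abs_nodalValue_le {G : Plane → ℝ} {B : ℝ} (hκ : 0 < κ) (hG : ∀ x, |G x| ≤ B) (i : Fin n)
    {z : Plane} (hz : z ∈ Shape.square.closedCell) : |nodalValue T κ G i z| ≤ B := by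
  unfold nodalValue
  split_ifs with h
  · exact abs_cornerInterpolant_le hκ (hG _) (hG _) (hG _) (hG _) hz.1 hz.2.2.1 h.1 h.2
  · exact hG _

/-- The points of the square both of whose coordinates are `0`, `κ` or `1`. -/
def IsGridPoint (κ : ℝ) (z : Plane) : Prop :=
  (z 0 = 0 ∨ z 0 = κ ∨ z 0 = 1) ∧ (z 1 = 0 ∨ z 1 = κ ∨ z 1 = 1)

theorem nodalValue_of_isGridPoint {G : Plane → ℝ} (hκ : κ ∈ Ioc (0 : ℝ) (1 / 2)) (i : Fin n)
    {z : Plane} (hz : IsGridPoint κ z) : nodalValue T κ G i z = G (T.F i z) := by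
  obtain ⟨k0, k1⟩ := hκ
  have k2 : κ / κ = 1 := div_self k0.ne'
  unfold nodalValue
  split_ifs with h
  · have z0 : z 0 = 0 ∨ z 0 = κ := by rcases hz.1 with h1 | h1 | h1 <;> [tauto; tauto; linarith]
    have z1 : z 1 = 0 ∨ z 1 = κ := by rcases hz.2 with h1 | h1 | h1 <;> [tauto; tauto; linarith]
    unfold cornerInterpolant
    rcases z0 with z0 | z0 <;> rcases z1 with z1 | z1
    · rw [show z = !₂[0, 0] from plane_ext (by simpa) (by simpa)]; simp
    · rw [show z = !₂[0, κ] from plane_ext (by simpa) (by simpa)]; simp [k0, k2]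
    · rw [show z = !₂[κ, 0] from plane_ext (by simpa) (by simpa)]; simp [k0.le, k2]
    · rw [show z = !₂[κ, κ] from plane_ext (by simpa) (by simpa)]; simp [k2]
  · rfl

/-- The nodal values on the bottom and on the left edge, close to the corner. -/
theorem nodalValue_lineMap {G : Plane → ℝ} (hκ : κ ∈ Ioc (0 : ℝ) (1 / 2)) (i : Fin n)
    {D : Plane × Plane} (hD : D = (!₂[0, 0], !₂[1, 0]) ∨ D = (!₂[0, 0], !₂[0, 1])) {t : ℝ}
    (ht : 0 < t) (ht' : t ≤ κ) :
    nodalValue T κ G i (AffineMap.lineMap D.1 D.2 t) =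
      (1 - t / κ) * G (T.F i (AffineMap.lineMap D.1 D.2 (0 : ℝ))) +
        t / κ * G (T.F i (AffineMap.lineMap D.1 D.2 κ)) := by
  have e1 : ∀ s : ℝ, AffineMap.lineMap (!₂[0, 0] : Plane) !₂[1, 0] s = (!₂[s, 0] : Plane) :=
    fun s => plane_ext (by simp [lineMap_apply_coord]) (by simp [lineMap_apply_coord])
  have e2 : ∀ s : ℝ, AffineMap.lineMap (!₂[0, 0] : Plane) !₂[0, 1] s = (!₂[0, s] : Plane) :=
    fun s => plane_ext (by simp [lineMap_apply_coord]) (by simp [lineMap_apply_coord])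
  rcases hD with rfl | rfl
  · simp only [e1, nodalValue, cornerInterpolant]
    simp [ht', ht.le, hκ.1.le]; ring
  · simp only [e2, nodalValue, cornerInterpolant]
    simp [ht', not_le.2 ht, hκ.1.le]; ring

/-- A node of the mesh on an edge of the square, at distance less than `κ` from one of its end
points, lies on the bottom or on the left edge, and the end point is the origin. -/
theorem edge_of_isNode (hκ : κ ∈ Ioc (0 : ℝ) (1 / 2)) {E D : Plane × Plane}
    (hE : E ∈ Shape.square.edges) (hD : D = E ∨ D = E.swap) {t : ℝ} (ht : 0 < t) (ht' : t < κ)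
    (hz : IsNode κ (AffineMap.lineMap D.1 D.2 t)) :
    D = (!₂[0, 0], !₂[1, 0]) ∨ D = (!₂[0, 0], !₂[0, 1]) := by
  obtain ⟨k0, k1⟩ := hκ
  simp only [Shape.edges, List.mem_cons, List.not_mem_nil, or_false] at hE
  have heq : ∀ {z : Plane} {a b : ℝ}, z = !₂[a, b] → z 0 = a ∧ z 1 = b := by
    rintro _ a b rfl; simp
  have hz' : ((1 - t) * D.1 0 + t * D.2 0 = 0 ∨ (1 - t) * D.1 0 + t * D.2 0 = κ ∨
        (1 - t) * D.1 0 + t * D.2 0 = 1) ∧ ((1 - t) * D.1 1 + t * D.2 1 = 0 ∨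
        (1 - t) * D.1 1 + t * D.2 1 = κ ∨ (1 - t) * D.1 1 + t * D.2 1 = 1) ∨
      ∃ h, 0 < h ∧ h ≤ κ ∧ (((1 - t) * D.1 0 + t * D.2 0 = h ∧ (1 - t) * D.1 1 + t * D.2 1 = 0) ∨
        ((1 - t) * D.1 0 + t * D.2 0 = 0 ∧ (1 - t) * D.1 1 + t * D.2 1 = h) ∨
        ((1 - t) * D.1 0 + t * D.2 0 = h ∧ (1 - t) * D.1 1 + t * D.2 1 = h)) := by
    simp only [← lineMap_apply_coord]
    rcases hz with hz | ⟨h, h1, h2, h3⟩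
    · exact Or.inl hz
    · exact Or.inr ⟨h, h1, h2, h3.imp heq (Or.imp heq heq)⟩
  have hD' : (D = (!₂[0, 0], !₂[1, 0]) ∨ D = (!₂[0, 0], !₂[0, 1])) ∨
      (D.1 0 = 1 ∧ D.1 1 = 0 ∧ D.2 0 = 0 ∧ D.2 1 = 0) ∨
      (D.1 0 = 1 ∧ D.1 1 = 0 ∧ D.2 0 = 1 ∧ D.2 1 = 1) ∨
      (D.1 0 = 1 ∧ D.1 1 = 1 ∧ D.2 0 = 1 ∧ D.2 1 = 0) ∨
      (D.1 0 = 0 ∧ D.1 1 = 1 ∧ D.2 0 = 1 ∧ D.2 1 = 1) ∨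
      (D.1 0 = 1 ∧ D.1 1 = 1 ∧ D.2 0 = 0 ∧ D.2 1 = 1) ∨
      (D.1 0 = 0 ∧ D.1 1 = 1 ∧ D.2 0 = 0 ∧ D.2 1 = 0) := by
    rcases hD with rfl | rfl <;> rcases hE with rfl | rfl | rfl | rfl <;> simp
  rcases hD' with h | h
  · exact h
  exfalso
  rcases h with ⟨a, b, c, d⟩ | ⟨a, b, c, d⟩ | ⟨a, b, c, d⟩ | ⟨a, b, c, d⟩ | ⟨a, b, c, d⟩ |
    ⟨a, b, c, d⟩ <;> rw [a, b, c, d] at hz' <;>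
    rcases hz' with ⟨h1 | h1 | h1, h2 | h2 | h2⟩ | ⟨h, h1, h2, ⟨h3, h4⟩ | ⟨h3, h4⟩ | ⟨h3, h4⟩⟩ <;>
    linarith

theorem exists_of_isNode_of_not_isGridPoint (hκ : κ ∈ Ioc (0 : ℝ) (1 / 2)) {z : Plane}
    (hz : IsNode κ z) (hz' : ¬ IsGridPoint κ z) :
    z ∈ Shape.square.cell ∨ ∃ t, 0 < t ∧ t < κ ∧ (z = !₂[t, 0] ∨ z = !₂[0, t]) := by
  obtain ⟨k0, k1⟩ := hκ
  rcases hz with hz | ⟨h, h0, h1, h2⟩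
  · exact absurd hz hz'
  have hlt : h < κ := by
    refine lt_of_le_of_ne h1 ?_
    rintro rfl
    exact hz' (by rcases h2 with rfl | rfl | rfl <;> simp [IsGridPoint])
  rcases h2 with rfl | rfl | rfl
  · exact Or.inr ⟨h, h0, hlt, Or.inl rfl⟩
  · exact Or.inr ⟨h, h0, hlt, Or.inr rfl⟩
  · left; simp only [Shape.cell, mem_ofPred_eq]; simp; exact ⟨h0, by linarith, h0, by linarith⟩

theorem nodalValue_eq_of_not_isGridPoint {G : Plane → ℝ} (hκ : κ ∈ Ioc (0 : ℝ) (1 / 2)) {i j : Fin n}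
    (hij : i ≠ j) {z z' : Plane} (hz : IsNode κ z) (hz' : IsNode κ z')
    (mz : z ∈ Shape.square.closedCell) (mz' : z' ∈ Shape.square.closedCell)
    (h : T.F i z = T.F j z') (hg : ¬ IsGridPoint κ z) :
    nodalValue T κ G i z = nodalValue T κ G j z' := by
  have hmem : T.F i z ∈ T.F i '' Shape.square.closedCell ∩ T.F j '' Shape.square.closedCell :=
    ⟨mem_image_of_mem _ mz, h ▸ mem_image_of_mem _ mz'⟩
  have hng := exists_of_isNode_of_not_isGridPoint hκ hz hg
  rcases SpectralBoundaryLayerMesh.macro_meet T hij with h1 | ⟨a, ha, b, hb, h1, -⟩ |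
    ⟨E, hE, E', hE'', D, hD, h1, h2⟩
  · rw [h1] at hmem; exact absurd hmem (notMem_empty _)
  · rw [h1, mem_singleton_iff] at hmem
    obtain rfl := T.injOn i mz (Shape.vertices_subset ha).1 hmem
    refine absurd ?_ hg
    simp only [Shape.vertices, List.mem_cons, List.not_mem_nil, or_false] at ha
    rcases ha with rfl | rfl | rfl | rfl <;> simp [IsGridPoint]
  · rw [h1] at hmem
    have hzE := (T.injOn i).mem_image_iff (Shape.edgeSet_subset hE) mz |>.1 hmem
    rcases hng with hng | ⟨t, t0, tκ, hzt⟩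
    · exact absurd hng (Shape.notMem_cell_of_mem_edgeSet hE hzE)
    obtain ⟨s, hs, rfl⟩ := mem_edgeSet.1 hzE
    have c0 := lineMap_apply_coord E.1 E.2 s 0
    have c1 := lineMap_apply_coord E.1 E.2 s 1
    obtain rfl : s = t := by
      simp only [Shape.edges, List.mem_cons, List.not_mem_nil, or_false] at hE
      have := hκ.2
      rcases hzt with hzt | hzt <;> rw [hzt] at c0 c1 <;>
        rcases hE with rfl | rfl | rfl | rfl <;> simp at c0 c1 <;> linarith
    have hE' := edge_of_isNode hκ hE (Or.inl rfl) t0 tκ hz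
    have hD1 : edgeSet D ⊆ Shape.square.closedCell := by
      rcases hD with rfl | rfl
      · exact Shape.edgeSet_subset hE''
      · rw [edgeSet, Prod.fst_swap, Prod.snd_swap, segment_symm]
        exact Shape.edgeSet_subset hE''
    have hz2 : AffineMap.lineMap D.1 D.2 s = z' := by
      refine T.injOn j (hD1 (mem_edgeSet.2 ⟨s, hs, rfl⟩)) mz' ?_
      rw [← h2 s hs, h]
    subst hz2
    have hD' := edge_of_isNode hκ hE'' hD t0 tκ hz'
    rw [nodalValue_lineMap hκ i hE' t0 tκ.le, nodalValue_lineMap hκ j hD' t0 tκ.le,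
      h2 0 (by simp), h2 κ ⟨hκ.1.le, by linarith [hκ.2]⟩]

/-- The nodal values do not depend on the macro-element in which they are computed. -/
theorem nodalValue_eq {G : Plane → ℝ} (hκ : κ ∈ Ioc (0 : ℝ) (1 / 2)) {i j : Fin n}
    {z z' : Plane} (hz : IsNode κ z) (hz' : IsNode κ z')
    (mz : z ∈ Shape.square.closedCell) (mz' : z' ∈ Shape.square.closedCell)
    (h : T.F i z = T.F j z') : nodalValue T κ G i z = nodalValue T κ G j z' := by
  by_cases hij : i = j
  · subst hij; rw [T.injOn i mz mz' h]
  by_cases h1 : IsGridPoint κ z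
  · by_cases h2 : IsGridPoint κ z'
    · rw [nodalValue_of_isGridPoint hκ i h1, nodalValue_of_isGridPoint hκ j h2, h]
    · exact (nodalValue_eq_of_not_isGridPoint hκ (Ne.symm hij) hz' hz mz' mz h.symm h2).symm
  · exact nodalValue_eq_of_not_isGridPoint hκ hij hz hz' mz mz' h h1

end HpFEM

namespace HpFEM

/-! ### The lifting -/

namespace SpectralBoundaryLayerMesh

variable {Ω : Set Plane} {n : ℕ} {T : MacroTriangulation Ω n} {σ κ : ℝ} {L : Fin n → ℕ}

/-- The value of the lifting of `G` in the vertex `v` of the element `K`. -/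
def vertexValue (T : MacroTriangulation Ω n) (κ : ℝ) (G : Plane → ℝ) (K : Fin n × PatchElement)
    (v : Plane) : ℝ :=
  nodalValue T κ G K.1 (K.2.map v)

variable (M : SpectralBoundaryLayerMesh T σ κ L)

open Classical in
/-- The lifting of `G` on the edge `e` of `K`, as a function on `[0, 1]`: it is `G` on the edges
contained in `∂Ω₀`, and it interpolates the vertex values linearly on all other edges. -/
def edgeValue (G : Plane → ℝ) (K : Fin n × PatchElement) (e : Plane × Plane) (t : ℝ) : ℝ :=
  if T.elementMap K '' edgeSet e ⊆ frontier M.Ω₀ then G (T.elementMap K (AffineMap.lineMap e.1 e.2 t))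
  else (1 - t) * vertexValue T κ G K e.1 + t * vertexValue T κ G K e.2

/-- The lifting of `G` on the element `K`, pulled back to the reference cell. -/
def elementLift (G : Plane → ℝ) (K : Fin n × PatchElement) : Plane → ℝ :=
  K.2.shape.lift (vertexValue T κ G K) (M.edgeValue G K)

open Classical in
/-- The lifting of `G`, which is assembled from the liftings on the elements and extended by zero
to the complement of the closure of `Ω`. -/
def globalLift (G : Plane → ℝ) (x : Plane) : ℝ :=
  if h : ∃ K : Fin n × PatchElement, ∃ w : Plane, K ∈ M.elements ∧ w ∈ K.2.shape.closedCell ∧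
    T.elementMap K w = x then M.elementLift G h.choose h.choose_spec.choose else 0

variable {M}

theorem edgeValue_add (G G' : Plane → ℝ) (K : Fin n × PatchElement) (e : Plane × Plane) (t : ℝ) :
    M.edgeValue (fun x => G x + G' x) K e t = M.edgeValue G K e t + M.edgeValue G' K e t := by
  unfold edgeValue vertexValue; split_ifs
  · rfl
  · rw [nodalValue_add, nodalValue_add]; ring

theorem edgeValue_mul (r : ℝ) (G : Plane → ℝ) (K : Fin n × PatchElement) (e : Plane × Plane)
    (t : ℝ) : M.edgeValue (fun x => r * G x) K e t = r * M.edgeValue G K e t := by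
  unfold edgeValue vertexValue; split_ifs
  · rfl
  · rw [nodalValue_mul, nodalValue_mul]; ring

theorem elementLift_add (G G' : Plane → ℝ) (K : Fin n × PatchElement) (w : Plane) :
    M.elementLift (fun x => G x + G' x) K w = M.elementLift G K w + M.elementLift G' K w := by
  unfold elementLift
  rw [← Shape.lift_add]
  congr 1
  · exact funext fun v => nodalValue_add ..
  · exact funext₂ fun e t => edgeValue_add ..

theorem elementLift_mul (r : ℝ) (G : Plane → ℝ) (K : Fin n × PatchElement) (w : Plane) :
    M.elementLift (fun x => r * G x) K w = r * M.elementLift G K w := by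
  unfold elementLift
  rw [← Shape.lift_smul]
  congr 1
  · exact funext fun v => nodalValue_mul ..
  · exact funext₂ fun e t => edgeValue_mul ..

theorem globalLift_add (G G' : Plane → ℝ) (x : Plane) :
    M.globalLift (fun x => G x + G' x) x = M.globalLift G x + M.globalLift G' x := by
  unfold globalLift; split_ifs
  · exact elementLift_add ..
  · ring

theorem globalLift_mul (r : ℝ) (G : Plane → ℝ) (x : Plane) :
    M.globalLift (fun x => r * G x) x = r * M.globalLift G x := by
  unfold globalLift; split_ifs
  · exact elementLift_mul ..
  · ring

variable (hσ : σ ∈ Ioo (0 : ℝ) 1) (hκ : κ ∈ Ioc (0 : ℝ) (1 / 2))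
  {K K' : Fin n × PatchElement} {x : Plane} {G : Plane → ℝ}

include hσ hκ

/-- If a vertex of an element belongs to another element, it is a vertex of the latter. -/
theorem mem_vertices_of_eq (hK : K ∈ M.elements) (hK' : K' ∈ M.elements) {v w : Plane}
    (hv : v ∈ K.2.shape.vertices) (hw : w ∈ K'.2.shape.closedCell)
    (h : T.elementMap K v = T.elementMap K' w) : w ∈ K'.2.shape.vertices := by
  have hvc := (Shape.vertices_subset hv).1
  by_cases hne : K = K'
  · subst hne
    rwa [← injOn_elementMap hσ hκ hK hvc hw h]
  rcases meet hσ hκ hK hK' hne hvc hw h with ⟨-, h1⟩ | ⟨e, he, e', he', h1, -, h2⟩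
  · exact h1
  have hv' := Shape.edges_mem_vertices he'
  have key : T.elementMap K' w = T.elementMap K' e'.1 ∨ T.elementMap K' w = T.elementMap K' e'.2 := by
    rw [← h]
    rcases (edge_param hσ hκ hK hK' he he' h2).1 with hp | hp <;>
      rcases Shape.eq_endpoint_of_vertex he hv h1 with rfl | rfl
    · left; simpa using hp 0 (by simp)
    · right; simpa using hp 1 (by simp)
    · right; simpa using hp 0 (by simp)
    · left; simpa using hp 1 (by simp)
  have hi := injOn_elementMap hσ hκ hK'
  rcases key with key | key
  · rw [hi hw (Shape.vertices_subset hv'.1).1 key]; exact hv'.1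
  · rw [hi hw (Shape.vertices_subset hv'.2).1 key]; exact hv'.2

theorem vertexValue_eq (hK : K ∈ M.elements) (hK' : K' ∈ M.elements) {v v' : Plane}
    (hv : v ∈ K.2.shape.vertices) (hv' : v' ∈ K'.2.shape.vertices)
    (h : T.elementMap K v = T.elementMap K' v') :
    vertexValue T κ G K v = vertexValue T κ G K' v' :=
  nodalValue_eq hκ ((M.isPatternElement hσ hκ hK).isNode v hv)
    ((M.isPatternElement hσ hκ hK').isNode v' hv')
    (map_mem_square hσ hκ hK (Shape.vertices_subset hv).1)
    (map_mem_square hσ hκ hK' (Shape.vertices_subset hv').1) h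

/-- In the vertices on the boundary of `Ω₀` the lifting has the prescribed values. -/
theorem vertexValue_of_mem_frontier (hΩ : IsOpen Ω) (hK : K ∈ M.elements) {v : Plane}
    (hv : v ∈ K.2.shape.vertices) (hx : T.elementMap K v ∈ frontier M.Ω₀) :
    vertexValue T κ G K v = G (T.elementMap K v) := by
  obtain ⟨⟨K', hK', hk', w, hw, h⟩, -⟩ := (mem_frontier_Ω₀_iff hσ hκ hΩ).1 hx
  have hw' := mem_vertices_of_eq hσ hκ hK hK' hv hw h.symm
  rw [vertexValue_eq hσ hκ hK hK' hv hw' h.symm, ← h]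
  exact nodalValue_of_isGridPoint hκ _
    ((M.isPatternElement hσ hκ hK').isNode_of_large hk' w hw')

/-- The edge data are continuous at the vertices of the element. -/
theorem edgeValue_endpoints (hΩ : IsOpen Ω) (hK : K ∈ M.elements) {e : Plane × Plane}
    (he : e ∈ K.2.shape.edges) : M.edgeValue G K e 0 = vertexValue T κ G K e.1 ∧
      M.edgeValue G K e 1 = vertexValue T κ G K e.2 := by
  have hv := Shape.edges_mem_vertices he
  unfold edgeValue
  split_ifs with h
  · rw [AffineMap.lineMap_apply_zero, AffineMap.lineMap_apply_one]
    exact ⟨(vertexValue_of_mem_frontier hσ hκ hΩ hK hv.1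
        (h (mem_image_of_mem _ (left_mem_segment ℝ _ _)))).symm,
      (vertexValue_of_mem_frontier hσ hκ hΩ hK hv.2
        (h (mem_image_of_mem _ (right_mem_segment ℝ _ _)))).symm⟩
  · constructor <;> ring

theorem elementLift_lineMap (hΩ : IsOpen Ω) (hK : K ∈ M.elements) {e : Plane × Plane}
    (he : e ∈ K.2.shape.edges) (t : ℝ) :
    M.elementLift G K (AffineMap.lineMap e.1 e.2 t) = M.edgeValue G K e t :=
  Shape.lift_lineMap (fun _ hd => edgeValue_endpoints hσ hκ hΩ hK hd) he t

theorem elementLift_vertex (hΩ : IsOpen Ω) (hK : K ∈ M.elements) {v : Plane}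
    (hv : v ∈ K.2.shape.vertices) : M.elementLift G K v = vertexValue T κ G K v := by
  obtain ⟨e, he, hve⟩ := Shape.exists_edge_of_notMem_cell (Shape.vertices_subset hv).1
    (Shape.vertices_subset hv).2
  have h := edgeValue_endpoints (G := G) hσ hκ hΩ hK he
  have h0 := elementLift_lineMap (G := G) hσ hκ hΩ hK he 0
  have h1 := elementLift_lineMap (G := G) hσ hκ hΩ hK he 1
  rw [AffineMap.lineMap_apply_zero, h.1] at h0
  rw [AffineMap.lineMap_apply_one, h.2] at h1
  rcases Shape.eq_endpoint_of_vertex he hv hve with rfl | rfl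
  · exact h0
  · exact h1

/-- The liftings on two elements agree in the common points. -/
theorem elementLift_eq (hΩ : IsOpen Ω) (hK : K ∈ M.elements) (hK' : K' ∈ M.elements) {w w' : Plane}
    (hw : w ∈ K.2.shape.closedCell) (hw' : w' ∈ K'.2.shape.closedCell)
    (h : T.elementMap K w = T.elementMap K' w') : M.elementLift G K w = M.elementLift G K' w' := by
  by_cases hne : K = K'
  · subst hne; rw [injOn_elementMap hσ hκ hK hw hw' h]
  rcases meet hσ hκ hK hK' hne hw hw' h with ⟨h1, h2⟩ | ⟨e, he, e', he', h1, h2, h3⟩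
  · rw [elementLift_vertex hσ hκ hΩ hK h1, elementLift_vertex hσ hκ hΩ hK' h2,
      vertexValue_eq hσ hκ hK hK' h1 h2 h]
  · obtain ⟨t, ht, rfl⟩ := mem_edgeSet.1 h1
    have hv := Shape.edges_mem_vertices he
    have hv' := Shape.edges_mem_vertices he'
    have hsub : ∀ s ∈ Icc (0 : ℝ) 1, (AffineMap.lineMap e'.1 e'.2 s : Plane) ∈ K'.2.shape.closedCell :=
      fun s hs => Shape.edgeSet_subset he' (mem_edgeSet.2 ⟨s, hs, rfl⟩)
    rcases (edge_param hσ hκ hK hK' he he' h3).1 with hp | hp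
    · have hww : w' = AffineMap.lineMap e'.1 e'.2 t :=
        injOn_elementMap hσ hκ hK' hw' (hsub t ht) (by rw [← h, hp t ht])
      have e0 := hp 0 (by simp)
      have e1 := hp 1 (by simp)
      simp only [AffineMap.lineMap_apply_zero, AffineMap.lineMap_apply_one] at e0 e1
      rw [hww, elementLift_lineMap hσ hκ hΩ hK he, elementLift_lineMap hσ hκ hΩ hK' he']
      unfold edgeValue
      rw [h3, hp t ht, vertexValue_eq hσ hκ hK hK' hv.1 hv'.1 e0,
        vertexValue_eq hσ hκ hK hK' hv.2 hv'.2 e1]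
    · have ht' : 1 - t ∈ Icc (0 : ℝ) 1 := ⟨by linarith [ht.2], by linarith [ht.1]⟩
      have hww : w' = AffineMap.lineMap e'.1 e'.2 (1 - t) :=
        injOn_elementMap hσ hκ hK' hw' (hsub _ ht') (by rw [← h, hp t ht])
      have e0 := hp 0 (by simp)
      have e1 := hp 1 (by simp)
      simp only [sub_zero, sub_self, AffineMap.lineMap_apply_zero,
        AffineMap.lineMap_apply_one] at e0 e1
      rw [hww, elementLift_lineMap hσ hκ hΩ hK he, elementLift_lineMap hσ hκ hΩ hK' he']
      unfold edgeValue
      rw [h3, hp t ht, vertexValue_eq hσ hκ hK hK' hv.1 hv'.2 e0,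
        vertexValue_eq hσ hκ hK hK' hv.2 hv'.1 e1]
      split_ifs
      · rfl
      · ring

theorem globalLift_elementMap (hΩ : IsOpen Ω) (hK : K ∈ M.elements) {w : Plane}
    (hw : w ∈ K.2.shape.closedCell) :
    M.globalLift G (T.elementMap K w) = M.elementLift G K w := by
  have h : ∃ K' : Fin n × PatchElement, ∃ w' : Plane, K' ∈ M.elements ∧
      w' ∈ K'.2.shape.closedCell ∧ T.elementMap K' w' = T.elementMap K w := ⟨K, w, hK, hw, rfl⟩
  unfold globalLift
  rw [dif_pos h]
  obtain ⟨h1, h2, h3⟩ := h.choose_spec.choose_spec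
  exact elementLift_eq hσ hκ hΩ h1 hK h2 hw h3

theorem globalLift_of_notMem (hx : x ∉ closure Ω) : M.globalLift G x = 0 := by
  unfold globalLift
  rw [dif_neg]
  rintro ⟨K, w, hK, hw, rfl⟩
  exact hx (elementMap_mem_closure hσ hκ hK hw)

/-- The lifting has the prescribed values on the boundary of `Ω₀`. -/
theorem globalLift_of_mem_frontier (hΩ : IsOpen Ω) (hx : x ∈ frontier M.Ω₀) :
    M.globalLift G x = G x := by
  obtain ⟨⟨K, hK, hk, w, hw, rfl⟩, K', hK', hk', w', hw', h⟩ := (mem_frontier_Ω₀_iff hσ hκ hΩ).1 hx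
  have hwc : w ∉ K.2.shape.cell := by
    intro hwc
    rw [eq_of_mem_cell hσ hκ hK hK' hwc hw' h.symm] at hk
    exact hk' hk
  rw [globalLift_elementMap hσ hκ hΩ hK hw]
  by_cases hv : w ∈ K.2.shape.vertices
  · rw [elementLift_vertex hσ hκ hΩ hK hv, vertexValue_of_mem_frontier hσ hκ hΩ hK hv hx]
  obtain ⟨e, he, hwe⟩ := Shape.exists_edge_of_notMem_cell hw hwc
  have hsub := image_edgeSet_subset_frontier hσ hκ hΩ hK he hwe hv hx
  obtain ⟨t, ht, rfl⟩ := mem_edgeSet.1 hwe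
  rw [elementLift_lineMap hσ hκ hΩ hK he, edgeValue, if_pos hsub]

theorem abs_vertexValue_le {B : ℝ} (hG : ∀ x, |G x| ≤ B) (hK : K ∈ M.elements) {v : Plane}
    (hv : v ∈ K.2.shape.vertices) : |vertexValue T κ G K v| ≤ B :=
  abs_nodalValue_le hκ.1 hG _ (map_mem_square hσ hκ hK (Shape.vertices_subset hv).1)

theorem abs_elementLift_le {B : ℝ} (hG : ∀ x, |G x| ≤ B) (hK : K ∈ M.elements) {w : Plane}
    (hw : w ∈ K.2.shape.closedCell) : |M.elementLift G K w| ≤ 7 * B := by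
  refine Shape.abs_lift_le (fun v hv => abs_vertexValue_le hσ hκ hG hK hv) ?_ hw
  intro e he t ht
  have hv := Shape.edges_mem_vertices he
  unfold edgeValue
  split_ifs
  · exact hG _
  · exact abs_convex_comb_le (abs_vertexValue_le hσ hκ hG hK hv.1)
      (abs_vertexValue_le hσ hκ hG hK hv.2) ht.1 ht.2

theorem abs_globalLift_le (hΩ : IsOpen Ω) {B : ℝ} (hG : ∀ x, |G x| ≤ B) (x : Plane) :
    |M.globalLift G x| ≤ 7 * B := by
  by_cases hx : x ∈ closure Ω
  · obtain ⟨K, hK, w, hw, rfl⟩ := exists_element (M := M) hσ hκ hx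
    rw [globalLift_elementMap hσ hκ hΩ hK hw]
    exact abs_elementLift_le hσ hκ hG hK hw
  · rw [globalLift_of_notMem hσ hκ hx, abs_zero]
    have := (abs_nonneg _).trans (hG x)
    linarith

end SpectralBoundaryLayerMesh
end HpFEM

namespace HpFEM

/-! ### The lifting belongs to the finite element space -/

/-- If `f` is a diffeomorphism near each point of a compact set `C`, and is injective on `C`, then
`u` is Lipschitz on `f(C)` as soon as its pull-back is smooth. -/
theorem exists_lipschitzOnWith_image {E : Type*} [NormedAddCommGroup E] [NormedSpace ℝ E]
    [CompleteSpace E] {f : E → E} {C : Set E} {u q : E → ℝ} (hC : IsCompact C) (hf : InjOn f C)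
    (hd : ∀ w ∈ C, ∃ f' : E ≃L[ℝ] E, HasStrictFDerivAt f (f' : E →L[ℝ] E) w)
    (hq : ContDiff ℝ 1 q) (hu : ∀ w ∈ C, u (f w) = q w) : ∃ A, LipschitzOnWith A u (f '' C) := by
  have hcont : ContinuousOn f C := fun w hw => by
    obtain ⟨f', h⟩ := hd w hw
    exact h.hasFDerivAt.continuousAt.continuousWithinAt
  refine LocallyLipschitzOn.exists_lipschitzOnWith_of_compact (hC.image_of_continuousOn hcont) ?_
  rintro _ ⟨w, hw, rfl⟩
  obtain ⟨f', h⟩ := hd w hw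
  set g := h.localInverse f f' w with hg
  have hgs : HasStrictFDerivAt g (f'.symm : E →L[ℝ] E) (f w) := h.to_localInverse
  have hgw : g (f w) = w := h.localInverse_apply_image
  obtain ⟨A, V, hV, hA⟩ := hgs.exists_lipschitzOnWith
  obtain ⟨B, W, hW, hB⟩ := (hq.contDiffAt (x := w)).exists_lipschitzOnWith
  obtain ⟨N, hN, hNo, hwN⟩ := eventually_nhds_iff.1 h.eventually_left_inverse
  have hcl : IsClosed (f '' (C \ N)) :=
    ((hC.diff hNo).image_of_continuousOn (hcont.mono sdiff_subset)).isClosed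
  have hwn : f w ∈ (f '' (C \ N))ᶜ := by
    rintro ⟨w', ⟨h1, h2⟩, h3⟩
    rw [hf h1 hw h3] at h2
    exact h2 hwN
  have hW' : g ⁻¹' W ∈ 𝓝 (f w) := hgs.hasFDerivAt.continuousAt.preimage_mem_nhds (by rwa [hgw])
  refine ⟨B * A, (V ∩ (g ⁻¹' W) ∩ (f '' (C \ N))ᶜ) ∩ f '' C, ?_, ?_⟩
  · exact inter_mem (mem_nhdsWithin_of_mem_nhds (inter_mem (inter_mem hV hW')
      (hcl.isOpen_compl.mem_nhds hwn))) self_mem_nhdsWithin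
  · have hcomp : LipschitzOnWith (B * A) (q ∘ g) ((V ∩ (g ⁻¹' W) ∩ (f '' (C \ N))ᶜ) ∩ f '' C) :=
      hB.comp (hA.mono fun y hy => hy.1.1.1) fun y hy => hy.1.1.2
    have heq : ∀ y ∈ (V ∩ (g ⁻¹' W) ∩ (f '' (C \ N))ᶜ) ∩ f '' C, u y = (q ∘ g) y := by
      rintro _ ⟨⟨-, h1⟩, w', hw', rfl⟩
      have hN' : w' ∈ N := by
        by_contra hN'
        exact h1 (mem_image_of_mem _ ⟨hw', hN'⟩)
      rw [Function.comp_apply, hu w' hw', hg, hN w' hN']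
    intro y hy y' hy'
    rw [heq y hy, heq y' hy']
    exact hcomp hy hy'

namespace SpectralBoundaryLayerMesh

variable {Ω : Set Plane} {n : ℕ} {T : MacroTriangulation Ω n} {σ κ : ℝ} {L : Fin n → ℕ}
  {M : SpectralBoundaryLayerMesh T σ κ L} (hσ : σ ∈ Ioo (0 : ℝ) 1)
  (hκ : κ ∈ Ioc (0 : ℝ) (1 / 2)) {K : Fin n × PatchElement} {x : Plane} {G v : Plane → ℝ} {p : ℕ}

include hσ hκ

theorem exists_polynomial_on_closedCell (hv : v ∈ M.S p) (hK : K ∈ M.elements) :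
    ∃ q ∈ K.2.shape.polynomials p, ∀ w ∈ K.2.shape.closedCell,
      v (T.elementMap K w) = MvPolynomial.eval (fun i => w i) q := by
  obtain ⟨-, hc, -, h⟩ := hv
  obtain ⟨q, hq, hqv⟩ := h K hK
  refine ⟨q, hq, ?_⟩
  exact Set.EqOn.of_subset_closure (f := fun w => v (T.elementMap K w))
    (g := fun w => MvPolynomial.eval (fun i => w i) q) (s := K.2.shape.cell) hqv
    (hc.comp (continuousOn_elementMap hσ hκ hK) fun w hw => elementMap_mem_closure hσ hκ hK hw)
    (contDiff_eval q).continuous.continuousOn K.2.shape.cell_subset_closedCell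
    K.2.shape.closedCell_subset_closure

/-- The lifting of the trace of a finite element function is a polynomial on each element. -/
theorem exists_elementLift_polynomial (hΩ : IsOpen Ω) (hp : 1 ≤ p) (hv : v ∈ M.S p)
    (hG : ∀ x ∈ frontier M.Ω₀, G x = v x) (hK : K ∈ M.elements) :
    ∃ q ∈ K.2.shape.polynomials p, ∀ w ∈ K.2.shape.closedCell,
      M.elementLift G K w = MvPolynomial.eval (fun i => w i) q := by
  refine Shape.exists_lift_polynomial hp (fun e he => edgeValue_endpoints hσ hκ hΩ hK he) ?_
  intro e he
  by_cases hsub : T.elementMap K '' edgeSet e ⊆ frontier M.Ω₀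
  · obtain ⟨q, hq, hqv⟩ := exists_polynomial_on_closedCell hσ hκ hv hK
    have hdir : K.2.shape = .triangle ∨ (e.2 - e.1) 0 = 0 ∨ (e.2 - e.1) 1 = 0 := by
      cases hs : K.2.shape with
      | triangle => left; rfl
      | square =>
        right
        rw [hs] at he
        simp only [Shape.edges, List.mem_cons, List.not_mem_nil, or_false] at he
        rcases he with rfl | rfl | rfl | rfl <;> simp
    obtain ⟨P, hP, hPe⟩ := exists_polynomial_on_line hq e.1 (e.2 - e.1) hdir
    refine ⟨P, hP, fun t ht => ?_⟩
    have hmem : (AffineMap.lineMap e.1 e.2 t : Plane) ∈ edgeSet e := mem_edgeSet.2 ⟨t, ht, rfl⟩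
    rw [edgeValue, if_pos hsub, hG _ (hsub (mem_image_of_mem _ hmem)),
      hqv _ (Shape.edgeSet_subset he hmem), hPe]
    simp only [AffineMap.lineMap_apply, vsub_eq_sub, vadd_eq_add, add_comm]
  · refine ⟨Polynomial.C (vertexValue T κ G K e.1) +
      Polynomial.C (vertexValue T κ G K e.2 - vertexValue T κ G K e.1) * Polynomial.X, ?_, ?_⟩
    · refine (Polynomial.natDegree_add_le _ _).trans (max_le (by simp) ?_)
      exact (Polynomial.natDegree_C_mul_le _ _).trans (Polynomial.natDegree_X_le.trans hp)
    · intro t _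
      rw [edgeValue, if_neg hsub]
      simp only [Polynomial.eval_add, Polynomial.eval_mul, Polynomial.eval_C, Polynomial.eval_X]
      ring

/-- The interior of an element is mapped to the interior of the reference square. -/
theorem map_mem_square_cell (hK : K ∈ M.elements) {w : Plane} (hw : w ∈ K.2.shape.cell) :
    K.2.map w ∈ Shape.square.cell := by
  have hwc := K.2.shape.cell_subset_closedCell hw
  have hin := ((M.isPatternElement hσ hκ hK).nondegenerate hκ).linear_injective
  have hs := (K.2.hasStrictFDerivAt_map w).map_nhds_eq_of_surj
    (LinearMap.range_eq_top.2 (LinearMap.injective_iff_surjective.1 hin))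
  have hnh : Shape.square.closedCell ∈ 𝓝 (K.2.map w) := by
    rw [← hs]
    exact mem_map.2 (mem_of_superset (K.2.shape.isOpen_cell.mem_nhds hw) fun w' hw' =>
      map_mem_square hσ hκ hK (K.2.shape.cell_subset_closedCell hw'))
  by_contra hnot
  -- moving away from the center of the square leaves the square
  have hcont : Tendsto (fun t : ℝ => AffineMap.lineMap (!₂[1 / 2, 1 / 2] : Plane) (K.2.map w) t)
      (𝓝[>] 1) (𝓝 (K.2.map w)) := by
    have : Continuous (fun t : ℝ => AffineMap.lineMap (!₂[1 / 2, 1 / 2] : Plane) (K.2.map w) t) :=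
      AffineMap.lineMap_continuous
    have h := this.tendsto 1
    rw [AffineMap.lineMap_apply_one] at h
    exact h.mono_left nhdsWithin_le_nhds
  obtain ⟨t, ht, ht1⟩ := ((hcont.eventually hnh).and self_mem_nhdsWithin).exists
  replace ht1 : 1 < t := ht1
  replace ht : AffineMap.lineMap (!₂[1 / 2, 1 / 2] : Plane) (K.2.map w) t ∈
    Shape.square.closedCell := ht
  simp only [Shape.cell, Shape.closedCell, mem_ofPred_eq, lineMap_apply_coord] at ht hnot
  simp at ht
  obtain ⟨h1, h2, h3, h4⟩ := ht
  refine hnot ⟨?_, ?_, ?_, ?_⟩ <;> by_contra! hcon <;> nlinarith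

omit hσ hκ in
theorem nodalValue_eq_zero {i : Fin n} {z : Plane} (h0 : G (T.F i !₂[0, 0]) = 0)
    (hz : 0 ≤ z 0 ∧ 0 ≤ z 1) (hGz : G (T.F i z) = 0)
    (h : (z 0 = 0 ∧ z 1 = 0) ∨ (z 1 = 0 ∧ G (T.F i !₂[κ, 0]) = 0) ∨
      (z 0 = 0 ∧ G (T.F i !₂[0, κ]) = 0)) : nodalValue T κ G i z = 0 := by
  unfold nodalValue
  split_ifs
  · unfold cornerInterpolant
    split_ifs with h2
    · rcases h with ⟨h, h'⟩ | ⟨h, h'⟩ | ⟨h, h'⟩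
      · simp [h, h', h0]
      · simp [h, h', h0]
      · have : z 1 = 0 := le_antisymm (by linarith) hz.2
        simp [h, this, h0]
    · rcases h with ⟨h, h'⟩ | ⟨h, h'⟩ | ⟨h, h'⟩
      · simp [h, h', h0]
      · exact absurd (by rw [h]; exact hz.1) h2
      · simp [h, h', h0]
  · exact hGz

/-- If a face `Z` of the reference square is mapped to the boundary of `Ω`, then the lifting
vanishes on its image. -/
theorem elementLift_eq_zero_of_face (hΩ : IsOpen Ω) (hG : ∀ x ∉ frontier M.Ω₀, G x = 0)
    (hK : K ∈ M.elements) {Z : Set Plane} (hZ0 : !₂[0, 0] ∈ Z)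
    (hZf : ∀ z ∈ Z, z ∈ Shape.square.closedCell → T.F K.1 z ∈ frontier Ω)
    (hZ : ∀ z ∈ Z, (z 0 = 0 ∧ z 1 = 0) ∨ (z 1 = 0 ∧ !₂[κ, 0] ∈ Z) ∨ (z 0 = 0 ∧ !₂[0, κ] ∈ Z))
    (hZe : ∀ a ∈ Shape.square.closedCell, ∀ b ∈ Shape.square.closedCell, ∀ t ∈ Ioo (0 : ℝ) 1,
      AffineMap.lineMap a b t ∈ Z → a ∈ Z ∧ b ∈ Z)
    {w : Plane} (hw : w ∈ K.2.shape.closedCell) (hwZ : K.2.map w ∈ Z) :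
    M.elementLift G K w = 0 := by
  have hΩ₀ := frontier_Ω₀_subset (M := M) hσ hκ hΩ
  have hnot : ∀ y ∈ frontier Ω, y ∉ frontier M.Ω₀ := by
    intro y hy hy'
    rw [hΩ.frontier_eq] at hy
    exact hy.2 (hΩ₀ hy')
  have k0 := hκ.1.le
  have k1 : κ ≤ 1 := by linarith [hκ.2]
  have m0 : (!₂[0, 0] : Plane) ∈ Shape.square.closedCell := by simp [Shape.closedCell]
  have m1 : (!₂[κ, 0] : Plane) ∈ Shape.square.closedCell := by
    simp only [Shape.closedCell, mem_ofPred_eq]; simp [k0, k1]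
  have m2 : (!₂[0, κ] : Plane) ∈ Shape.square.closedCell := by
    simp only [Shape.closedCell, mem_ofPred_eq]; simp [k0, k1]
  have hGz : ∀ z ∈ Z, z ∈ Shape.square.closedCell → G (T.F K.1 z) = 0 := fun z hz hzs =>
    hG _ (hnot _ (hZf z hz hzs))
  have hnod : ∀ z ∈ Z, z ∈ Shape.square.closedCell → nodalValue T κ G K.1 z = 0 := by
    intro z hz hzs
    refine nodalValue_eq_zero (hGz _ hZ0 m0) ⟨hzs.1, hzs.2.2.1⟩ (hGz z hz hzs) ?_
    exact (hZ z hz).imp id (Or.imp (And.imp id fun h => hGz _ h m1) (And.imp id fun h => hGz _ h m2))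
  have hws := map_mem_square hσ hκ hK hw
  have hwc : w ∉ K.2.shape.cell := by
    intro hwc
    obtain ⟨c0, -, c1, -⟩ := map_mem_square_cell hσ hκ hK hwc
    rcases hZ _ hwZ with h | h | h <;> linarith [h.1]
  by_cases hv : w ∈ K.2.shape.vertices
  · rw [elementLift_vertex hσ hκ hΩ hK hv]
    exact hnod _ hwZ hws
  obtain ⟨e, he, hwe⟩ := Shape.exists_edge_of_notMem_cell hw hwc
  have hev := Shape.edges_mem_vertices he
  have hsub : ¬ T.elementMap K '' edgeSet e ⊆ frontier M.Ω₀ := fun hsub =>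
    hnot _ (hZf _ hwZ hws) (hsub (mem_image_of_mem _ hwe))
  obtain ⟨t, ht, rfl⟩ := mem_edgeSet.1 hwe
  have ht0 : t ≠ 0 := by
    rintro rfl
    rw [AffineMap.lineMap_apply_zero] at hv
    exact hv hev.1
  have ht1 : t ≠ 1 := by
    rintro rfl
    rw [AffineMap.lineMap_apply_one] at hv
    exact hv hev.2
  rw [PatchElement.map_lineMap] at hwZ
  have s1 := map_mem_square hσ hκ hK (Shape.vertices_subset hev.1).1
  have s2 := map_mem_square hσ hκ hK (Shape.vertices_subset hev.2).1
  obtain ⟨z1, z2⟩ := hZe _ s1 _ s2 t ⟨lt_of_le_of_ne ht.1 ht0.symm, lt_of_le_of_ne ht.2 ht1⟩ hwZ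
  rw [elementLift_lineMap hσ hκ hΩ hK he, edgeValue, if_neg hsub, vertexValue, vertexValue,
    hnod _ z1 s1, hnod _ z2 s2]
  ring

theorem elementLift_eq_zero_of_mem_frontier (hΩ : IsOpen Ω) (hG : ∀ x ∉ frontier M.Ω₀, G x = 0)
    (hK : K ∈ M.elements) {w : Plane} (hw : w ∈ K.2.shape.closedCell)
    (hx : T.elementMap K w ∈ frontier Ω) : M.elementLift G K w = 0 := by
  have hz := map_mem_square hσ hκ hK hw
  have hb : T.F K.1 (K.2.map w) ∈ T.boundaryPart K.1 := ⟨mem_image_of_mem _ hz, hx⟩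
  have s0 : (!₂[0, 0] : Plane) ∈ Shape.square.closedCell := by simp [Shape.closedCell]
  have s1 : segment ℝ (!₂[0, 0] : Plane) !₂[1, 0] ⊆ Shape.square.closedCell :=
    Shape.square.convex_closedCell.segment_subset s0 (by simp [Shape.closedCell])
  have s2 : segment ℝ (!₂[0, 0] : Plane) !₂[0, 1] ⊆ Shape.square.closedCell :=
    Shape.square.convex_closedCell.segment_subset s0 (by simp [Shape.closedCell])
  have b1 : ∀ z ∈ Shape.square.closedCell,
      (z ∈ segment ℝ (!₂[0, 0] : Plane) !₂[1, 0] ↔ z 1 = 0) := by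
    intro z hz
    rw [show segment ℝ (!₂[0, 0] : Plane) !₂[1, 0] = edgeSet (!₂[0, 0], !₂[1, 0]) from rfl,
      mem_edgeSet]
    constructor
    · rintro ⟨t, -, rfl⟩; simp [lineMap_apply_coord]
    · intro h
      exact ⟨z 0, ⟨hz.1, hz.2.1⟩, plane_ext (by simp [lineMap_apply_coord])
        (by simp [lineMap_apply_coord, h])⟩
  have b2 : ∀ z ∈ Shape.square.closedCell,
      (z ∈ segment ℝ (!₂[0, 0] : Plane) !₂[0, 1] ↔ z 0 = 0) := by
    intro z hz
    rw [show segment ℝ (!₂[0, 0] : Plane) !₂[0, 1] = edgeSet (!₂[0, 0], !₂[0, 1]) from rfl,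
      mem_edgeSet]
    constructor
    · rintro ⟨t, -, rfl⟩; simp [lineMap_apply_coord]
    · intro h
      exact ⟨z 1, hz.2.2, plane_ext (by simp [lineMap_apply_coord, h])
        (by simp [lineMap_apply_coord])⟩
  have ext : ∀ (i : Fin 2) {a b : Plane} {t : ℝ}, a ∈ Shape.square.closedCell →
      b ∈ Shape.square.closedCell → t ∈ Ioo (0 : ℝ) 1 → (AffineMap.lineMap a b t : Plane) i = 0 →
      a i = 0 ∧ b i = 0 := by
    intro i a b t ha hb ht h
    rw [lineMap_apply_coord] at h
    have ha' : 0 ≤ a i := by fin_cases i <;> [exact ha.1; exact ha.2.2.1]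
    have hb' : 0 ≤ b i := by fin_cases i <;> [exact hb.1; exact hb.2.2.1]
    have h1 : 0 ≤ (1 - t) * a i := mul_nonneg (by linarith [ht.2]) ha'
    have h2 : 0 ≤ t * b i := mul_nonneg ht.1.le hb'
    have h3 : (1 - t) * a i = 0 := by linarith
    have h4 : t * b i = 0 := by linarith
    exact ⟨(mul_eq_zero.1 h3).resolve_left (by linarith [ht.2]),
      (mul_eq_zero.1 h4).resolve_left ht.1.ne'⟩
  rcases M.boundary K.1 with h | ⟨h, hP⟩ | ⟨h, hP⟩ | ⟨h, hP⟩
  · rw [h] at hb; exact absurd hb (notMem_empty _)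
  · rw [h, mem_singleton_iff] at hb
    refine elementLift_eq_zero_of_face hσ hκ hΩ hG hK (Z := {z | z 0 = 0 ∧ z 1 = 0})
      (by simp) ?_ (fun z hz => Or.inl hz) ?_ hw (by rw [T.injOn K.1 hz s0 hb]; simp)
    · rintro z ⟨h0, h1⟩ -
      have : z = !₂[0, 0] := plane_ext (by simpa) (by simpa)
      rw [this]
      exact (h.ge (mem_singleton _)).2
    · rintro a ha b hb t ht ⟨h0, h1⟩
      have e0 := ext 0 ha hb ht h0
      have e1 := ext 1 ha hb ht h1
      exact ⟨⟨e0.1, e1.1⟩, e0.2, e1.2⟩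
  · rw [h] at hb
    refine elementLift_eq_zero_of_face hσ hκ hΩ hG hK (Z := {z | z 1 = 0})
      (by simp) ?_ (fun z hz => Or.inr (Or.inl ⟨hz, by simp⟩)) ?_ hw
      ((b1 _ hz).1 ((T.injOn K.1).mem_image_iff s1 hz |>.1 hb))
    · intro z h1 hzs
      exact (h.ge (mem_image_of_mem _ ((b1 z hzs).2 h1))).2
    · intro a ha b hb t ht h1
      exact ext 1 ha hb ht h1
  · rw [h] at hb
    refine elementLift_eq_zero_of_face hσ hκ hΩ hG hK (Z := {z | z 1 = 0 ∨ z 0 = 0})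
      (by simp) ?_ (fun z hz => Or.inr (hz.imp (fun h => ⟨h, by simp⟩) fun h => ⟨h, by simp⟩)) ?_ hw
      (((T.injOn K.1).mem_image_iff (union_subset s1 s2) hz |>.1 hb).imp (b1 _ hz).1 (b2 _ hz).1)
    · intro z h1 hzs
      exact (h.ge (mem_image_of_mem _ (h1.imp (b1 z hzs).2 (b2 z hzs).2))).2
    · intro a ha b hb t ht h1
      rcases h1 with h1 | h1
      · have := ext 1 ha hb ht h1
        exact ⟨Or.inl this.1, Or.inl this.2⟩
      · have := ext 0 ha hb ht h1
        exact ⟨Or.inr this.1, Or.inr this.2⟩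

theorem globalLift_eq_zero (hΩ : IsOpen Ω) (hG : ∀ x ∉ frontier M.Ω₀, G x = 0) (hx : x ∉ Ω) :
    M.globalLift G x = 0 := by
  by_cases hc : x ∈ closure Ω
  · obtain ⟨K, hK, w, hw, rfl⟩ := exists_element (M := M) hσ hκ hc
    rw [globalLift_elementMap hσ hκ hΩ hK hw]
    exact elementLift_eq_zero_of_mem_frontier hσ hκ hΩ hG hK hw
      (by rw [hΩ.frontier_eq]; exact ⟨hc, hx⟩)
  · exact globalLift_of_notMem hσ hκ hc

theorem exists_lipschitzOnWith_globalLift (hΩ : IsOpen Ω) (hp : 1 ≤ p) (hv : v ∈ M.S p)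
    (hG : ∀ x ∈ frontier M.Ω₀, G x = v x) (hK : K ∈ M.elements) :
    ∃ A, LipschitzOnWith A (M.globalLift G) (closedElement T K) := by
  obtain ⟨q, -, hq⟩ := exists_elementLift_polynomial hσ hκ hΩ hp hv hG hK
  refine exists_lipschitzOnWith_image (q := fun z => MvPolynomial.eval (fun i => z i) q)
    K.2.shape.isCompact_closedCell (injOn_elementMap hσ hκ hK) ?_
    ((contDiff_eval q).of_le (by simp)) ?_
  · intro w hw
    have hinj := derivative_injective hσ hκ hK hw
    refine ⟨ContinuousLinearEquiv.ofBijective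
      ((fderiv ℝ (T.F K.1) (K.2.map w)).comp K.2.linear) (LinearMap.ker_eq_bot.2 hinj)
      (LinearMap.range_eq_top.2 (LinearMap.injective_iff_surjective.1 hinj)), ?_⟩
    rw [ContinuousLinearEquiv.coe_ofBijective]
    exact hasStrictFDerivAt_elementMap hσ hκ hK hw
  · intro w hw
    rw [globalLift_elementMap hσ hκ hΩ hK hw, hq w hw]

theorem exists_lipschitzWith_globalLift (hΩ : IsOpen Ω) (hp : 1 ≤ p) (hv : v ∈ M.S p)
    (hG : ∀ x ∈ frontier M.Ω₀, G x = v x) (hG0 : ∀ x ∉ frontier M.Ω₀, G x = 0) :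
    ∃ A, LipschitzWith A (M.globalLift G) := by
  have : Finite M.elements := M.finite_elements.to_subtype
  choose A hA using fun K : M.elements =>
    exists_lipschitzOnWith_globalLift hσ hκ hΩ hp hv hG K.2
  obtain ⟨B, hB⟩ := (finite_range A).bddAbove
  refine ⟨B, lipschitzWith_of_finite_closed_cover (ι := Option M.elements)
    (S := fun k => k.elim Ωᶜ fun K => closedElement T K) ?_ ?_ ?_⟩
  · rintro (_ | K)
    · exact hΩ.isClosed_compl
    · exact (isCompact_image_closedCell hσ hκ K.2).isClosed
  · refine eq_univ_of_forall fun x => mem_iUnion.2 ?_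
    by_cases hx : x ∈ Ω
    · obtain ⟨K, hK, w, hw, rfl⟩ := exists_element (M := M) hσ hκ (subset_closure hx)
      exact ⟨some ⟨K, hK⟩, mem_image_of_mem _ hw⟩
    · exact ⟨none, hx⟩
  · rintro (_ | K)
    · intro x hx y hy
      rw [globalLift_eq_zero hσ hκ hΩ hG0 hx, globalLift_eq_zero hσ hκ hΩ hG0 hy]
      simp
    · exact (hA K).weaken (hB (mem_range_self K))

theorem globalLift_mem (hΩ : IsOpen Ω) (hb : Bornology.IsBounded Ω) (hp : 1 ≤ p) (hv : v ∈ M.S p)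
    (hG : ∀ x ∈ frontier M.Ω₀, G x = v x) (hG0 : ∀ x ∉ frontier M.Ω₀, G x = 0) :
    M.globalLift G ∈ M.S₀ p := by
  obtain ⟨A, hA⟩ := exists_lipschitzWith_globalLift hσ hκ hΩ hp hv hG hG0
  have h := lipschitz_mem_sobolev hΩ hb hA fun x hx => globalLift_eq_zero hσ hκ hΩ hG0 hx
  refine ⟨⟨⟨_, h.1⟩, hA.continuous.continuousOn, fun x hx => globalLift_of_notMem hσ hκ hx,
    fun K hK => ?_⟩, ⟨_, h⟩⟩
  obtain ⟨q, hq, hqe⟩ := exists_elementLift_polynomial hσ hκ hΩ hp hv hG hK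
  refine ⟨q, hq, fun w hw => ?_⟩
  have hwc := K.2.shape.cell_subset_closedCell hw
  rw [globalLift_elementMap hσ hκ hΩ hK hwc, hqe w hwc]

end SpectralBoundaryLayerMesh
end HpFEM

namespace HpFEM

/-! ### The gradient of the lifting -/

theorem hasFDerivAt_bilinear (a α β γ : ℝ) (w : Plane) :
    ∃ D : Plane →L[ℝ] ℝ, HasFDerivAt (fun z : Plane => a + α * z 0 + β * z 1 + γ * (z 0 * z 1)) D w ∧
      ∀ w' : Plane, D w' = α * w' 0 + β * w' 1 + γ * (w 0 * w' 1 + w 1 * w' 0) := by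
  have h0 : HasFDerivAt (fun z : Plane => z 0) (EuclideanSpace.proj (𝕜 := ℝ) (0 : Fin 2)) w :=
    (EuclideanSpace.proj (𝕜 := ℝ) (0 : Fin 2)).hasFDerivAt
  have h1 : HasFDerivAt (fun z : Plane => z 1) (EuclideanSpace.proj (𝕜 := ℝ) (1 : Fin 2)) w :=
    (EuclideanSpace.proj (𝕜 := ℝ) (1 : Fin 2)).hasFDerivAt
  refine ⟨_, ((((hasFDerivAt_const a w).add (h0.const_mul α)).add (h1.const_mul β)).add
    ((h0.mul h1).const_mul γ)), ?_⟩
  intro w'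
  simp [smul_eq_mul]
  ring

theorem abs_coord_le_norm (w : Plane) (i : Fin 2) : |w i| ≤ ‖w‖ :=
  PiLp.norm_apply_le w i

namespace SpectralBoundaryLayerMesh

variable {Ω : Set Plane} {n : ℕ} {T : MacroTriangulation Ω n} {σ κ : ℝ} {L : Fin n → ℕ}
  {M : SpectralBoundaryLayerMesh T σ κ L} (hσ : σ ∈ Ioo (0 : ℝ) 1)
  (hκ : κ ∈ Ioc (0 : ℝ) (1 / 2)) {K : Fin n × PatchElement} {x : Plane} {G v : Plane → ℝ} {p : ℕ}

theorem elementLift_triangle (hs : K.2.shape = .triangle)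
    (hb : ∀ e ∈ K.2.shape.edges, ∀ t, M.edgeValue G K e t =
      (1 - t) * vertexValue T κ G K e.1 + t * vertexValue T κ G K e.2) (w : Plane) :
    M.elementLift G K w = (1 - w 0 - w 1) * vertexValue T κ G K !₂[0, 0] +
      w 0 * vertexValue T κ G K !₂[1, 0] + w 1 * vertexValue T κ G K !₂[0, 1] := by
  rw [hs] at hb
  simp only [Shape.edges, List.forall_mem_cons] at hb
  obtain ⟨h1, h2, h3, -⟩ := hb
  unfold elementLift
  rw [hs]
  simp only [Shape.lift, bubble]
  rw [h1, h2, h3]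
  ring

theorem elementLift_square (hs : K.2.shape = .square)
    (hb : ∀ e ∈ K.2.shape.edges, ∀ t, M.edgeValue G K e t =
      (1 - t) * vertexValue T κ G K e.1 + t * vertexValue T κ G K e.2) (w : Plane) :
    M.elementLift G K w = (1 - w 0) * (1 - w 1) * vertexValue T κ G K !₂[0, 0] +
      w 0 * (1 - w 1) * vertexValue T κ G K !₂[1, 0] +
      (1 - w 0) * w 1 * vertexValue T κ G K !₂[0, 1] +
      w 0 * w 1 * vertexValue T κ G K !₂[1, 1] := by
  rw [hs] at hb
  simp only [Shape.edges, List.forall_mem_cons] at hb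
  obtain ⟨h1, h2, h3, h4, -⟩ := hb
  unfold elementLift
  rw [hs]
  simp only [Shape.lift]
  rw [h1, h2, h3, h4]
  ring

/-- On a triangle of the corner refinement the lifting is the interpolant on the corner square, an
affine function with gradient of size `1 / κ`. -/
theorem exists_hasFDerivAt_of_triangle (hκ : 0 < κ) {B : ℝ} (hG : ∀ x, |G x| ≤ B)
    (hs : K.2.shape = .triangle)
    (hb : ∀ e ∈ K.2.shape.edges, ∀ t, M.edgeValue G K e t =
      (1 - t) * vertexValue T κ G K e.1 + t * vertexValue T κ G K e.2)
    (hv : ∀ v ∈ K.2.shape.vertices, K.2.map v 0 ≤ κ ∧ K.2.map v 1 ≤ κ)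
    (hd : (∀ v ∈ K.2.shape.vertices, K.2.map v 1 ≤ K.2.map v 0) ∨
      ∀ v ∈ K.2.shape.vertices, K.2.map v 0 ≤ K.2.map v 1) (w : Plane) :
    ∃ D : Plane →L[ℝ] ℝ, HasFDerivAt (M.elementLift G K) D w ∧
      ∀ w', |D w'| ≤ 4 * B / κ * ‖K.2.linear w'‖ := by
  obtain ⟨a, α, β, hα, hβ, hval⟩ : ∃ a α β : ℝ, |α| ≤ 2 * B / κ ∧ |β| ≤ 2 * B / κ ∧
      ∀ v ∈ K.2.shape.vertices,
        vertexValue T κ G K v = a + α * K.2.map v 0 + β * K.2.map v 1 := by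
    have hdiff : ∀ x y, |(G x - G y) / κ| ≤ 2 * B / κ := by
      intro x y
      rw [abs_div, abs_of_pos hκ]
      gcongr
      exact (abs_sub _ _).trans (by linarith [hG x, hG y])
    rcases hd with hd | hd
    · refine ⟨G (T.F K.1 !₂[0, 0]), (G (T.F K.1 !₂[κ, 0]) - G (T.F K.1 !₂[0, 0])) / κ,
        (G (T.F K.1 !₂[κ, κ]) - G (T.F K.1 !₂[κ, 0])) / κ, hdiff _ _, hdiff _ _, fun v hvv => ?_⟩
      rw [vertexValue, nodalValue, if_pos (hv v hvv), cornerInterpolant, if_pos (hd v hvv)]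
      ring
    · refine ⟨G (T.F K.1 !₂[0, 0]), (G (T.F K.1 !₂[κ, κ]) - G (T.F K.1 !₂[0, κ])) / κ,
        (G (T.F K.1 !₂[0, κ]) - G (T.F K.1 !₂[0, 0])) / κ, hdiff _ _, hdiff _ _, fun v hvv => ?_⟩
      rw [vertexValue, nodalValue, if_pos (hv v hvv), cornerInterpolant]
      split_ifs with h
      · rw [le_antisymm h (hd v hvv)]; ring
      · ring
  have hfun : M.elementLift G K = fun w => (a + α * K.2.origin 0 + β * K.2.origin 1) +
      (α * K.2.dirX 0 + β * K.2.dirX 1) * w 0 + (α * K.2.dirY 0 + β * K.2.dirY 1) * w 1 +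
        0 * (w 0 * w 1) := by
    funext w
    rw [elementLift_triangle hs hb]
    rw [hs] at hval
    simp only [Shape.vertices, List.forall_mem_cons, PatchElement.map_apply] at hval
    obtain ⟨h1, h2, h3, -⟩ := hval
    rw [h1, h2, h3]
    simp
    ring
  rw [hfun]
  obtain ⟨D, hD, hD'⟩ := hasFDerivAt_bilinear (a + α * K.2.origin 0 + β * K.2.origin 1)
    (α * K.2.dirX 0 + β * K.2.dirX 1) (α * K.2.dirY 0 + β * K.2.dirY 1) 0 w
  refine ⟨D, hD, fun w' => ?_⟩
  have e : D w' = α * K.2.linear w' 0 + β * K.2.linear w' 1 := by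
    rw [hD', PatchElement.linear_apply]
    simp
    ring
  have h0 := abs_coord_le_norm (K.2.linear w') 0
  have h1 := abs_coord_le_norm (K.2.linear w') 1
  have hB : 0 ≤ 2 * B / κ := (abs_nonneg _).trans hα
  calc |D w'| ≤ |α| * |K.2.linear w' 0| + |β| * |K.2.linear w' 1| := by
        rw [e, ← abs_mul, ← abs_mul]; exact abs_add_le _ _
    _ ≤ 2 * B / κ * ‖K.2.linear w'‖ + 2 * B / κ * ‖K.2.linear w'‖ := by gcongr
    _ = 4 * B / κ * ‖K.2.linear w'‖ := by ring

/-- On the innermost square of the corner refinement the lifting is bilinear, with gradient of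
size `1 / κ`, since its vertex values interpolate values at distance `κ`. -/
theorem exists_hasFDerivAt_of_square (hκ : 0 < κ) {B : ℝ} (hG : ∀ x, |G x| ≤ B) {h : ℝ}
    (h0 : 0 < h) (hle : h ≤ κ) (hK : K.2 = rectangle .corner 0 h 0 h)
    (hb : ∀ e ∈ K.2.shape.edges, ∀ t, M.edgeValue G K e t =
      (1 - t) * vertexValue T κ G K e.1 + t * vertexValue T κ G K e.2)
    {w : Plane} (hw : w ∈ Shape.square.closedCell) :
    ∃ D : Plane →L[ℝ] ℝ, HasFDerivAt (M.elementLift G K) D w ∧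
      ∀ w', |D w'| ≤ 12 * B / κ * ‖K.2.linear w'‖ := by
  have hs : K.2.shape = .square := by rw [hK]; rfl
  have hmap : ∀ v : Plane, K.2.map v = !₂[h * v 0, h * v 1] := by
    intro v
    rw [hK]
    apply plane_ext <;> simp [PatchElement.map_apply, rectangle, mul_comm]
  set a := G (T.F K.1 !₂[0, 0]) with ha
  set b := G (T.F K.1 !₂[κ, 0]) with hbb
  set c := G (T.F K.1 !₂[κ, κ]) with hc
  set d := G (T.F K.1 !₂[0, κ]) with hd
  have hv : ∀ x y : ℝ, h * x ≤ κ → h * y ≤ κ →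
      vertexValue T κ G K !₂[x, y] = cornerInterpolant κ a b c d !₂[h * x, h * y] := by
    intro x y hx hy
    rw [vertexValue, hmap, nodalValue, if_pos (by simpa using ⟨hx, hy⟩)]
    simp [ha, hbb, hc, hd]
  have hfun : M.elementLift G K = fun w => a + ((b - a) / κ * h) * w 0 + ((d - a) / κ * h) * w 1 +
      ((a + c - b - d) / κ * h) * (w 0 * w 1) := by
    funext w
    rw [elementLift_square hs hb, hv 0 0 (by simpa using hκ.le) (by simpa using hκ.le),
      hv 1 0 (by simpa) (by simpa using hκ.le), hv 1 1 (by simpa) (by simpa),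
      hv 0 1 (by simpa using hκ.le) (by simpa)]
    simp [cornerInterpolant, h0.le, not_le.2 h0]
    ring
  rw [hfun]
  obtain ⟨D, hD, hD'⟩ := hasFDerivAt_bilinear a ((b - a) / κ * h) ((d - a) / κ * h)
    ((a + c - b - d) / κ * h) w
  refine ⟨D, hD, fun w' => ?_⟩
  have hlin : K.2.linear w' = h • w' := by
    rw [PatchElement.linear_apply, hK]
    apply plane_ext <;> simp [rectangle, mul_comm]
  have hB : 0 ≤ B := (abs_nonneg _).trans (hG 0)
  have hquot : ∀ {t C : ℝ}, |t| ≤ C → |t / κ| ≤ C / κ := by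
    intro t C ht
    rw [abs_div, abs_of_pos hκ]; gcongr
  have h1 : |(b - a) / κ| ≤ 2 * B / κ :=
    hquot ((abs_sub _ _).trans (by linarith [hG (T.F K.1 !₂[κ, 0]), hG (T.F K.1 !₂[0, 0])]))
  have h2 : |(d - a) / κ| ≤ 2 * B / κ :=
    hquot ((abs_sub _ _).trans (by linarith [hG (T.F K.1 !₂[0, κ]), hG (T.F K.1 !₂[0, 0])]))
  have h3 : |(a + c - b - d) / κ| ≤ 4 * B / κ := by
    refine hquot ?_
    have := abs_le.1 (hG (T.F K.1 !₂[0, 0]))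
    have := abs_le.1 (hG (T.F K.1 !₂[κ, 0]))
    have := abs_le.1 (hG (T.F K.1 !₂[κ, κ]))
    have := abs_le.1 (hG (T.F K.1 !₂[0, κ]))
    rw [abs_le]
    constructor <;> linarith
  have n0 := abs_coord_le_norm w' 0
  have n1 := abs_coord_le_norm w' 1
  have hw0 : |w 0| ≤ 1 := abs_le.2 ⟨by linarith [hw.1], hw.2.1⟩
  have hw1 : |w 1| ≤ 1 := abs_le.2 ⟨by linarith [hw.2.2.1], hw.2.2.2⟩
  have e : D w' = h * ((b - a) / κ * w' 0 + (d - a) / κ * w' 1 +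
      (a + c - b - d) / κ * (w 0 * w' 1 + w 1 * w' 0)) := by rw [hD']; ring
  have h4 : |w 0 * w' 1 + w 1 * w' 0| ≤ 1 * ‖w'‖ + 1 * ‖w'‖ := by
    refine (abs_add_le _ _).trans ?_
    rw [abs_mul, abs_mul]
    gcongr
  rw [e, hlin, norm_smul, abs_mul, Real.norm_eq_abs]
  calc |h| * |(b - a) / κ * w' 0 + (d - a) / κ * w' 1 +
        (a + c - b - d) / κ * (w 0 * w' 1 + w 1 * w' 0)|
      ≤ |h| * (2 * B / κ * ‖w'‖ + 2 * B / κ * ‖w'‖ + 4 * B / κ * (1 * ‖w'‖ + 1 * ‖w'‖)) := by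
        gcongr
        refine (abs_add_le _ _).trans (add_le_add ((abs_add_le _ _).trans (add_le_add ?_ ?_)) ?_) <;>
          rw [abs_mul] <;> gcongr
    _ = 12 * B / κ * (|h| * ‖w'‖) := by ring

include hσ hκ

/-- The gradient of the lifting on an element that is not large. -/
theorem exists_hasFDerivAt_elementLift (hΩ : IsOpen Ω) (hp : 1 ≤ p) (hv : v ∈ M.S p)
    (hGv : ∀ x ∈ frontier M.Ω₀, G x = v x) {B : ℝ} (hG : ∀ x, |G x| ≤ B) (hK : K ∈ M.elements)
    (hk : K.2.kind ≠ .large) {w : Plane} (hw : w ∈ K.2.shape.cell) :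
    ∃ D : Plane →L[ℝ] ℝ, HasFDerivAt (M.elementLift G K) D w ∧
      ∀ w', |D w'| ≤ 224 * (p : ℝ) ^ 2 * B / κ * ‖K.2.linear w'‖ := by
  have hB : 0 ≤ B := (abs_nonneg _).trans (hG 0)
  have k0 := hκ.1
  have hp1 : (1 : ℝ) ≤ (p : ℝ) ^ 2 := one_le_pow₀ (by exact_mod_cast hp)
  have hmono : ∀ {c N : ℝ}, c ≤ 224 → 0 ≤ N → c * B / κ * N ≤ 224 * (p : ℝ) ^ 2 * B / κ * N := by
    intro c N hc hN
    gcongr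
    nlinarith
  rcases (M.isPatternElement hσ hκ hK).diagonal_or_corner hκ hk with
    ⟨a, b, ha, hb, hX, hY⟩ | ⟨hL, hc, hcase⟩
  · obtain ⟨q, hq, hqe⟩ := exists_elementLift_polynomial hσ hκ hΩ hp hv hGv hK
    have heq : M.elementLift G K =ᶠ[𝓝 w] fun z => MvPolynomial.eval (fun i => z i) q :=
      eventually_of_mem (K.2.shape.isOpen_cell.mem_nhds hw) fun z hz =>
        hqe z (K.2.shape.cell_subset_closedCell hz)
    have hd := ((contDiff_eval q).differentiable (by simp)) w
    refine ⟨_, hd.hasFDerivAt.congr_of_eventuallyEq heq, fun w' => ?_⟩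
    have hM := norm_fderiv_eval_le (B := 7 * B) hq
      (fun z hz => by rw [← hqe z hz]; exact abs_elementLift_le hσ hκ hG hK hz) hw
    have hnorm : κ * ‖w'‖ ≤ ‖K.2.linear w'‖ := by
      have hlin : K.2.linear w' = !₂[a * w' 0, b * w' 1] := by
        rw [PatchElement.linear_apply, hX, hY]
        apply plane_ext <;> simp [mul_comm]
      rw [hlin, EuclideanSpace.norm_eq, EuclideanSpace.norm_eq, ← Real.sqrt_sq k0.le,
        ← Real.sqrt_mul (sq_nonneg κ)]
      apply Real.sqrt_le_sqrt
      simp only [Fin.sum_univ_two, Real.norm_eq_abs, sq_abs]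
      simp only [Matrix.cons_val_zero, Matrix.cons_val_one]
      have h1 : κ ^ 2 ≤ a ^ 2 := by gcongr
      have h2 : κ ^ 2 ≤ b ^ 2 := by gcongr
      nlinarith [mul_le_mul_of_nonneg_right h1 (sq_nonneg (w' 0)),
        mul_le_mul_of_nonneg_right h2 (sq_nonneg (w' 1))]
    have hnorm' : ‖w'‖ ≤ ‖K.2.linear w'‖ / κ := by
      rw [le_div_iff₀ k0, mul_comm]; exact hnorm
    calc |fderiv ℝ (fun z : Plane => MvPolynomial.eval (fun i => z i) q) w w'|
        ≤ ‖fderiv ℝ (fun z : Plane => MvPolynomial.eval (fun i => z i) q) w‖ * ‖w'‖ :=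
          (fderiv ℝ (fun z : Plane => MvPolynomial.eval (fun i => z i) q) w).le_opNorm w'
      _ ≤ (32 * (p : ℝ) ^ 2 * (7 * B)) * (‖K.2.linear w'‖ / κ) := by gcongr
      _ = 224 * (p : ℝ) ^ 2 * B / κ * ‖K.2.linear w'‖ := by ring
  · have hbv : ∀ e ∈ K.2.shape.edges, ∀ t, M.edgeValue G K e t =
        (1 - t) * vertexValue T κ G K e.1 + t * vertexValue T κ G K e.2 := by
      intro e he t
      rw [edgeValue, if_neg (not_subset_frontier_of_corner hσ hκ hΩ hK hc hL he)]
    rcases hcase with ⟨h, h0, hle, hKr⟩ | ⟨hs, hv1, hv2⟩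
    · have hwc := K.2.shape.closedCell_subset_square (K.2.shape.cell_subset_closedCell hw)
      obtain ⟨D, hD, hD'⟩ := exists_hasFDerivAt_of_square (M := M) k0 hG h0 hle.le hKr hbv hwc
      exact ⟨D, hD, fun w' => (hD' w').trans (hmono (by norm_num) (norm_nonneg _))⟩
    · obtain ⟨D, hD, hD'⟩ := exists_hasFDerivAt_of_triangle (M := M) k0 hG hs hbv hv1 hv2 w
      exact ⟨D, hD, fun w' => (hD' w').trans (hmono (by norm_num) (norm_nonneg _))⟩

/-- The gradient of the lifting on the elements that are not large; where the lifting is not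
differentiable, its `fderiv` is zero. -/
theorem norm_fderiv_globalLift_le (hΩ : IsOpen Ω) {Λ : ℝ} (hΛ : T.ShapeRegular Λ) (hp : 1 ≤ p)
    (hv : v ∈ M.S p) (hGv : ∀ x ∈ frontier M.Ω₀, G x = v x) {B : ℝ} (hG : ∀ x, |G x| ≤ B)
    (hK : K ∈ M.elements) (hk : K.2.kind ≠ .large) {w : Plane} (hw : w ∈ K.2.shape.cell) :
    ‖fderiv ℝ (M.globalLift G) (T.elementMap K w)‖ ≤ 224 * (p : ℝ) ^ 2 * B / κ * |Λ| := by
  have hB : 0 ≤ B := (abs_nonneg _).trans (hG 0)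
  have k0 := hκ.1
  by_cases hd : DifferentiableAt ℝ (M.globalLift G) (T.elementMap K w)
  swap
  · rw [fderiv_zero_of_not_differentiableAt hd, norm_zero]; positivity
  have hwc := K.2.shape.cell_subset_closedCell hw
  obtain ⟨D, hD, hD'⟩ := exists_hasFDerivAt_elementLift hσ hκ hΩ hp hv hGv hG hK hk hw
  have hf := (hasStrictFDerivAt_elementMap hσ hκ hK hwc).hasFDerivAt
  have hcomp := hd.hasFDerivAt.comp w hf
  have heq : (M.globalLift G) ∘ (T.elementMap K) =ᶠ[𝓝 w] M.elementLift G K :=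
    eventually_of_mem (K.2.shape.isOpen_cell.mem_nhds hw) fun z hz =>
      globalLift_elementMap hσ hκ hΩ hK (K.2.shape.cell_subset_closedCell hz)
  have hDe := hD.unique (hcomp.congr_of_eventuallyEq heq.symm)
  refine ContinuousLinearMap.opNorm_le_bound _ (by positivity) fun y => ?_
  obtain ⟨w', rfl⟩ := LinearMap.injective_iff_surjective.1 (derivative_injective hσ hκ hK hwc) y
  have h1 := hD' w'
  rw [hDe] at h1
  have h2 := (hΛ K.1 _ (map_mem_square hσ hκ hK hwc) (K.2.linear w')).2
  calc ‖fderiv ℝ (M.globalLift G) (T.elementMap K w)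
        (fderiv ℝ (T.F K.1) (K.2.map w) (K.2.linear w'))‖
      ≤ 224 * (p : ℝ) ^ 2 * B / κ * ‖K.2.linear w'‖ := h1
    _ ≤ 224 * (p : ℝ) ^ 2 * B / κ *
        (|Λ| * ‖fderiv ℝ (T.F K.1) (K.2.map w) (K.2.linear w')‖) := by
        gcongr
        exact h2.trans (by gcongr; exact le_abs_self Λ)
    _ = _ := by rw [← mul_assoc]; rfl

end SpectralBoundaryLayerMesh
end HpFEM

namespace HpFEM

/-! ### Norms of the lifting on the layer -/

theorem exists_abs_det_le (Λ : ℝ) :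
    ∃ d : ℝ, 0 ≤ d ∧ ∀ A : Plane →L[ℝ] Plane, ‖A‖ ≤ Λ → |A.det| ≤ d := by
  have hc : IsCompact (Metric.closedBall (0 : Plane →L[ℝ] Plane) Λ) := isCompact_closedBall 0 Λ
  obtain ⟨d, hd⟩ := hc.exists_bound_of_continuousOn
    (f := fun A : Plane →L[ℝ] Plane => A.det) ContinuousLinearMap.continuous_det.continuousOn
  exact ⟨max d 0, le_max_right _ _, fun A hA => (hd A (by simpa using hA)).trans (le_max_left _ _)⟩

theorem volume_box (a b : ℝ) :
    volume {z : Plane | z 0 ∈ Icc 0 a ∧ z 1 ∈ Icc 0 b} = ENNReal.ofReal a * ENNReal.ofReal b := by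
  have h := (PiLp.volume_preserving_ofLp (Fin 2)).measure_preimage
    (s := Set.pi univ ![Icc 0 a, Icc 0 b]) (MeasurableSet.univ_pi (by
      intro i; fin_cases i <;> exact measurableSet_Icc)).nullMeasurableSet
  have e : {z : Plane | z 0 ∈ Icc 0 a ∧ z 1 ∈ Icc 0 b} =
      WithLp.ofLp ⁻¹' (Set.pi univ ![Icc 0 a, Icc 0 b]) := by
    ext z
    simp [Set.mem_pi, Fin.forall_fin_two]
  rw [e, h, volume_pi_pi]
  simp [Fin.prod_univ_two]

/-- The strip of width `κ` along the bottom and the left edge of the square. -/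
def strip (κ : ℝ) : Set Plane := Shape.square.closedCell ∩ {z | z 0 ≤ κ ∨ z 1 ≤ κ}

theorem measurableSet_strip (κ : ℝ) : MeasurableSet (strip κ) := by
  refine (Shape.square.isClosed_closedCell.inter ?_).measurableSet
  exact (isClosed_le (continuous_coord 0) continuous_const).union
    (isClosed_le (continuous_coord 1) continuous_const)

theorem volume_strip_le {κ : ℝ} (hκ : 0 ≤ κ) : volume (strip κ) ≤ ENNReal.ofReal (2 * κ) := by
  have hsub : strip κ ⊆ {z : Plane | z 0 ∈ Icc 0 κ ∧ z 1 ∈ Icc 0 1} ∪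
      {z : Plane | z 0 ∈ Icc 0 1 ∧ z 1 ∈ Icc 0 κ} := by
    rintro z ⟨⟨h1, h2, h3, h4⟩, h | h⟩
    · exact Or.inl ⟨⟨h1, h⟩, h3, h4⟩
    · exact Or.inr ⟨⟨h1, h2⟩, h3, h⟩
  refine (measure_mono hsub).trans ((measure_union_le _ _).trans ?_)
  rw [volume_box, volume_box, ENNReal.ofReal_one, mul_one, one_mul, two_mul,
    ENNReal.ofReal_add hκ hκ]

theorem MacroTriangulation.volume_image_strip_le {Ω : Set Plane} {n : ℕ}
    {T : MacroTriangulation Ω n} {Λ d κ : ℝ} (hΛ : T.ShapeRegular Λ) (hκ : 0 ≤ κ)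
    (hd : ∀ A : Plane →L[ℝ] Plane, ‖A‖ ≤ |Λ| → |A.det| ≤ d) (i : Fin n) :
    volume (T.F i '' strip κ) ≤ ENNReal.ofReal d * ENNReal.ofReal (2 * κ) := by
  have hder : ∀ z ∈ strip κ, HasFDerivWithinAt (T.F i) (fderiv ℝ (T.F i) z) (strip κ) z :=
    fun z hz => ((T.analytic i z hz.1).differentiableAt.hasFDerivAt).hasFDerivWithinAt
  refine (addHaar_image_le_lintegral_abs_det_fderiv volume (measurableSet_strip κ) hder).trans ?_
  calc ∫⁻ z in strip κ, ENNReal.ofReal |(fderiv ℝ (T.F i) z).det|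
      ≤ ∫⁻ _ in strip κ, ENNReal.ofReal d := by
        refine setLIntegral_mono' (measurableSet_strip κ) fun z hz => ENNReal.ofReal_le_ofReal ?_
        refine hd _ (ContinuousLinearMap.opNorm_le_bound _ (abs_nonneg _) fun w => ?_)
        exact ((hΛ i z hz.1 w).1).trans (by gcongr; exact le_abs_self Λ)
    _ = ENNReal.ofReal d * volume (strip κ) := by rw [setLIntegral_const]
    _ ≤ _ := by gcongr; exact volume_strip_le hκ

namespace SpectralBoundaryLayerMesh

variable {Ω : Set Plane} {n : ℕ} {T : MacroTriangulation Ω n} {σ κ : ℝ} {L : Fin n → ℕ}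
  {M : SpectralBoundaryLayerMesh T σ κ L} (hσ : σ ∈ Ioo (0 : ℝ) 1)
  (hκ : κ ∈ Ioc (0 : ℝ) (1 / 2)) {K : Fin n × PatchElement} {x : Plane} {G v : Plane → ℝ} {p : ℕ}

include hσ hκ

theorem volume_diff_le (hΩ : IsOpen Ω) {Λ d : ℝ} (hΛ : T.ShapeRegular Λ) (hd0 : 0 ≤ d)
    (hd : ∀ A : Plane →L[ℝ] Plane, ‖A‖ ≤ |Λ| → |A.det| ≤ d) :
    volume (Ω \ M.Ω₀) ≤ ENNReal.ofReal (2 * n * d * κ) := by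
  have hsub : Ω \ M.Ω₀ ⊆ ⋃ i, T.F i '' strip κ := by
    intro x hx
    obtain ⟨K, hK, hk, w, hw, rfl⟩ := exists_not_large_of_mem_diff hσ hκ hΩ hx
    exact mem_iUnion.2 ⟨K.1, K.2.map w, ⟨map_mem_square hσ hκ hK hw,
      (M.isPatternElement hσ hκ hK).le_or_le_of_not_large hκ.1 hk hw⟩, rfl⟩
  calc volume (Ω \ M.Ω₀) ≤ ∑ i, volume (T.F i '' strip κ) :=
        (measure_mono hsub).trans (measure_iUnion_fintype_le _ _)
    _ ≤ ∑ _i : Fin n, ENNReal.ofReal d * ENNReal.ofReal (2 * κ) :=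
        Finset.sum_le_sum fun i _ => MacroTriangulation.volume_image_strip_le hΛ hκ.1.le hd i
    _ = ENNReal.ofReal (2 * n * d * κ) := by
        rw [Finset.sum_const, Finset.card_univ, Fintype.card_fin, nsmul_eq_mul,
          ← ENNReal.ofReal_natCast, ← ENNReal.ofReal_mul hd0, ← ENNReal.ofReal_mul (by positivity)]
        congr 1; ring

/-- Up to a null set, the layer consists of the interiors of the elements that are not large. -/
theorem ae_exists_cell (hΩ : IsOpen Ω) : ∀ᵐ x ∂volume.restrict (Ω \ M.Ω₀),
    ∃ K ∈ M.elements, K.2.kind ≠ .large ∧ ∃ w ∈ K.2.shape.cell, T.elementMap K w = x := by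
  have hmeas : MeasurableSet (Ω \ M.Ω₀) := hΩ.measurableSet.diff isOpen_interior.measurableSet
  have hnull : volume (⋃ K ∈ M.elements, T.elementMap K '' (K.2.shape.closedCell \ K.2.shape.cell)) =
      0 := by
    refine (measure_biUnion_null_iff M.finite_elements.countable).2 fun K hK => ?_
    refine addHaar_image_eq_zero_of_differentiableOn_of_addHaar_eq_zero volume (fun w hw => ?_)
      K.2.shape.volume_closedCell_diff
    exact (hasStrictFDerivAt_elementMap hσ hκ hK hw.1).hasFDerivAt.differentiableAt.differentiableWithinAt
  rw [ae_restrict_iff' hmeas]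
  filter_upwards [compl_mem_ae_iff.2 hnull] with x hx hxd
  obtain ⟨K, hK, hk, w, hw, rfl⟩ := exists_not_large_of_mem_diff hσ hκ hΩ hxd
  refine ⟨K, hK, hk, w, ?_, rfl⟩
  by_contra hwc
  exact hx (mem_biUnion hK (mem_image_of_mem _ ⟨hw, hwc⟩))

/-- The three norms of the lifting of data bounded by `B`. -/
theorem norms_globalLift_le (hΩ : IsOpen Ω) (hb : Bornology.IsBounded Ω) {Λ d : ℝ}
    (hΛ : T.ShapeRegular Λ) (hd0 : 0 ≤ d)
    (hd : ∀ A : Plane →L[ℝ] Plane, ‖A‖ ≤ |Λ| → |A.det| ≤ d) (hp : 1 ≤ p) (hv : v ∈ M.S p)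
    (hGv : ∀ x ∈ frontier M.Ω₀, G x = v x) (hG0 : ∀ x ∉ frontier M.Ω₀, G x = 0) {B : ℝ}
    (hG : ∀ x, |G x| ≤ B) :
    eLpNorm (M.globalLift G) ∞ (volume.restrict Ω) ≤ ENNReal.ofReal (7 * B) ∧
    h1Seminorm Ω (Ω \ M.Ω₀) (M.globalLift G) ≤
      ENNReal.ofReal ((2 * n * d * κ) ^ (1 / 2 : ℝ) * (224 * (p : ℝ) ^ 2 * B / κ * |Λ|)) ∧
    eLpNorm (M.globalLift G) 2 (volume.restrict (Ω \ M.Ω₀)) ≤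
      ENNReal.ofReal ((2 * n * d * κ) ^ (1 / 2 : ℝ) * (7 * B)) := by
  have k0 := hκ.1.le
  have hV0 : 0 ≤ 2 * n * d * κ := by positivity
  have hV : (volume.restrict (Ω \ M.Ω₀)) univ ^ (2 : ℝ≥0∞).toReal⁻¹ ≤
      ENNReal.ofReal ((2 * n * d * κ) ^ (1 / 2 : ℝ)) := by
    rw [Measure.restrict_apply_univ, ← ENNReal.ofReal_rpow_of_nonneg hV0 (by norm_num)]
    have h2 : (2 : ℝ≥0∞).toReal⁻¹ = (1 / 2 : ℝ) := by norm_num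
    rw [h2]
    gcongr
    exact volume_diff_le hσ hκ hΩ hΛ hd0 hd
  have hu : ∀ x, ‖M.globalLift G x‖ ≤ 7 * B := abs_globalLift_le hσ hκ hΩ hG
  obtain ⟨A, hA⟩ := exists_lipschitzWith_globalLift hσ hκ hΩ hp hv hGv hG0
  have hsob := lipschitz_mem_sobolev hΩ hb hA fun x hx => globalLift_eq_zero hσ hκ hΩ hG0 hx
  refine ⟨eLpNormEssSup_le_of_ae_bound (Eventually.of_forall hu), ?_, ?_⟩
  · refine (iInf₂_le _ hsob.1).trans ?_
    have hgrad : ∀ᵐ x ∂volume.restrict (Ω \ M.Ω₀), ‖truncGradient (M.globalLift G) x‖ ≤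
        224 * (p : ℝ) ^ 2 * B / κ * |Λ| := by
      filter_upwards [ae_exists_cell (M := M) hσ hκ hΩ] with x hx
      obtain ⟨K, hK, hk, w, hw, rfl⟩ := hx
      exact (norm_truncGradient_le _ _).trans
        (norm_fderiv_globalLift_le hσ hκ hΩ hΛ hp hv hGv hG hK hk hw)
    refine (eLpNorm_le_of_ae_bound hgrad).trans ?_
    rw [ENNReal.ofReal_mul (Real.rpow_nonneg hV0 _)]
    exact mul_le_mul_left hV _
  · refine (eLpNorm_le_of_ae_bound (Eventually.of_forall hu)).trans ?_
    rw [ENNReal.ofReal_mul (Real.rpow_nonneg hV0 _)]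
    exact mul_le_mul_left hV _

omit hσ hκ in
open Classical in
/-- The extension by zero of a function on the boundary of `Ω₀`. -/
def extend (M : SpectralBoundaryLayerMesh T σ κ L) (g : frontier M.Ω₀ → ℝ) (x : Plane) : ℝ :=
  if h : x ∈ frontier M.Ω₀ then g ⟨x, h⟩ else 0

omit hσ hκ in
theorem extend_of_mem (g : frontier M.Ω₀ → ℝ) (hx : x ∈ frontier M.Ω₀) :
    M.extend g x = g ⟨x, hx⟩ := dif_pos hx

omit hσ hκ in
theorem extend_of_notMem (g : frontier M.Ω₀ → ℝ) (hx : x ∉ frontier M.Ω₀) :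
    M.extend g x = 0 := dif_neg hx

/-- The lifting operator `𝓛₀`. -/
def lifting (M : SpectralBoundaryLayerMesh T σ κ L) (hΩ : IsOpen Ω) (hb : Bornology.IsBounded Ω)
    (hp : 1 ≤ p) : M.traceSpace p →ₗ[ℝ] M.S₀ p where
  toFun g := ⟨M.globalLift (M.extend g), by
    obtain ⟨v, hv, hvg⟩ := g.2
    refine globalLift_mem hσ hκ hΩ hb hp hv.1 (fun x hx => ?_) fun x hx => extend_of_notMem _ hx
    rw [extend_of_mem _ hx, ← hvg]
    rfl⟩
  map_add' g g' := by
    refine Subtype.ext (funext fun x => ?_)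
    refine Eq.trans ?_ (globalLift_add (M.extend g) (M.extend g') x)
    refine congrArg (fun G => M.globalLift G x) (funext fun y => ?_)
    by_cases hy : y ∈ frontier M.Ω₀
    · simp only [extend_of_mem _ hy]; rfl
    · simp only [extend_of_notMem _ hy, add_zero]
  map_smul' r g := by
    refine Subtype.ext (funext fun x => ?_)
    refine Eq.trans ?_ (globalLift_mul r (M.extend g) x)
    refine congrArg (fun G => M.globalLift G x) (funext fun y => ?_)
    by_cases hy : y ∈ frontier M.Ω₀
    · simp only [extend_of_mem _ hy]; rfl
    · simp only [extend_of_notMem _ hy, mul_zero]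

theorem restrict_lifting (hΩ : IsOpen Ω) (hb : Bornology.IsBounded Ω) (hp : 1 ≤ p)
    (g : M.traceSpace p) : M.restrict (M.lifting hσ hκ hΩ hb hp g) = g := by
  funext x
  exact (globalLift_of_mem_frontier hσ hκ hΩ x.2).trans (extend_of_mem _ x.2)

/-- The trace of a finite element function is bounded. -/
theorem boundarySup_ne_top (hΩ : IsOpen Ω) (hb : Bornology.IsBounded Ω) (hv : v ∈ M.S p) :
    M.boundarySup (M.restrict v) ≠ ⊤ := by
  have hcl : IsCompact (closure Ω) := hb.isCompact_closure
  obtain ⟨C, hC⟩ := hcl.exists_bound_of_continuousOn hv.2.1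
  refine ne_top_of_le_ne_top (ENNReal.ofReal_ne_top (r := C)) (iSup_le fun x => ?_)
  rw [← ofReal_norm]
  exact ENNReal.ofReal_le_ofReal
    (hC x (subset_closure (frontier_Ω₀_subset (M := M) hσ hκ hΩ x.2)))

end SpectralBoundaryLayerMesh

/-- Balancing the three contributions, with `s = ε^{1/2}`, `k = κ^{1/2}`: the supremum of the
lifting is absorbed by means of `s / k + k / s ≥ 1`. -/
theorem sum_norms_le {s k r B P Λ : ℝ} (hs : 0 < s) (hk : 0 < k) (hr : 0 ≤ r) (hB : 0 ≤ B)
    (hP : 1 ≤ P) (hΛ : 0 ≤ Λ) :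
    7 * B + (s * (r * k * (224 * P * B / k ^ 2 * Λ)) + s⁻¹ * (r * k * (7 * B))) ≤
      (7 + 224 * r * Λ + 7 * r) * (P * (s / k) + k / s) * B := by
  have hsk : 0 < s / k := by positivity
  have hks : 0 < k / s := by positivity
  have h1 : 1 ≤ s / k + k / s := by
    have : s / k * (k / s) = 1 := by field_simp
    nlinarith [sq_nonneg (s / k - k / s)]
  have h2 : 1 ≤ P * (s / k) + k / s := by nlinarith
  have e1 : s * (r * k * (224 * P * B / k ^ 2 * Λ)) = 224 * r * Λ * (P * (s / k)) * B := by
    field_simp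
  have e2 : s⁻¹ * (r * k * (7 * B)) = 7 * r * (k / s) * B := by
    field_simp
  rw [e1, e2]
  have h3 : 0 ≤ 224 * r * Λ * (k / s) * B := by positivity
  have h4 : 0 ≤ 7 * r * (P * (s / k)) * B := by positivity
  nlinarith [mul_le_mul_of_nonneg_right h2 hB]

end HpFEM

end

theorem mainTheorem5 (n : ℕ) (Λ : ℝ) :
    ∃ C : ℝ, 0 < C ∧
      ∀ (Ω : Set HpFEM.Plane), HpFEM.IsBoundedLipschitzDomain Ω →
      ∀ (T : HpFEM.MacroTriangulation Ω n), T.ShapeRegular Λ →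
      ∀ (σ κ : ℝ), σ ∈ Set.Ioo (0 : ℝ) 1 → κ ∈ Set.Ioc (0 : ℝ) (1 / 2) →
      ∀ (L : Fin n → ℕ) (M : HpFEM.SpectralBoundaryLayerMesh T σ κ L) (p : ℕ), 1 ≤ p →
        ∃ Lift : M.traceSpace p →ₗ[ℝ] M.S₀ p,
          (∀ g : M.traceSpace p, M.restrict (Lift g) = g) ∧
          ∀ ε ∈ Set.Ioc (0 : ℝ) 1,
            M.liftingNorm p ε Lift ≤ M.liftingNormPlus p ε Lift ∧
            M.liftingNormPlus p ε Lift ≤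
              ENNReal.ofReal (C * ((p : ℝ) ^ 2 * (ε ^ (1 / 2 : ℝ) / κ ^ (1 / 2 : ℝ)) +
                κ ^ (1 / 2 : ℝ) / ε ^ (1 / 2 : ℝ))) := by
  obtain ⟨d, hd0, hd⟩ := HpFEM.exists_abs_det_le |Λ|
  set r : ℝ := (2 * n * d) ^ (1 / 2 : ℝ) with hr
  have hr0 : 0 ≤ r := by positivity
  refine ⟨7 + 224 * r * |Λ| + 7 * r, by positivity, ?_⟩
  intro Ω hΩ T hΛ σ κ hσ hκ L M p hp
  refine ⟨M.lifting hσ hκ hΩ.isOpen hΩ.isBounded hp,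
    HpFEM.SpectralBoundaryLayerMesh.restrict_lifting hσ hκ hΩ.isOpen hΩ.isBounded hp, ?_⟩
  rintro ε ⟨ε0, -⟩
  constructor
  · exact iSup₂_mono fun v _ => ENNReal.div_le_div_right le_add_self _
  refine iSup₂_le fun v _ => ENNReal.div_le_of_le_mul ?_
  have hfin := HpFEM.SpectralBoundaryLayerMesh.boundarySup_ne_top (M := M) hσ hκ hΩ.isOpen
    hΩ.isBounded v.2.1
  set B : ℝ := (M.boundarySup (M.restrict v)).toReal with hB
  have hBe : M.boundarySup (M.trace p v) = ENNReal.ofReal B := (ENNReal.ofReal_toReal hfin).symm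
  have hG : ∀ x, |M.extend (M.restrict v) x| ≤ B := by
    intro x
    by_cases hx : x ∈ frontier M.Ω₀
    · rw [HpFEM.SpectralBoundaryLayerMesh.extend_of_mem _ hx, ← Real.norm_eq_abs,
        ← toReal_enorm]
      exact ENNReal.toReal_mono hfin (le_iSup (fun x => ‖M.restrict v x‖ₑ) ⟨x, hx⟩)
    · rw [HpFEM.SpectralBoundaryLayerMesh.extend_of_notMem _ hx, abs_zero]
      exact ENNReal.toReal_nonneg
  obtain ⟨h1, h2, h3⟩ := HpFEM.SpectralBoundaryLayerMesh.norms_globalLift_le (M := M) hσ hκ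
    hΩ.isOpen hΩ.isBounded hΛ hd0 hd hp v.2.1
    (fun x hx => HpFEM.SpectralBoundaryLayerMesh.extend_of_mem (M.restrict v) hx)
    (fun x hx => HpFEM.SpectralBoundaryLayerMesh.extend_of_notMem (M.restrict v) hx) hG
  have k0 := hκ.1
  have hB0 : 0 ≤ B := ENNReal.toReal_nonneg
  set s : ℝ := ε ^ (1 / 2 : ℝ) with hs
  set k : ℝ := κ ^ (1 / 2 : ℝ) with hk
  have s0 : 0 < s := Real.rpow_pos_of_pos ε0 _
  have kk : 0 < k := Real.rpow_pos_of_pos k0 _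
  have hsi : ε ^ (-(1 / 2) : ℝ) = s⁻¹ := Real.rpow_neg ε0.le _
  have hk2 : κ = k ^ 2 := by
    rw [hk, ← Real.rpow_natCast, ← Real.rpow_mul k0.le]; norm_num
  have hrk : (2 * n * d * κ) ^ (1 / 2 : ℝ) = r * k := Real.mul_rpow (by positivity) k0.le
  rw [hrk] at h2 h3
  rw [hBe, ← ENNReal.ofReal_mul (by positivity)]
  calc _ ≤ ENNReal.ofReal (7 * B) +
        (ENNReal.ofReal s * ENNReal.ofReal (r * k * (224 * (p : ℝ) ^ 2 * B / κ * |Λ|)) +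
          ENNReal.ofReal s⁻¹ * ENNReal.ofReal (r * k * (7 * B))) := by
        rw [← hsi]
        exact add_le_add h1 (add_le_add (mul_le_mul_right h2 _) (mul_le_mul_right h3 _))
    _ = ENNReal.ofReal (7 * B + (s * (r * k * (224 * (p : ℝ) ^ 2 * B / κ * |Λ|)) +
          s⁻¹ * (r * k * (7 * B)))) := by
        rw [← ENNReal.ofReal_mul s0.le, ← ENNReal.ofReal_mul (by positivity),
          ← ENNReal.ofReal_add (by positivity) (by positivity),
          ← ENNReal.ofReal_add (by positivity) (by positivity)]
    _ ≤ _ := by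
        refine ENNReal.ofReal_le_ofReal ?_
        rw [hk2]
        exact HpFEM.sum_norms_le s0 kk hr0 hB0 (one_le_pow₀ (by exact_mod_cast hp)) (abs_nonneg Λ)
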